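/- Let $p>3$ be prime, $\zeta_p=e^{2\pi i/p}$, and $q=e^{2\pi i z}$ with $\operatorname{Im} z>0$. The crank of a partition is its largest part if it has no ones ($0$ for the empty partition), and otherwise the number of parts larger than the number $\omega$ of ones, minus $\omega$. Let $M(k,p,n)$ be the number of partitions of $n$ with crank congruent to $k$ modulo $p$, where for $n=1$ one uses the usual convention that crank $0$ is counted $-1$ times, the cranks $1$ and $-1$ are counted once each, and no other value is counted (so that $\sum_{n\ge 0}\sum_{k=0}^{p-1}M(k,p,n)\zeta_p^kq^n=\prod_{n\ge1}\frac{1-q^n}{(1-\zeta_pq^n)(1-\zeta_p^{-1}q^n)}$). With $s_p=\frac{p^2-1}{24}$ put $$\mathcal K^{(C)}_{p,0}(\zeta_p,z)=\prod_{n\ge1}(1-q^{pn})\sum_{n\ge\lceil s_p/p\rceil}\Big(\sum_{k=0}^{p-1}M(k,p,pn-s_p)\,\zeta_p^k\Big)q^n .$$ Let $\eta(z)=q^{1/24}\prod_{n\ge1}(1-q^n)$ and $$f_{p,k}(z)=(-1)^{\lfloor k/p\rfloor}q^{(p-2k)^2/(8p)}\prod_{m\ge0}(1-q^{k+pm})(1-q^{p-k+pm})(1-q^{p+pm}).$$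 For $\vec n=(n_0,n_1,\dots,n_{(p-1)/2})\in\mathbb Z^{(p+1)/2}$ put $$j(p,\vec n,z)=\eta(pz)^{n_0}\prod_{k=1}^{(p-1)/2}f_{p,k}(z)^{n_k}.$$ For $1\le r\le\frac{p-1}2$ let $\pi_r$ be the permutation of $\{1,\dots,\frac{p-1}2\}$ with $r\,\pi_r(i)\equiv\pm i\pmod p$, and let $\pi_r(\vec n)=(n_0,n_{\pi_r(1)},\dots,n_{\pi_r((p-1)/2)})$. **Theorem.** Let $\vec n_1,\dots,\vec n_t\in\mathbb Z^{(p+1)/2}$ be such that the functions $j(p,\pi_r(\vec n_k),z)$, indexed by the pairs $(k,r)$ with $1\le k\le t$, $1\le r\le\frac{p-1}2$, are linearly independent over $\mathbb Q$, and suppose that for all $z$ in the upper half-plane $$\mathcal K^{(C)}_{p,0}(\zeta_p,z)=\sum_{k=1}^t\sum_{r=1}^{(p-1)/2}c_{p,r,k}(\zeta_p)\,j(p,\pi_r(\vec n_k),z),$$ where $c_{p,r,k}\in\mathbb Q[X]$. Then for all $1\le k\le t$ and $1\le d\le\frac{p-1}2$, and for all integers $a,b$ with $\begin{pmatrix}a&b\\p&d\end{pmatrix}\in\Gamma_0(p)$,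 that is, $ad-bp=1$, $$c_{p,d,k}(\zeta_p)=\frac{\sin(\pi/p)}{\sin(d\pi/p)}\,(-1)^{d+1+L(\vec n_k,d)}\,c_{p,1,k}(\zeta_p^d),$$ where, for $\vec n=(n_0,\dots,n_{(p-1)/2})$, $$L(\vec n,d)=L(\vec n,a,b,d,p)=bd(1+a)\sum_{i=1}^{(p-1)/2}i\,n_i+\sum_{i=1}^{(p-1)/2}\Big(\Big\lfloor\frac{dia}p\Big\rfloor+\Big\lfloor\frac{di}p\Big\rfloor\Big)n_i .$$ In particular, all coefficients are determined by those with $r=1$, up to a ratio of sines and a sign. -/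

import Mathlib

open scoped UpperHalfPlane

noncomputable section

namespace CrankSymmetry

/-- The primitive root of unity `ζ_p = exp(2πi/p)`. -/
def zeta (p : ℕ) : ℂ := Complex.exp (2 * Real.pi * Complex.I / p)

/-- The power `q^x = exp(2πi x z)` of `q = exp(2πi z)`, for a real exponent `x`. -/
def qpow (x : ℝ) (z : ℍ) : ℂ := Complex.exp (2 * Real.pi * Complex.I * x * z)

/-- The infinite product `(a; q)_∞ = ∏_{k ≥ 0} (1 - a q^k)`. -/
def qPoch (a q : ℂ) : ℂ := ∏' k : ℕ, (1 - a * q ^ k)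

/-! ### The crank -/

/-- The crank of a partition: the largest part if there are no ones (`0` for the empty partition),
and otherwise the number of parts larger than the number of ones, minus the number of ones. -/
def crank {n : ℕ} (P : n.Partition) : ℤ :=
  if P.parts.count 1 = 0 then (P.parts.sup : ℤ)
  else ((P.parts.filter (fun x => P.parts.count 1 < x)).card : ℤ) - (P.parts.count 1 : ℤ)

/-- `M(m, n)`: the number of partitions of `n` with crank `m`, with the usual convention
`M(0, 1) = -1`, `M(1, 1) = M(-1, 1) = 1` (and `M(m, 1) = 0` otherwise), under which
`∑ M(m, n) z^m q^n = (q; q)_∞ / ((z q; q)_∞ (z⁻¹ q; q)_∞)`. -/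
def crankCount (m : ℤ) (n : ℕ) : ℤ :=
  if n = 1 then (if m = 0 then -1 else if m = 1 ∨ m = -1 then 1 else 0)
  else ((Finset.univ.filter (fun P : n.Partition => crank P = m)).card : ℤ)

/-- `M(r, t, n) = ∑_{m ≡ r (mod t)} M(m, n)`: the number of partitions of `n` with crank congruent
to `r` modulo `t` (a partition of `n` has its crank between `-n` and `n`). -/
def crankCountMod (r t n : ℕ) : ℤ :=
  ∑ m ∈ (Finset.Icc (-(n : ℤ)) n).filter (fun m => m ≡ r [ZMOD t]), crankCount m n

/-- `s_p = (p² - 1) / 24`, an integer for each prime `p > 3`. -/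
def sP (p : ℕ) : ℕ := (p ^ 2 - 1) / 24

/-- The element of the crank dissection
`K_{p,m}(ζ_p^ℓ, z) = q^{m/p} ∏_{n ≥ 1} (1 - q^{pn})
  ∑_{n ≥ ⌈(s_p - m)/p⌉} (∑_{k=0}^{p-1} M(k, p, pn + m - s_p) ζ_p^{kℓ}) q^n`. -/
def crankK (p m l : ℕ) (z : ℍ) : ℂ :=
  qpow ((m : ℝ) / p) z * qPoch (qpow p z) (qpow p z) *
    ∑' n : ℕ, if sP p ≤ p * n + m then
      (∑ k ∈ Finset.range p, (crankCountMod k p (p * n + m - sP p) : ℂ) * zeta p ^ (k * l)) *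
        qpow n z
    else 0

/-! ### Generalized eta quotients -/

/-- `f_{N,ρ}(z) = (-1)^⌊ρ/N⌋ q^{(N-2ρ)²/(8N)} (q^ρ, q^{N-ρ}, q^N; q^N)_∞`
(`/` on the integers is the floor of the quotient, as `N > 0`). -/
def biagioliF (N : ℕ) (ρ : ℤ) (z : ℍ) : ℂ :=
  (-1) ^ (ρ / (N : ℤ)) * qpow (((N : ℝ) - 2 * ρ) ^ 2 / (8 * N)) z *
    (qPoch (qpow ρ z) (qpow N z) * qPoch (qpow (N - ρ) z) (qpow N z) *
      qPoch (qpow N z) (qpow N z))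

/-- `j(p, n, z) = η(pz)^{n_0} ∏_{k=1}^{(p-1)/2} f_{p,k}(z)^{n_k}`. The integer vector
`(n_0, …, n_{(p-1)/2})` is given as a function on `ℕ`, of which only these entries are used. -/
def etaQuot (p : ℕ) (n : ℕ → ℤ) (z : ℍ) : ℂ :=
  ModularForm.eta ((p : ℂ) * z) ^ n 0 *
    ∏ k ∈ Finset.Icc 1 ((p - 1) / 2), biagioliF p k z ^ n k

/-- `π_r(i)`: the `i'` in `{1, …, (p-1)/2}` with `r i' ≡ ± i (mod p)`; moreover `π_r(0) = 0`. It is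
the absolute value of the representative of `i r⁻¹` modulo `p` that is smallest in absolute
value. -/
def permIdx (p r i : ℕ) : ℕ := ((i : ZMod p) * (r : ZMod p)⁻¹).valMinAbs.natAbs

/-- The defining property of `π_r`. -/
theorem permIdx_spec {p r i : ℕ} (hp : p.Prime) (h3 : 3 < p)
    (hr : r ∈ Finset.Icc 1 ((p - 1) / 2)) (hi : i ∈ Finset.Icc 1 ((p - 1) / 2)) :
    permIdx p r i ∈ Finset.Icc 1 ((p - 1) / 2) ∧
      ((r : ZMod p) * (permIdx p r i : ZMod p) = i ∨
        (r : ZMod p) * (permIdx p r i : ZMod p) = -i) := by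
  have := Fact.mk hp
  rw [Finset.mem_Icc] at hr hi
  have hr0 : (r : ZMod p) ≠ 0 := by
    rw [Ne, ZMod.natCast_eq_zero_iff]
    exact fun h => absurd (Nat.le_of_dvd (by omega) h) (by omega)
  have hi0 : (i : ZMod p) ≠ 0 := by
    rw [Ne, ZMod.natCast_eq_zero_iff]
    exact fun h => absurd (Nat.le_of_dvd (by omega) h) (by omega)
  have hodd : p % 2 = 1 := Nat.odd_iff.mp (hp.odd_of_ne_two (by omega))
  refine ⟨?_, ?_⟩
  · rw [Finset.mem_Icc]
    have h1 := ZMod.natAbs_valMinAbs_le ((i : ZMod p) * (r : ZMod p)⁻¹)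
    have h2 : permIdx p r i ≠ 0 := by
      unfold permIdx
      rw [Ne, Int.natAbs_eq_zero, ZMod.valMinAbs_eq_zero]
      exact mul_ne_zero hi0 (inv_ne_zero hr0)
    unfold permIdx at h2 ⊢
    omega
  · unfold permIdx
    rw [ZMod.natCast_natAbs_valMinAbs]
    split_ifs
    · left; field_simp
    · right; field_simp

/-- The vector `π_r(n)`, with `0`-th entry `n_0` and `i`-th entry `n_{π_r(i)}` for `i ≥ 1`; thus
`j(p, π_r(n), z) = η(pz)^{n_0} ∏_{k=1}^{(p-1)/2} f_{p,rk}(z)^{n_k}`. -/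
def vecPerm (p r : ℕ) (n : ℕ → ℤ) : ℕ → ℤ := fun i => n (permIdx p r i)

/-- `L(n, a, b, d, p) = b d (1 + a) ∑ k n_k + ∑ (⌊d k a / p⌋ + ⌊d k / p⌋) n_k`, both sums over
`1 ≤ k ≤ (p-1)/2` (`/` on the integers is the floor of the quotient, as `p > 0`). -/
def signL (n : ℕ → ℤ) (a b : ℤ) (d p : ℕ) : ℤ :=
  b * d * (1 + a) * ∑ k ∈ Finset.Icc 1 ((p - 1) / 2), (k : ℤ) * n k +
    ∑ k ∈ Finset.Icc 1 ((p - 1) / 2),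
      (((d : ℤ) * k * a) / (p : ℤ) + ((d : ℤ) * k) / (p : ℤ)) * n k

end CrankSymmetry

end

/-! Write K(ζ^l, z) for the dissection element at ζ^l, where ζ = ζ_p. The crank generating function
at ζ^l is (q;q)/((ζ^l q;q)(ζ^{-l} q;q)) (Andrews and Garvan, `hasSum_crankCoeff`). Multiplied by
q^{s_p} (q^{p²};q^{p²}), it is 2i sin(πl/p) times the quotient of η(p²τ)/η(τ) by φ(l/p, τ), where φ
= θ/η³ is a Jacobi form of weight -1 and index 1/2. K(ζ^l, z) is the average of this kernel over the
points τ = (z+m)/p (`crankK_eq_sum`). Now φ obeys its law under SL(2,ℤ) without multiplier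
(`phiLaw`), and η(p²τ)/η(τ) is invariant under matrices with lower left entry p² (`etaRatio_smul`).
Hence A = (a b; p d) carries K(ζ, ·) to K(ζ^d, ·), with automorphy factor pz+d, the sign (-1)^{d+1}
and the ratio of sines (`crankK_smul`).

Two facts turn this into a statement on coefficients. First, the quotients j have rational
expansions, so the given relation may be conjugated by ζ ↦ ζ^d: K(ζ^d, z) is the same combination
with coefficients c(ζ^d) (`crankK_conj`). Secondly, f_{p,k} is -η(pz)³ times a theta function that
is odd and antiperiodic modulo p in k, and A multiplies the index by a ≡ d⁻¹. So A sends j(p,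
π_r(n)) to j(p, π_s(n)) with ds ≡ ±r, up to a constant and a power of pz+d. For r = d this gives s =
1 and the constant is (-1)^L (`etaQuot_vecPerm_smul_self`).

Evaluating the relation at Az and comparing coefficients of j(p, π_1(n_k)) gives the theorem
(`aeval_zeta_eq`). Independence over ℂ follows from independence over ℚ because the expansions are
rational. Neither modularity nor weight 1 of the j is assumed. Since K is invariant under z ↦ z+1,
so is each j that occurs; this forces 24 ∣ n_0 + 3∑n_k and p ∣ ∑k²n_k (`dvd_cuspOrder_iff`), which
is what makes the multipliers computable. The substitutions z ↦ z+N then separate the powers of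
pz+d. -/

open scoped UpperHalfPlane

noncomputable section

namespace CrankSymmetry

open Filter Topology Finset

/-! ### Infinite products -/

lemma summable_norm_mul_pow (a : ℂ) {q : ℂ} (hq : ‖q‖ < 1) :
    Summable fun k : ℕ => ‖-(a * q ^ k)‖ := by
  simpa using (summable_geometric_of_lt_one (norm_nonneg _) hq).mul_left ‖a‖

lemma multipliable_qPoch (a : ℂ) {q : ℂ} (hq : ‖q‖ < 1) :
    Multipliable fun k : ℕ => (1 - a * q ^ k) := by
  simpa [sub_eq_add_neg] using multipliable_one_add_of_summable (summable_norm_mul_pow a hq)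

lemma tendsto_qPoch (a : ℂ) {q : ℂ} (hq : ‖q‖ < 1) :
    Tendsto (fun N => ∏ k ∈ range N, (1 - a * q ^ k)) atTop (𝓝 (qPoch a q)) :=
  (multipliable_qPoch a hq).hasProd.tendsto_prod_nat

lemma qPoch_ne_zero {a q : ℂ} (hq : ‖q‖ < 1) (h : ∀ k : ℕ, a * q ^ k ≠ 1) : qPoch a q ≠ 0 := by
  have := tprod_one_add_ne_zero_of_summable (f := fun k : ℕ => -(a * q ^ k))
    (fun i => by
      rw [← sub_eq_add_neg, sub_ne_zero]
      exact (h i).symm) (summable_norm_mul_pow a hq)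
  simpa [qPoch, sub_eq_add_neg] using this

lemma qPoch_ne_zero_of_norm_lt {a q : ℂ} (hq : ‖q‖ < 1) (h : ‖a‖ < 1) : qPoch a q ≠ 0 := by
  refine qPoch_ne_zero hq fun k hk => ?_
  have h1 : ‖a * q ^ k‖ = 1 := by rw [hk]; simp
  rw [norm_mul, norm_pow] at h1
  have h2 : ‖q‖ ^ k ≤ 1 := pow_le_one₀ (norm_nonneg _) hq.le
  nlinarith [norm_nonneg a, pow_nonneg (norm_nonneg q) k]

lemma qPoch_succ (a : ℂ) {q : ℂ} (hq : ‖q‖ < 1) : qPoch a q = (1 - a) * qPoch (a * q) q := by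
  have h := (multipliable_qPoch (a * q) hq)
  have h1 : (fun k : ℕ => (1 - a * q * q ^ k)) = fun k => (1 - a * q ^ (k + 1)) := by
    ext k; ring
  rw [h1] at h
  rw [qPoch, tprod_eq_zero_mul' (f := fun k : ℕ => (1 - a * q ^ k)) h, qPoch, h1]
  simp

lemma qPoch_eq_prod_mul (a : ℂ) {q : ℂ} (hq : ‖q‖ < 1) (n : ℕ) :
    qPoch a q = (∏ k ∈ range n, (1 - a * q ^ k)) * qPoch (a * q ^ n) q := by
  induction n with
  | zero => simp
  | succ n ih =>
    rw [ih, prod_range_succ, qPoch_succ (a * q ^ n) hq, pow_succ]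
    ring_nf

lemma qPoch_zero (q : ℂ) : qPoch 0 q = 1 := by simp [qPoch]

/-- The finite product `(a; q)_n`. -/
def qPochN (a q : ℂ) (n : ℕ) : ℂ := ∏ k ∈ range n, (1 - a * q ^ k)

lemma qPochN_succ (a q : ℂ) (n : ℕ) : qPochN a q (n + 1) = qPochN a q n * (1 - a * q ^ n) :=
  prod_range_succ _ _

lemma qPochN_zero (a q : ℂ) : qPochN a q 0 = 1 := by simp [qPochN]

lemma one_sub_pow_ne_zero {q : ℂ} (hq : ‖q‖ < 1) (n : ℕ) : 1 - q ^ (n + 1) ≠ 0 := by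
  intro h
  have h1 : q ^ (n + 1) = 1 := (sub_eq_zero.mp h).symm
  have h2 : ‖q‖ ^ (n + 1) = 1 := by rw [← norm_pow, h1, norm_one]
  exact (pow_lt_one₀ (norm_nonneg _) hq (by omega)).ne h2

lemma qPochN_self_ne_zero {q : ℂ} (hq : ‖q‖ < 1) (n : ℕ) : qPochN q q n ≠ 0 := by
  refine prod_ne_zero_iff.mpr fun k _ => ?_
  rw [← pow_succ']
  exact one_sub_pow_ne_zero hq k

lemma qPoch_self_ne_zero {q : ℂ} (hq : ‖q‖ < 1) : qPoch q q ≠ 0 := qPoch_ne_zero_of_norm_lt hq hq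

lemma bddAbove_norm_of_tendsto {u : ℕ → ℂ} {l : ℂ} (h : Tendsto u atTop (𝓝 l)) :
    ∃ C : ℝ, ∀ n, ‖u n‖ ≤ C := by
  obtain ⟨C, hC⟩ := (Metric.isBounded_range_of_tendsto u h).exists_norm_le
  exact ⟨C, fun n => hC _ ⟨n, rfl⟩⟩

/-- Dominated convergence. This closes the iteration of a functional equation relating F(x) to
F(xq), in the q-binomial theorem and in Euler's expansion. -/
lemma tendsto_tsum_mul_pow {e : ℕ → ℂ} {r : ℝ}
    (hs : Summable fun n => ‖e n‖ * r ^ n) {q t : ℂ} (hq : ‖q‖ < 1) (ht : ‖t‖ ≤ r) :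
    Tendsto (fun N => ∑' n, e n * (t * q ^ N) ^ n) atTop (𝓝 (e 0)) := by
  have h1 : e 0 = ∑' n, (if n = 0 then e 0 else 0) := by simp
  rw [h1]
  refine tendsto_tsum_of_dominated_convergence hs (fun n => ?_) (Eventually.of_forall fun N n => ?_)
  · rcases Nat.eq_zero_or_pos n with rfl | hn
    · simp
    · rw [if_neg hn.ne']
      have h2 : Tendsto (fun N : ℕ => q ^ N) atTop (𝓝 0) := tendsto_pow_atTop_nhds_zero_of_norm_lt_one hq
      have h3 : Tendsto (fun N : ℕ => e n * (t * q ^ N) ^ n) atTop (𝓝 (e n * (t * 0) ^ n)) :=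
        ((h2.const_mul t).pow n).const_mul (e n)
      simpa [hn.ne'] using h3
  · rw [norm_mul, norm_pow, norm_mul, norm_pow]
    gcongr
    calc ‖t‖ * ‖q‖ ^ N ≤ ‖t‖ * 1 := by
          gcongr; exact pow_le_one₀ (norm_nonneg _) hq.le
      _ ≤ r := by simpa using ht

/-- The `q`-binomial theorem. -/
lemma hasSum_qBinomial (a : ℂ) {q t : ℂ} (hq : ‖q‖ < 1) (ht : ‖t‖ < 1) :
    HasSum (fun n => qPochN a q n / qPochN q q n * t ^ n) (qPoch (a * t) q / qPoch t q) := by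
  set e : ℕ → ℂ := fun n => qPochN a q n / qPochN q q n with he
  have hlim : Tendsto e atTop (𝓝 (qPoch a q / qPoch q q)) :=
    (tendsto_qPoch a hq).div (tendsto_qPoch q hq) (qPoch_self_ne_zero hq)
  obtain ⟨C, hC⟩ := bddAbove_norm_of_tendsto hlim
  have hsum : ∀ r : ℝ, 0 ≤ r → r < 1 → Summable fun n => ‖e n‖ * r ^ n := fun r h0 h1 =>
    Summable.of_nonneg_of_le (fun n => by positivity)
      (fun n => mul_le_mul_of_nonneg_right (hC n) (by positivity))
      ((summable_geometric_of_lt_one h0 h1).mul_left C)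
  have hs : ∀ x : ℂ, ‖x‖ < 1 → Summable fun n => e n * x ^ n := fun x hx =>
    Summable.of_norm (by simpa using hsum ‖x‖ (norm_nonneg _) hx)
  set F : ℂ → ℂ := fun x => ∑' n, e n * x ^ n with hF
  -- Coefficientwise this is the recursion `key` below. Iterating it along t, tq, tq², … produces
  -- the two infinite products, since F(tq^N) tends to e 0 = 1.
  have hrec : ∀ x : ℂ, ‖x‖ < 1 → (1 - x) * F x = (1 - a * x) * F (x * q) := by
    intro x hx
    have hxq : ‖x * q‖ < 1 := by
      rw [norm_mul]; nlinarith [norm_nonneg x, norm_nonneg q]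
    have h0 : ∀ y, ‖y‖ < 1 → F y = e 0 + ∑' n, e (n + 1) * y ^ (n + 1) := by
      intro y hy
      simpa using (hs y hy).tsum_eq_zero_add
    have h1 : ∀ y, ‖y‖ < 1 → y * F y = ∑' n, e n * y ^ (n + 1) := by
      intro y hy
      rw [hF, ← tsum_mul_left]
      exact tsum_congr fun n => by ring
    have s1 : ∀ y, ‖y‖ < 1 → Summable fun n => e (n + 1) * y ^ (n + 1) := fun y hy =>
      (summable_nat_add_iff 1).mpr (hs y hy)
    have s2 : ∀ y, ‖y‖ < 1 → Summable fun n => e n * y ^ (n + 1) := fun y hy => by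
      simpa [pow_succ, mul_assoc] using (hs y hy).mul_right y
    have key : ∀ n, e (n + 1) * (1 - q ^ (n + 1)) = e n * (1 - a * q ^ n) := by
      intro n
      have hA := qPochN_self_ne_zero hq n
      have hB := one_sub_pow_ne_zero hq n
      simp only [he, qPochN_succ, ← pow_succ']
      field_simp
    have h3 : F x - x * F x - F (x * q) + a * x * F (x * q) = 0 := by
      have e2 : a * x * F (x * q) = ∑' n, a * (e n * (x * q) ^ n * x) := by
        rw [hF, ← tsum_mul_left]
        exact tsum_congr fun n => by ring
      have s3 : Summable fun n => a * (e n * (x * q) ^ n * x) := ((hs _ hxq).mul_right x).mul_left a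
      rw [e2, h1 x hx, h0 x hx, h0 _ hxq]
      have : e 0 + ∑' n, e (n + 1) * x ^ (n + 1) - ∑' n, e n * x ^ (n + 1) -
          (e 0 + ∑' n, e (n + 1) * (x * q) ^ (n + 1)) + ∑' n, a * (e n * (x * q) ^ n * x) =
          ∑' n, (e (n + 1) * x ^ (n + 1) - e n * x ^ (n + 1) - e (n + 1) * (x * q) ^ (n + 1) +
            a * (e n * (x * q) ^ n * x)) := by
        rw [Summable.tsum_add (((s1 x hx).sub (s2 x hx)).sub (s1 _ hxq)) s3,
          Summable.tsum_sub ((s1 x hx).sub (s2 x hx)) (s1 _ hxq),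
          Summable.tsum_sub (s1 x hx) (s2 x hx)]
        ring
      rw [this]
      convert! tsum_zero with n
      rw [mul_pow, mul_pow]
      linear_combination x ^ (n + 1) * key n
    linear_combination h3
  have hiter : ∀ N, qPochN t q N * F t = qPochN (a * t) q N * F (t * q ^ N) := by
    intro N
    induction N with
    | zero => simp [qPochN]
    | succ N ih =>
      have hx : ‖t * q ^ N‖ < 1 := by
        rw [norm_mul, norm_pow]
        have := pow_le_one₀ (norm_nonneg q) hq.le (n := N)
        nlinarith [norm_nonneg t, pow_nonneg (norm_nonneg q) N]
      have := hrec _ hx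
      rw [qPochN_succ, qPochN_succ, pow_succ, ← mul_assoc t]
      linear_combination (1 - t * q ^ N) * ih + qPochN (a * t) q N * this
  obtain ⟨r, hr1, hr2⟩ := exists_between ht
  have hlimF : Tendsto (fun N => F (t * q ^ N)) atTop (𝓝 (e 0)) :=
    tendsto_tsum_mul_pow (hsum r ((norm_nonneg t).trans hr1.le) hr2)
      hq hr1.le
  have h8 : qPoch t q * F t = qPoch (a * t) q * e 0 := by
    refine tendsto_nhds_unique ((tendsto_qPoch t hq).mul_const (F t)) ?_
    exact ((tendsto_qPoch (a * t) hq).mul hlimF).congr fun N => (hiter N).symm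
  have h9 : F t = qPoch (a * t) q / qPoch t q := by
    rw [eq_div_iff (qPoch_ne_zero_of_norm_lt hq ht), mul_comm, h8]
    simp [he, qPochN]
  rw [← h9]
  exact (hs t ht).hasSum

/-- Euler's expansion of `1 / (t; q)_∞`. -/
lemma hasSum_euler_inv {q t : ℂ} (hq : ‖q‖ < 1) (ht : ‖t‖ < 1) :
    HasSum (fun n => t ^ n / qPochN q q n) (1 / qPoch t q) := by
  simpa [qPochN, qPoch_zero, div_eq_inv_mul] using hasSum_qBinomial 0 hq ht

/-- The coefficients of Euler's expansion of `(t; q)_∞`. -/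
def eulerCoeff (q : ℂ) (n : ℕ) : ℂ := (-1) ^ n * q ^ (n * (n - 1) / 2) / qPochN q q n

lemma triangle_succ (n : ℕ) : (n + 1) * (n + 1 - 1) / 2 = n * (n - 1) / 2 + n := by
  rw [← Finset.sum_range_id, ← Finset.sum_range_id, Finset.sum_range_succ]

lemma eulerCoeff_succ {q : ℂ} (hq : ‖q‖ < 1) (n : ℕ) :
    eulerCoeff q (n + 1) * (1 - q ^ (n + 1)) = - q ^ n * eulerCoeff q n := by
  have hA := qPochN_self_ne_zero hq n
  have hB := one_sub_pow_ne_zero hq n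
  simp only [eulerCoeff, qPochN_succ, ← pow_succ', triangle_succ]
  rw [pow_add _ _ n, pow_succ (-1)]
  field_simp

/-- Ratio test: consecutive coefficients have quotient -q^n/(1-q^{n+1}), which tends to 0. The
series is therefore entire, and `hasSum_euler` needs no bound on t. -/
lemma summable_eulerCoeff {q : ℂ} (hq : ‖q‖ < 1) {r : ℝ} (hr : 0 ≤ r) :
    Summable fun n => ‖eulerCoeff q n‖ * r ^ n := by
  have h1 : Tendsto (fun n : ℕ => ‖q ^ n / (1 - q ^ (n + 1))‖ * r) atTop (𝓝 0) := by
    have h2 : Tendsto (fun n : ℕ => q ^ n) atTop (𝓝 0) := tendsto_pow_atTop_nhds_zero_of_norm_lt_one hq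
    have h3 : Tendsto (fun n : ℕ => q ^ n / (1 - q ^ (n + 1))) atTop (𝓝 (0 / (1 - 0))) :=
      h2.div (tendsto_const_nhds.sub ((tendsto_add_atTop_iff_nat 1).mpr h2)) (by simp)
    simpa using h3.norm.mul_const r
  refine summable_of_ratio_norm_eventually_le (r := 1 / 2) (by norm_num) ?_
  filter_upwards [h1.eventually (ge_mem_nhds (by norm_num : (0 : ℝ) < 1 / 2))] with n hn
  have h4 : eulerCoeff q (n + 1) = - (q ^ n / (1 - q ^ (n + 1))) * eulerCoeff q n := by
    have := eulerCoeff_succ hq n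
    have hB := one_sub_pow_ne_zero hq n
    field_simp
    linear_combination this
  rw [h4, pow_succ r]
  simp only [norm_mul, norm_neg, norm_norm, norm_pow, Real.norm_of_nonneg hr]
  have : 0 ≤ ‖eulerCoeff q n‖ * r ^ n := by positivity
  nlinarith

/-- Euler's expansion of `(t; q)_∞`. -/
lemma hasSum_euler {q : ℂ} (hq : ‖q‖ < 1) (t : ℂ) :
    HasSum (fun n => eulerCoeff q n * t ^ n) (qPoch t q) := by
  have hs : ∀ x : ℂ, Summable fun n => eulerCoeff q n * x ^ n := fun x =>
    Summable.of_norm (by simpa using summable_eulerCoeff hq (norm_nonneg x))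
  set F : ℂ → ℂ := fun x => ∑' n, eulerCoeff q n * x ^ n with hF
  have hrec : ∀ x, F x = (1 - x) * F (x * q) := by
    intro x
    have h0 : ∀ y, F y = eulerCoeff q 0 + ∑' n, eulerCoeff q (n + 1) * y ^ (n + 1) := fun y => by
      simpa using (hs y).tsum_eq_zero_add
    have s1 : ∀ y, Summable fun n => eulerCoeff q (n + 1) * y ^ (n + 1) := fun y =>
      (summable_nat_add_iff 1).mpr (hs y)
    have h1 : x * F (x * q) = ∑' n, eulerCoeff q n * (x * q) ^ n * x := by
      rw [mul_comm, hF, ← tsum_mul_right]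
    have s2 : Summable fun n => eulerCoeff q n * (x * q) ^ n * x := (hs _).mul_right x
    have h3 : F x - F (x * q) + x * F (x * q) = 0 := by
      rw [h1, h0 x, h0 (x * q)]
      have : eulerCoeff q 0 + ∑' n, eulerCoeff q (n + 1) * x ^ (n + 1) -
          (eulerCoeff q 0 + ∑' n, eulerCoeff q (n + 1) * (x * q) ^ (n + 1)) +
          ∑' n, eulerCoeff q n * (x * q) ^ n * x =
          ∑' n, (eulerCoeff q (n + 1) * x ^ (n + 1) - eulerCoeff q (n + 1) * (x * q) ^ (n + 1) +
            eulerCoeff q n * (x * q) ^ n * x) := by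
        rw [Summable.tsum_add ((s1 x).sub (s1 _)) s2, Summable.tsum_sub (s1 x) (s1 _)]
        ring
      rw [this]
      convert! tsum_zero with n
      rw [mul_pow, mul_pow]
      linear_combination x ^ (n + 1) * eulerCoeff_succ hq n
    linear_combination h3
  have hiter : ∀ N, F t = qPochN t q N * F (t * q ^ N) := by
    intro N
    induction N with
    | zero => simp [qPochN]
    | succ N ih => rw [ih, qPochN_succ, hrec (t * q ^ N), pow_succ]; ring_nf
  have hlimF : Tendsto (fun N => F (t * q ^ N)) atTop (𝓝 (eulerCoeff q 0)) :=
    tendsto_tsum_mul_pow (r := ‖t‖ + 1) (summable_eulerCoeff hq (by positivity))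
      hq (by simp)
  have h8 : F t = qPoch t q * eulerCoeff q 0 :=
    tendsto_nhds_unique tendsto_const_nhds
      (((tendsto_qPoch t hq).mul hlimF).congr fun N => (hiter N).symm)
  have h9 : F t = qPoch t q := by rw [h8]; simp [eulerCoeff, qPochN]
  rw [← h9]
  exact (hs t).hasSum

end CrankSymmetry

end

noncomputable section

namespace CrankSymmetry

open Filter Topology Finset

/-! ### The Jacobi triple product -/

/-- For n < 0 one factor is 1 - q⁰ = 0. This truncates the bilateral theta series to n ≥ 0 in the
proof of the triple product. -/
lemma prod_one_sub_zpow_mul_qPoch {q : ℂ} (hq : ‖q‖ < 1) (hq0 : q ≠ 0) (n : ℤ) :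
    qPoch (q ^ (n + 1)) q =
      if 0 ≤ n then qPoch q q / qPochN q q n.toNat else 0 := by
  split_ifs with hn
  · obtain ⟨m, rfl⟩ := Int.eq_ofNat_of_zero_le hn
    rw [qPoch_eq_prod_mul q hq m, Int.toNat_natCast]
    have := qPochN_self_ne_zero hq m
    rw [qPochN] at this ⊢
    rw [mul_div_cancel_left₀ _ this]
    norm_cast
    rw [pow_succ']
  · obtain ⟨m, hm⟩ := Int.eq_ofNat_of_zero_le (show 0 ≤ -(n + 1) by omega)
    rw [qPoch_eq_prod_mul _ hq (m + 1), prod_range_succ]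
    have : n + 1 = -(m : ℤ) := by omega
    rw [this, zpow_neg, zpow_natCast, inv_mul_cancel₀ (pow_ne_zero _ hq0)]
    simp

/-- The general term of the theta series `∑ (-1)^n q^{n(n-1)/2} x^n`, `x = e(z)`, `q = e(τ)`. -/
def thetaTerm (z τ : ℂ) (n : ℤ) : ℂ := jacobiTheta₂_term n (z - τ / 2 + 1 / 2) τ

lemma thetaTerm_eq (z τ : ℂ) (n : ℤ) :
    thetaTerm z τ n = Complex.exp (Real.pi * Complex.I * (2 * n * z + n * (n - 1) * τ + n)) := by
  rw [thetaTerm, jacobiTheta₂_term]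
  congr 1
  ring

lemma exp_pi_I_mul_natCast (n : ℕ) :
    Complex.exp (Real.pi * Complex.I * n) = (-1) ^ n := by
  rw [mul_comm, Complex.exp_nat_mul, Complex.exp_pi_mul_I]

lemma exp_pi_I_mul_intCast (n : ℤ) :
    Complex.exp (Real.pi * Complex.I * n) = (-1) ^ n := by
  rw [mul_comm, Complex.exp_int_mul, Complex.exp_pi_mul_I]

lemma exp_two_pi_I_mul_pow (z : ℂ) (n : ℕ) :
    Complex.exp (2 * Real.pi * Complex.I * z) ^ n =
      Complex.exp (2 * Real.pi * Complex.I * (n * z)) := by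
  rw [← Complex.exp_nat_mul]
  ring_nf

lemma norm_exp_two_pi_I_lt_one {τ : ℂ} (hτ : 0 < τ.im) :
    ‖Complex.exp (2 * Real.pi * Complex.I * τ)‖ < 1 := by
  simpa using UpperHalfPlane.norm_exp_two_pi_I_lt_one ⟨τ, hτ⟩

lemma two_mul_triangle (n : ℕ) : (2 : ℂ) * ((n * (n - 1) / 2 : ℕ) : ℂ) = n * (n - 1) := by
  have h : 2 * (n * (n - 1) / 2) = n * (n - 1) := Nat.mul_div_cancel' (Nat.even_mul_pred_self n).two_dvd
  rcases n with _ | n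
  · simp
  · have := congrArg (fun k : ℕ => (k : ℂ)) h
    push_cast at this ⊢
    simpa using this

lemma hasSum_mul_of_hasSum {ι κ : Type*} {f : ι → ℂ} {g : κ → ℂ} {a b : ℂ} (hf : HasSum f a)
    (hg : HasSum g b) : HasSum (fun p : ι × κ => f p.1 * g p.2) (a * b) := by
  have := tsum_mul_tsum_of_summable_norm hf.summable.norm hg.summable.norm
  rw [← hf.tsum_eq, ← hg.tsum_eq, this]
  exact (summable_mul_of_summable_norm hf.summable.norm hg.summable.norm).hasSum

/-- The shear `(n, m) ↦ (n + m, m)`. -/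
def shearEquiv : ℤ × ℕ ≃ ℤ × ℕ where
  toFun p := (p.1 + p.2, p.2)
  invFun p := (p.1 - p.2, p.2)
  left_inv p := by simp
  right_inv p := by simp

/-- The core of the triple product. Expand Θ/(y;q) by Euler as a double series over (n, m) and shear
it by n ↦ n+m. The inner sum over m becomes (q^{n+1};q), which vanishes for n < 0 and is
(q;q)/(q;q)_n otherwise. What remains is Euler's series for (x;q), times (q;q). -/
lemma qPoch_mul_eq_of_hasSum {T : ℤ → ℂ} {Θ q x y : ℂ} (hT : HasSum T Θ) (hq : ‖q‖ < 1)
    (hy : ‖y‖ < 1) (hq0 : q ≠ 0)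
    (hterm : ∀ (n : ℤ) (m : ℕ), T (n + m) * (y ^ m / qPochN q q m) =
      T n * (eulerCoeff q m * (q ^ (n + 1)) ^ m))
    (hnat : ∀ n : ℕ, T n = (-1) ^ n * q ^ (n * (n - 1) / 2) * x ^ n) :
    qPoch x q * qPoch y q * qPoch q q = Θ := by
  have hsE := hasSum_euler_inv hq hy
  have hfs := hasSum_mul_of_hasSum hT hsE
  have hgs : HasSum (fun p : ℤ × ℕ => T p.1 * (eulerCoeff q p.2 * (q ^ (p.1 + 1)) ^ p.2))
      (Θ * (1 / qPoch y q)) := by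
    have := (shearEquiv.hasSum_iff).mpr hfs
    convert! this using 1
    exact funext fun p => (hterm p.1 p.2).symm
  have houter := hgs.prod_fiberwise
    (fun n => (hasSum_euler hq (q ^ (n + 1))).mul_left (T n))
  have hnat' : HasSum (fun n : ℕ => T n * qPoch (q ^ ((n : ℤ) + 1)) q) (Θ * (1 / qPoch y q)) := by
    have hinj : Function.Injective ((↑) : ℕ → ℤ) := Nat.cast_injective
    refine (hinj.hasSum_iff ?_).mpr houter
    intro n hn
    rw [prod_one_sub_zpow_mul_qPoch hq hq0, if_neg, mul_zero]
    intro h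
    obtain ⟨m, rfl⟩ := Int.eq_ofNat_of_zero_le h
    exact hn ⟨m, rfl⟩
  have hx : HasSum (fun n : ℕ => T n * qPoch (q ^ ((n : ℤ) + 1)) q) (qPoch x q * qPoch q q) := by
    convert! (hasSum_euler hq x).mul_right (qPoch q q) using 1
    funext n
    rw [prod_one_sub_zpow_mul_qPoch hq hq0, if_pos (by omega), Int.toNat_natCast, eulerCoeff, hnat]
    ring
  have := hx.unique hnat'
  have hyne := qPoch_ne_zero_of_norm_lt hq hy
  field_simp at this
  linear_combination this

lemma thetaTerm_add_mul (z τ : ℂ) (n : ℤ) (m : ℕ) :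
    thetaTerm z τ (n + m) * Complex.exp (2 * Real.pi * Complex.I * (τ - z)) ^ m =
      thetaTerm z τ n * ((-1) ^ m * Complex.exp (2 * Real.pi * Complex.I * τ) ^ (m * (m - 1) / 2) *
        (Complex.exp (2 * Real.pi * Complex.I * τ) ^ (n + 1)) ^ m) := by
  rw [← Complex.exp_int_mul, exp_two_pi_I_mul_pow, exp_two_pi_I_mul_pow,
    ← exp_pi_I_mul_natCast, ← Complex.exp_nat_mul, thetaTerm_eq, thetaTerm_eq,
    ← Complex.exp_add, ← Complex.exp_add, ← Complex.exp_add, ← Complex.exp_add]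
  congr 1
  generalize hk : m * (m - 1) / 2 = k
  have h2 := two_mul_triangle m
  rw [hk] at h2
  push_cast
  linear_combination (-Real.pi * Complex.I * τ) * h2

lemma thetaTerm_natCast (z τ : ℂ) (n : ℕ) :
    thetaTerm z τ n = (-1) ^ n * Complex.exp (2 * Real.pi * Complex.I * τ) ^ (n * (n - 1) / 2) *
      Complex.exp (2 * Real.pi * Complex.I * z) ^ n := by
  rw [exp_two_pi_I_mul_pow, exp_two_pi_I_mul_pow,
    ← exp_pi_I_mul_natCast, thetaTerm_eq, ← Complex.exp_add, ← Complex.exp_add]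
  congr 1
  generalize hk : n * (n - 1) / 2 = k
  have h2 := two_mul_triangle n
  rw [hk] at h2
  push_cast
  linear_combination (-Real.pi * Complex.I * τ) * h2

/-- Jacobi's triple product in the annulus of convergence of `1 / (q/x; q)_∞`. -/
lemma jacobi_triple_product_aux {z τ : ℂ} (hτ : 0 < τ.im) (hz : z.im < τ.im) :
    qPoch (Complex.exp (2 * Real.pi * Complex.I * z)) (Complex.exp (2 * Real.pi * Complex.I * τ)) *
      qPoch (Complex.exp (2 * Real.pi * Complex.I * (τ - z)))
        (Complex.exp (2 * Real.pi * Complex.I * τ)) *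
      qPoch (Complex.exp (2 * Real.pi * Complex.I * τ)) (Complex.exp (2 * Real.pi * Complex.I * τ)) =
    jacobiTheta₂ (z - τ / 2 + 1 / 2) τ := by
  have hsT : HasSum (thetaTerm z τ) (jacobiTheta₂ (z - τ / 2 + 1 / 2) τ) :=
    hasSum_jacobiTheta₂_term _ hτ
  refine qPoch_mul_eq_of_hasSum hsT (norm_exp_two_pi_I_lt_one hτ)
    (norm_exp_two_pi_I_lt_one (by simpa using hz)) (Complex.exp_ne_zero _) (fun n m => ?_)
    (thetaTerm_natCast z τ)
  rw [mul_div_assoc', thetaTerm_add_mul, eulerCoeff]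
  ring

/-- The function `(x; q)_∞ (q/x; q)_∞ (q; q)_∞` with `x = e(z)`, `q = e(τ)`. -/
def thetaProd (z τ : ℂ) : ℂ :=
  qPoch (Complex.exp (2 * Real.pi * Complex.I * z)) (Complex.exp (2 * Real.pi * Complex.I * τ)) *
    qPoch (Complex.exp (2 * Real.pi * Complex.I * (τ - z)))
      (Complex.exp (2 * Real.pi * Complex.I * τ)) *
    qPoch (Complex.exp (2 * Real.pi * Complex.I * τ)) (Complex.exp (2 * Real.pi * Complex.I * τ))

lemma exp_two_pi_I_add (z w : ℂ) : Complex.exp (2 * Real.pi * Complex.I * (z + w)) =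
    Complex.exp (2 * Real.pi * Complex.I * z) * Complex.exp (2 * Real.pi * Complex.I * w) := by
  rw [← Complex.exp_add]
  ring_nf

lemma thetaProd_add_period {τ : ℂ} (hτ : 0 < τ.im) (z : ℂ) :
    thetaProd (z + τ) τ = -Complex.exp (-(2 * Real.pi * Complex.I * z)) * thetaProd z τ := by
  have hq := norm_exp_two_pi_I_lt_one hτ
  rw [thetaProd, thetaProd, qPoch_succ (Complex.exp (2 * Real.pi * Complex.I * z)) hq,
    qPoch_succ (Complex.exp (2 * Real.pi * Complex.I * (τ - (z + τ)))) hq, ← exp_two_pi_I_add,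
    ← exp_two_pi_I_add, show τ - (z + τ) = -z by ring, show -z + τ = τ - z by ring,
    mul_neg (2 * Real.pi * Complex.I) z]
  have : Complex.exp (-(2 * Real.pi * Complex.I * z)) * Complex.exp (2 * Real.pi * Complex.I * z) = 1 := by
    rw [← Complex.exp_add]; simp
  linear_combination (-qPoch (Complex.exp (2 * Real.pi * Complex.I * (z + τ))) (Complex.exp (2 * Real.pi * Complex.I * τ)) *
    qPoch (Complex.exp (2 * Real.pi * Complex.I * (τ - z))) (Complex.exp (2 * Real.pi * Complex.I * τ)) *
    qPoch (Complex.exp (2 * Real.pi * Complex.I * τ)) (Complex.exp (2 * Real.pi * Complex.I * τ))) * this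

/-- Jacobi's triple product identity. -/
theorem jacobi_triple_product {τ : ℂ} (hτ : 0 < τ.im) (z : ℂ) :
    thetaProd z τ = jacobiTheta₂ (z - τ / 2 + 1 / 2) τ := by
  -- Both sides acquire the same factor under w ↦ w+τ, so the identity spreads from Im w < Im τ to
  -- all w.
  have hstep : ∀ w : ℂ, thetaProd (w + τ) τ = jacobiTheta₂ (w + τ - τ / 2 + 1 / 2) τ ↔
      thetaProd w τ = jacobiTheta₂ (w - τ / 2 + 1 / 2) τ := by
    intro w
    rw [thetaProd_add_period hτ, show w + τ - τ / 2 + 1 / 2 = (w - τ / 2 + 1 / 2) + τ by ring,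
      jacobiTheta₂_add_left', show -Real.pi * Complex.I * (τ + 2 * (w - τ / 2 + 1 / 2)) =
        -(2 * Real.pi * Complex.I * w) - Real.pi * Complex.I by ring, Complex.exp_sub,
      Complex.exp_pi_mul_I, div_neg, div_one, mul_right_inj' (neg_ne_zero.mpr (Complex.exp_ne_zero _))]
  have hall : ∀ n : ℕ, ∀ w : ℂ, w.im < (n + 1) * τ.im →
      thetaProd w τ = jacobiTheta₂ (w - τ / 2 + 1 / 2) τ := by
    intro n
    induction n with
    | zero => exact fun w hw => jacobi_triple_product_aux hτ (by simpa using hw)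
    | succ n ih =>
      intro w hw
      have := (hstep (w - τ)).mpr (ih (w - τ) (by push_cast at hw; simp; linarith))
      simpa using this
  obtain ⟨n, hn⟩ := exists_nat_gt (z.im / τ.im)
  refine hall n z ?_
  rw [div_lt_iff₀ hτ] at hn
  linarith

end CrankSymmetry

end

noncomputable section

namespace CrankSymmetry

open Filter Topology Finset

/-! ### A Jacobi form of weight `-1` and index `1/2` -/

/-- Euler's function `(q; q)_∞` at `q = e(τ)`. -/
def eulerFun (τ : ℂ) : ℂ :=
  qPoch (Complex.exp (2 * Real.pi * Complex.I * τ)) (Complex.exp (2 * Real.pi * Complex.I * τ))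

lemma eulerFun_ne_zero {τ : ℂ} (hτ : 0 < τ.im) : eulerFun τ ≠ 0 :=
  qPoch_self_ne_zero (norm_exp_two_pi_I_lt_one hτ)

lemma eta_eq_eulerFun (τ : ℂ) :
    ModularForm.eta τ = Complex.exp (2 * Real.pi * Complex.I * τ / 24) * eulerFun τ := by
  rw [ModularForm.eta, eulerFun, qPoch]
  have h1 : Function.Periodic.qParam 24 τ = Complex.exp (2 * Real.pi * Complex.I * τ / 24) := by
    simp [Function.Periodic.qParam]
  rw [h1]
  congr 1
  refine tprod_congr fun n => ?_
  rw [ModularForm.eta_q_eq_pow, pow_succ']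

/-- The Jacobi form `θ(z, τ) / η(τ)^3`, where
`θ(z, τ) = q^{1/8} (x^{1/2} - x^{-1/2}) ∏_{n ≥ 1} (1 - q^n) (1 - x q^n) (1 - q^n / x)`. -/
def phi (z τ : ℂ) : ℂ :=
  -Complex.exp (-(Real.pi * Complex.I * z)) * thetaProd z τ / eulerFun τ ^ 3

lemma exp_two_pi_I_add_one (z : ℂ) : Complex.exp (2 * Real.pi * Complex.I * (z + 1)) =
    Complex.exp (2 * Real.pi * Complex.I * z) := by
  rw [exp_two_pi_I_add, mul_one, Complex.exp_two_pi_mul_I, mul_one]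

lemma thetaProd_add_one (z τ : ℂ) : thetaProd (z + 1) τ = thetaProd z τ := by
  rw [thetaProd, thetaProd, exp_two_pi_I_add_one, ← exp_two_pi_I_add_one (τ - (z + 1))]
  ring_nf

lemma thetaProd_tau_add_one (z τ : ℂ) : thetaProd z (τ + 1) = thetaProd z τ := by
  rw [thetaProd, thetaProd, exp_two_pi_I_add_one, show τ + 1 - z = τ - z + 1 by ring,
    exp_two_pi_I_add_one]

lemma eulerFun_add_one (τ : ℂ) : eulerFun (τ + 1) = eulerFun τ := by
  rw [eulerFun, eulerFun, exp_two_pi_I_add_one]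

lemma phi_add_one (z τ : ℂ) : phi (z + 1) τ = -phi z τ := by
  rw [phi, phi, thetaProd_add_one, show -(Real.pi * Complex.I * (z + 1)) =
    -(Real.pi * Complex.I * z) - Real.pi * Complex.I by ring, Complex.exp_sub, Complex.exp_pi_mul_I]
  ring

lemma phi_tau_add_one (z τ : ℂ) : phi z (τ + 1) = phi z τ := by
  rw [phi, phi, thetaProd_tau_add_one, eulerFun_add_one]

lemma phi_add_tau {τ : ℂ} (hτ : 0 < τ.im) (z : ℂ) :
    phi (z + τ) τ = -Complex.exp (-(Real.pi * Complex.I * (τ + 2 * z))) * phi z τ := by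
  rw [phi, phi, thetaProd_add_period hτ, show -(Real.pi * Complex.I * (z + τ)) =
    -(Real.pi * Complex.I * (τ + 2 * z)) + -(Real.pi * Complex.I * z) + 2 * Real.pi * Complex.I * z by ring,
    Complex.exp_add, Complex.exp_add]
  have : Complex.exp (2 * Real.pi * Complex.I * z) * Complex.exp (-(2 * Real.pi * Complex.I * z)) = 1 := by
    rw [← Complex.exp_add]; simp
  linear_combination (Complex.exp (-(Real.pi * Complex.I * (τ + 2 * z))) *
    Complex.exp (-(Real.pi * Complex.I * z)) * thetaProd z τ / eulerFun τ ^ 3) * this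

lemma phi_neg {τ : ℂ} (hτ : 0 < τ.im) (z : ℂ) : phi (-z) τ = -phi z τ := by
  have hq := norm_exp_two_pi_I_lt_one hτ
  rw [phi, phi, thetaProd, thetaProd, qPoch_succ (Complex.exp (2 * Real.pi * Complex.I * z)) hq,
    qPoch_succ (Complex.exp (2 * Real.pi * Complex.I * (-z))) hq, ← exp_two_pi_I_add,
    ← exp_two_pi_I_add, show τ - -z = z + τ by ring, show -z + τ = τ - z by ring]
  have h1 : Complex.exp (-(Real.pi * Complex.I * -z)) * (1 - Complex.exp (2 * Real.pi * Complex.I * -z)) =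
      -(Complex.exp (-(Real.pi * Complex.I * z)) * (1 - Complex.exp (2 * Real.pi * Complex.I * z))) := by
    rw [mul_sub, mul_sub, ← Complex.exp_add, ← Complex.exp_add]
    ring_nf
  linear_combination (-qPoch (Complex.exp (2 * Real.pi * Complex.I * (z + τ))) (Complex.exp (2 * Real.pi * Complex.I * τ)) *
    qPoch (Complex.exp (2 * Real.pi * Complex.I * (τ - z))) (Complex.exp (2 * Real.pi * Complex.I * τ)) *
    qPoch (Complex.exp (2 * Real.pi * Complex.I * τ)) (Complex.exp (2 * Real.pi * Complex.I * τ)) /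
      eulerFun τ ^ 3) * h1

lemma im_neg_one_div_pos {τ : ℂ} (hτ : 0 < τ.im) : 0 < (-1 / τ).im := by
  have h := UpperHalfPlane.im_inv_neg_coe_pos ⟨τ, hτ⟩
  simpa [neg_div, inv_neg] using h

lemma eta_pow_three (τ : ℂ) : ModularForm.eta τ ^ 3 =
    Complex.exp (Real.pi * Complex.I * τ / 4) * eulerFun τ ^ 3 := by
  rw [eta_eq_eulerFun, mul_pow, ← Complex.exp_nat_mul]
  congr 2
  push_cast
  ring

/-- The inversion formula for theta involves (-iτ)^{1/2}, that for η involves √τ and √i. Since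
|arg(-iτ)| < π/2, adding arg i = π/2 does not cross the cut, so the principal branches are
compatible. -/
lemma cpow_half_eq_sqrt_div {τ : ℂ} (hτ : 0 < τ.im) :
    (-Complex.I * τ) ^ (1 / 2 : ℂ) * Complex.sqrt Complex.I = Complex.sqrt τ := by
  have hτ0 : τ ≠ 0 := by rintro rfl; simp at hτ
  set w := -Complex.I * τ with hw
  have h1 : τ = Complex.I * w := by
    rw [hw]
    linear_combination τ * Complex.I_mul_I
  have hw0 : w ≠ 0 := by simpa [hw] using hτ0
  have harg : |Complex.arg w| < Real.pi / 2 := by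
    rw [Complex.abs_arg_lt_pi_div_two_iff]
    left
    simpa [hw] using hτ
  have hlog : Complex.log (Complex.I * w) = Complex.log Complex.I + Complex.log w := by
    rw [Complex.log_mul_eq_add_log_iff Complex.I_ne_zero hw0, Complex.arg_I]
    have := abs_lt.mp harg
    constructor <;> linarith [Real.pi_pos]
  rw [h1, Complex.sqrt, Complex.sqrt, Complex.cpow_def_of_ne_zero hw0,
    Complex.cpow_def_of_ne_zero Complex.I_ne_zero,
    Complex.cpow_def_of_ne_zero (mul_ne_zero Complex.I_ne_zero hw0), hlog, ← Complex.exp_add]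
  ring_nf

/-- With u = (-iτ)^{1/2}, theta contributes u and η³ contributes u³, so only u² = -iτ survives and
no square root is left. The remaining factor i is cancelled by the half-period shift in the argument
of theta. -/
lemma phi_neg_one_div {τ : ℂ} (hτ : 0 < τ.im) (z : ℂ) :
    phi (z / τ) (-1 / τ) = τ⁻¹ * Complex.exp (Real.pi * Complex.I * z ^ 2 / τ) * phi z τ := by
  have hτ0 : τ ≠ 0 := by rintro rfl; simp at hτ
  have hτ' := im_neg_one_div_pos hτ
  have hphi : ∀ z τ : ℂ, phi z τ = -Complex.exp (Real.pi * Complex.I * (τ / 4 - z)) * thetaProd z τ /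
      ModularForm.eta τ ^ 3 := by
    intro z τ
    rw [eta_pow_three, phi, ← mul_div_mul_left _ (eulerFun τ ^ 3)
      (Complex.exp_ne_zero (Real.pi * Complex.I * τ / 4)), show Real.pi * Complex.I * (τ / 4 - z) =
      Real.pi * Complex.I * τ / 4 + -(Real.pi * Complex.I * z) by ring, Complex.exp_add]
    ring
  have hfun := jacobiTheta₂_functional_equation (z - τ / 2 + 1 / 2) τ
  have harg : (z - τ / 2 + 1 / 2) / τ = (z / τ - (-1 / τ) / 2 + 1 / 2) + (-1) := by
    field_simp
    ring
  have hper : ∀ w : ℂ, jacobiTheta₂ (w + (-1)) (-1 / τ) = jacobiTheta₂ w (-1 / τ) := fun w => by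
    rw [← jacobiTheta₂_add_left (w + (-1))]
    ring_nf
  have heta : ModularForm.eta (-1 / τ) = (Complex.sqrt Complex.I)⁻¹ * (Complex.sqrt τ * ModularForm.eta τ) := by
    simpa using ModularForm.eta_comp_eq_csqrt_I_inv (show τ ∈ UpperHalfPlane.upperHalfPlaneSet from hτ)
  have hw0 : -Complex.I * τ ≠ 0 := by simpa using hτ0
  have hsq := cpow_half_eq_sqrt_div hτ
  set u := (-Complex.I * τ) ^ (1 / 2 : ℂ) with hu
  have hu2 : u ^ 2 = -Complex.I * τ := by
    rw [hu, ← Complex.cpow_nat_mul]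
    norm_num
  have hu0 : u ≠ 0 := by
    intro h
    rw [h] at hu2
    exact hw0 (by rw [← hu2]; ring)
  have hsI : Complex.sqrt Complex.I ≠ 0 := by
    simp [Complex.sqrt]
  have heta3 : ModularForm.eta (-1 / τ) = u * ModularForm.eta τ := by
    rw [heta, ← hsq]
    field_simp
  have heta0 : ModularForm.eta τ ≠ 0 := ModularForm.eta_ne_zero hτ
  rw [harg, hper, ← jacobi_triple_product hτ, ← jacobi_triple_product hτ'] at hfun
  rw [hphi, hphi, heta3, hfun]
  have hexp : Complex.exp (Real.pi * Complex.I * z ^ 2 / τ) *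
      Complex.exp (Real.pi * Complex.I * (τ / 4 - z)) *
      Complex.exp (-Real.pi * Complex.I * (z - τ / 2 + 1 / 2) ^ 2 / τ) =
      Complex.exp (Real.pi * Complex.I * ((-1 / τ) / 4 - z / τ)) * Complex.I := by
    rw [← Complex.exp_add, ← Complex.exp_add]
    nth_rewrite 5 [← Complex.exp_pi_div_two_mul_I]
    rw [← Complex.exp_add]
    congr 1
    field_simp
    ring
  have hI : (Complex.I * Complex.I) = -1 := Complex.I_mul_I
  generalize thetaProd (z / τ) (-1 / τ) = Θ at *
  generalize Complex.exp (Real.pi * Complex.I * z ^ 2 / τ) = A at *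
  generalize Complex.exp (Real.pi * Complex.I * (τ / 4 - z)) = B at *
  generalize Complex.exp (-Real.pi * Complex.I * (z - τ / 2 + 1 / 2) ^ 2 / τ) = C at *
  generalize Complex.exp (Real.pi * Complex.I * ((-1 / τ) / 4 - z / τ)) = D at *
  have hu3 : u ^ 3 = u * (-Complex.I * τ) := by rw [pow_succ, hu2]; ring
  rw [mul_pow, hu3]
  field_simp
  linear_combination (Complex.I * Θ) * hexp + D * Θ * hI

open Matrix in
/-- The automorphy factor `cτ + d`. -/
def autFactor (A : SpecialLinearGroup (Fin 2) ℤ) (τ : ℂ) : ℂ := (A 1 0 : ℂ) * τ + (A 1 1 : ℂ)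

/-! ### The action of SL(2, ℤ) on `phi` and on the 24th power of η -/

section Modular

open Matrix MatrixGroups ModularGroup

lemma autFactor_ne_zero (A : SL(2, ℤ)) (τ : ℍ) : autFactor A τ ≠ 0 := by
  have := UpperHalfPlane.denom_ne_zero (A : GL (Fin 2) ℝ) τ
  simpa [UpperHalfPlane.denom, autFactor] using this

lemma coe_smul_eq (A : SL(2, ℤ)) (τ : ℍ) :
    ((A • τ : ℍ) : ℂ) = ((A 0 0 : ℂ) * τ + (A 0 1 : ℂ)) / autFactor A τ := by
  rw [UpperHalfPlane.specialLinearGroup_apply]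
  simp [autFactor]

lemma autFactor_mul_smul (A : SL(2, ℤ)) (τ : ℍ) :
    autFactor A τ * ((A • τ : ℍ) : ℂ) = (A 0 0 : ℂ) * τ + (A 0 1 : ℂ) := by
  rw [coe_smul_eq, mul_div_cancel₀ _ (autFactor_ne_zero A τ)]

lemma det_cast (A : SL(2, ℤ)) : (A 0 0 : ℂ) * A 1 1 - A 0 1 * A 1 0 = 1 := by
  have := A.det_coe
  rw [Matrix.det_fin_two] at this
  exact_mod_cast this

lemma autFactor_mul (A B : SL(2, ℤ)) (τ : ℍ) :
    autFactor (A * B) τ = autFactor A (B • τ : ℍ) * autFactor B τ := by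
  have h := autFactor_mul_smul B τ
  have h1 : autFactor (A * B) τ = ((A 1 0 : ℂ) * B 0 0 + A 1 1 * B 1 0) * τ +
      (A 1 0 * B 0 1 + A 1 1 * B 1 1) := by
    simp [autFactor, Matrix.mul_apply, Fin.sum_univ_two]
  rw [h1]
  unfold autFactor at h ⊢
  linear_combination (-(A 1 0 : ℂ)) * h

/-- The transformation law of `phi` under an element of `SL(2, ℤ)`. -/
def PhiLaw (A : SL(2, ℤ)) : Prop := ∀ (τ : ℍ) (z : ℂ),
  phi (z / autFactor A τ) (A • τ : ℍ) =
    (autFactor A τ)⁻¹ * Complex.exp (Real.pi * Complex.I * A 1 0 * z ^ 2 / autFactor A τ) * phi z τ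

lemma PhiLaw.mul {A B : SL(2, ℤ)} (hA : PhiLaw A) (hB : PhiLaw B) : PhiLaw (A * B) := by
  intro τ z
  have h1 := hA (B • τ) (z / autFactor B τ)
  rw [hB τ z] at h1
  have hB0 := autFactor_ne_zero B τ
  have hA0 := autFactor_ne_zero A (B • τ)
  rw [autFactor_mul, mul_smul, mul_comm (autFactor A _), ← div_div, h1]
  have hc : ((A * B) 1 0 : ℂ) * autFactor B τ = A 1 0 + B 1 0 * (autFactor A (B • τ : ℍ) * autFactor B τ) := by
    have h := autFactor_mul_smul B τ
    have h2 : ((A * B) 1 0 : ℂ) = (A 1 0 : ℂ) * B 0 0 + A 1 1 * B 1 0 := by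
      simp [Matrix.mul_apply, Fin.sum_univ_two]
    have h3 := det_cast B
    rw [h2]
    unfold autFactor at h ⊢
    linear_combination (A 1 0 : ℂ) * h3 - (A 1 0 : ℂ) * (B 1 0 : ℂ) * h
  have hexp : Complex.exp (Real.pi * Complex.I * ((A * B) 1 0 : ℤ) * z ^ 2 /
        (autFactor B τ * autFactor A (B • τ : ℍ))) =
      Complex.exp (Real.pi * Complex.I * A 1 0 * (z / autFactor B τ) ^ 2 / autFactor A (B • τ : ℍ)) *
        Complex.exp (Real.pi * Complex.I * B 1 0 * z ^ 2 / autFactor B τ) := by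
    rw [← Complex.exp_add]
    congr 1
    field_simp
    linear_combination z ^ 2 * hc
  rw [hexp, mul_inv]
  ring

lemma PhiLaw.inv {A : SL(2, ℤ)} (hA : PhiLaw A) : PhiLaw A⁻¹ := by
  intro τ z
  have h0 := autFactor_mul A A⁻¹ τ
  have h1 : autFactor (A * A⁻¹) τ = 1 := by simp [autFactor]
  rw [h1] at h0
  have hB0 := autFactor_ne_zero A⁻¹ τ
  have h2 := hA (A⁻¹ • τ) (z / autFactor A⁻¹ τ)
  rw [smul_inv_smul, div_div, mul_comm (autFactor A⁻¹ τ), ← h0, div_one] at h2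
  have hA1 : autFactor A (A⁻¹ • τ : ℍ) = (autFactor A⁻¹ τ)⁻¹ := eq_inv_of_mul_eq_one_left h0.symm
  have hc : ((A⁻¹ : SL(2, ℤ)) 1 0 : ℂ) = -A 1 0 := by
    simp [Matrix.SpecialLinearGroup.coe_inv, Matrix.adjugate_fin_two]
  rw [h2, hA1, hc, inv_inv, ← mul_assoc, ← mul_assoc,
    mul_right_comm _ _ (autFactor A⁻¹ τ), inv_mul_cancel₀ hB0, one_mul, ← Complex.exp_add]
  rw [div_pow, div_inv_eq_mul]
  have : Real.pi * Complex.I * -(A 1 0 : ℂ) * z ^ 2 / autFactor A⁻¹ τ + Real.pi * Complex.I * (A 1 0 : ℂ) *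
      (z ^ 2 / autFactor A⁻¹ τ ^ 2) * autFactor A⁻¹ τ = 0 := by
    field_simp
    ring
  rw [this, Complex.exp_zero, one_mul]

/-- The factor is a cocycle, so the law passes to products and inverses and need only be checked on
S and T. There is no multiplier: the powers q^{1/8} of θ and of η³ cancel, so T acts trivially. -/
theorem phiLaw (A : SL(2, ℤ)) : PhiLaw A := by
  have hmem : A ∈ Subgroup.closure {S, T} := by simp [SpecialLinearGroup.SL2Z_generators]
  induction hmem using Subgroup.closure_induction with
  | mem x hx =>
    rcases hx with rfl | rfl
    · intro τ z
      have h := phi_neg_one_div τ.im_pos z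
      have h1 : autFactor S τ = τ := by simp [autFactor, S]
      have h2 : ((S • τ : ℍ) : ℂ) = -1 / τ := by
        rw [coe_smul_eq, h1]; simp [S]
      rw [h1, h2, h]
      simp [S]
    · intro τ z
      have h1 : autFactor T τ = 1 := by simp [autFactor, T]
      have h2 : ((T • τ : ℍ) : ℂ) = τ + 1 := by
        rw [coe_smul_eq, h1]; simp [T]
      rw [h1, h2, div_one, phi_tau_add_one]
      simp [T]
  | one => intro τ z; simp [autFactor]
  | mul x y _ _ hx hy => exact hx.mul hy
  | inv x _ hx => exact hx.inv

/-- η^24 is the discriminant form. For general matrices η enters only through its 24th power, so its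
multiplier system is never evaluated. -/
lemma eta_pow_smul (A : SL(2, ℤ)) (τ : ℍ) :
    ModularForm.eta (A • τ : ℍ) ^ 24 = autFactor A τ ^ 12 * ModularForm.eta τ ^ 24 := by
  have h := congrFun (SlashInvariantForm.slash_action_generators_SL2Z
    ModularForm.discriminant_S_invariant ModularForm.discriminant_T_invariant A) τ
  rw [ModularForm.SL_slash_apply] at h
  have h1 : UpperHalfPlane.denom A τ = autFactor A τ := by
    simp [UpperHalfPlane.denom, autFactor]
  rw [h1] at h
  have h0 := autFactor_ne_zero A τ
  simp only [ModularForm.discriminant] at h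
  rw [← h, _root_.zpow_neg]
  have h12 : autFactor A τ ^ (12 : ℤ) = autFactor A τ ^ 12 := by norm_cast
  rw [h12]
  field_simp

end Modular

end CrankSymmetry

end

noncomputable section

namespace CrankSymmetry

open Filter Topology Finset Matrix MatrixGroups

/-! ### Odd antiperiodic sequences -/

/-- Odd functions on the integers with `u (k + p) = -u k`. -/
structure OddAntiperiodic (p : ℕ) (u : ℤ → ℂ) : Prop where
  add_period : ∀ k, u (k + p) = -u k
  neg : ∀ k, u (-k) = -u k

lemma neg_one_zpow_sq (m : ℤ) : ((-1 : ℂ) ^ m) ^ 2 = 1 := by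
  rcases Int.even_or_odd m with h | h
  · simp [h.neg_one_zpow]
  · simp [h.neg_one_zpow]

lemma OddAntiperiodic.add_mul {p : ℕ} {u : ℤ → ℂ} (hu : OddAntiperiodic p u) (k m : ℤ) :
    u (k + p * m) = (-1) ^ m * u k := by
  induction m using Int.induction_on with
  | zero => simp
  | succ m ih =>
    rw [show k + (p : ℤ) * (m + 1) = (k + p * m) + p by ring, hu.add_period, ih,
      zpow_add_one₀ (by norm_num)]
    ring
  | pred m ih =>
    have := hu.add_period (k + p * (-m - 1))
    rw [show k + (p : ℤ) * (-m - 1) + p = k + p * (-m) by ring, ih] at this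
    rw [zpow_sub_one₀ (by norm_num)]
    linear_combination this

/-- The absolute value of the least absolute residue. -/
def absResidue (p : ℕ) (m : ℤ) : ℕ := ((m : ZMod p)).valMinAbs.natAbs

lemma cast_absResidue (p : ℕ) [NeZero p] (m : ℤ) :
    ((absResidue p m : ℕ) : ZMod p) = m ∨ ((absResidue p m : ℕ) : ZMod p) = -m := by
  unfold absResidue
  rw [ZMod.natCast_natAbs_valMinAbs]
  split_ifs <;> simp

lemma exists_eq_absResidue (p : ℕ) [NeZero p] (m : ℤ) :
    ∃ t : ℤ, m = absResidue p m + p * t ∨ m = -absResidue p m + p * t := by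
  have h : ((m : ZMod p)).valMinAbs ≡ m [ZMOD p] := by
    rw [← ZMod.intCast_eq_intCast_iff, ZMod.coe_valMinAbs]
  obtain ⟨t, ht⟩ := h.dvd
  refine ⟨t, ?_⟩
  unfold absResidue
  rcases Int.natAbs_eq ((m : ZMod p)).valMinAbs with h1 | h1
  · left; rw [← h1]; linarith
  · right; rw [← h1]; linarith

lemma exists_sign_absResidue (p : ℕ) [NeZero p] (m : ℤ) :
    ∃ ε : ℂ, ε ^ 2 = 1 ∧ ∀ u, OddAntiperiodic p u → u m = ε * u (absResidue p m) := by
  obtain ⟨t, h | h⟩ := exists_eq_absResidue p m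
  · refine ⟨(-1) ^ t, neg_one_zpow_sq t, fun u hu => ?_⟩
    conv_lhs => rw [h]
    rw [hu.add_mul]
  · refine ⟨-(-1) ^ t, by rw [neg_sq, neg_one_zpow_sq t], fun u hu => ?_⟩
    conv_lhs => rw [h]
    rw [hu.add_mul, hu.neg]
    ring

/-! ### Multiplication by units on residues modulo p up to sign -/

section Residues

variable {p : ℕ} [hp : Fact p.Prime]

lemma natCast_ne_zero_of_mem_Icc {i : ℕ} (hi : i ∈ Icc 1 ((p - 1) / 2)) : (i : ZMod p) ≠ 0 := by
  rw [mem_Icc] at hi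
  rw [Ne, ZMod.natCast_eq_zero_iff]
  exact fun h => absurd (Nat.le_of_dvd (by omega) h) (by have := hp.out.two_le; omega)

lemma eq_of_cast_eq_or_neg {i j : ℕ} (hi : i ∈ Icc 1 ((p - 1) / 2)) (hj : j ∈ Icc 1 ((p - 1) / 2))
    (h : (i : ZMod p) = j ∨ (i : ZMod p) = -j) : i = j := by
  rw [mem_Icc] at hi hj
  rcases h with h | h
  · rw [ZMod.natCast_eq_natCast_iff'] at h
    rwa [Nat.mod_eq_of_lt (by omega), Nat.mod_eq_of_lt (by omega)] at h
  · have h1 : ((i + j : ℕ) : ZMod p) = 0 := by push_cast; rw [h]; ring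
    rw [ZMod.natCast_eq_zero_iff] at h1
    exact absurd (Nat.le_of_dvd (by omega) h1) (by omega)

lemma absResidue_mem_Icc (h2 : p ≠ 2) {m : ℤ} (hm : (m : ZMod p) ≠ 0) :
    absResidue p m ∈ Icc 1 ((p - 1) / 2) := by
  have hodd : p % 2 = 1 := Nat.odd_iff.mp (hp.out.odd_of_ne_two h2)
  rw [mem_Icc]
  have h1 := ZMod.natAbs_valMinAbs_le (m : ZMod p)
  have h2 : absResidue p m ≠ 0 := by
    unfold absResidue
    rwa [Ne, Int.natAbs_eq_zero, ZMod.valMinAbs_eq_zero]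
  unfold absResidue at h2 ⊢
  omega

/-- Multiplication by a unit permutes `{1, …, (p-1)/2}` modulo signs. -/
lemma prod_absResidue_mul {M : Type*} [CommMonoid M] (h2 : p ≠ 2) {δ : ℤ} (hδ : (δ : ZMod p) ≠ 0)
    (f : ℕ → M) :
    ∏ k ∈ Icc 1 ((p - 1) / 2), f (absResidue p (k * δ)) = ∏ k ∈ Icc 1 ((p - 1) / 2), f k := by
  have hmaps : ∀ k ∈ Icc 1 ((p - 1) / 2), absResidue p (k * δ) ∈ Icc 1 ((p - 1) / 2) := by
    intro k hk
    refine absResidue_mem_Icc h2 ?_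
    push_cast
    exact mul_ne_zero (natCast_ne_zero_of_mem_Icc hk) hδ
  have hinj : Set.InjOn (fun k : ℕ => absResidue p (k * δ)) (Icc 1 ((p - 1) / 2) : Finset ℕ) := by
    intro k hk l hl hkl
    refine eq_of_cast_eq_or_neg hk hl ?_
    have h1 := cast_absResidue p (k * δ)
    have h2 := cast_absResidue p (l * δ)
    simp only at hkl
    rw [hkl] at h1
    push_cast at h1 h2
    have h3 : (k : ZMod p) * δ = l * δ ∨ (k : ZMod p) * δ = (-l) * δ := by
      rcases h1 with h1 | h1 <;> rcases h2 with h2 | h2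
      · left; rw [← h1, h2]
      · right; rw [← h1, h2]; ring
      · right; rw [neg_mul, ← h2, h1]; ring
      · left; exact neg_injective (by rw [← h1, h2])
    exact h3.imp (mul_right_cancel₀ hδ) (mul_right_cancel₀ hδ)
  exact Finset.prod_nbij (fun k : ℕ => absResidue p (k * δ)) hmaps hinj
    (Finset.surjOn_of_injOn_of_card_le _ hmaps hinj le_rfl) (fun _ _ => rfl)

/-- As in Gauss's lemma, multiplication by δ permutes the half system up to signs. The order of
quantifiers matters: ε depends on δ alone, so one sign serves the torsion values of `phi` both at τ
and at pτ. -/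
lemma exists_sign_prod_mul (h2 : p ≠ 2) {δ : ℤ} (hδ : (δ : ZMod p) ≠ 0) :
    ∃ ε : ℂ, ε ^ 2 = 1 ∧ ∀ u, OddAntiperiodic p u →
      ∏ k ∈ Icc 1 ((p - 1) / 2), u (k * δ) = ε * ∏ k ∈ Icc 1 ((p - 1) / 2), u k := by
  choose ε hε hu using exists_sign_absResidue p
  refine ⟨∏ k ∈ Icc 1 ((p - 1) / 2), ε (k * δ), ?_, fun u h => ?_⟩
  · rw [← prod_pow]
    exact prod_eq_one fun k _ => hε _
  · rw [← prod_absResidue_mul h2 hδ (fun k => u k), ← prod_mul_distrib]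
    exact prod_congr rfl fun k _ => hu _ u h

end Residues

/-! ### Torsion values of `phi` -/

lemma phi_add_intCast (z τ : ℂ) (m : ℤ) : phi (z + m) τ = (-1) ^ m * phi z τ := by
  induction m using Int.induction_on with
  | zero => simp
  | succ m ih =>
    push_cast at ih ⊢
    rw [← add_assoc, phi_add_one, ih, zpow_add_one₀ (by norm_num)]
    ring
  | pred m ih =>
    have := phi_add_one (z + (-m - 1)) τ
    push_cast at ih ⊢
    rw [show z + (-(m : ℂ) - 1) + 1 = z + -m by ring, ih] at this
    rw [zpow_sub_one₀ (by norm_num)]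
    linear_combination this

lemma phi_add_nat_mul_tau {τ : ℂ} (hτ : 0 < τ.im) (z : ℂ) (m : ℕ) :
    phi (z + m * τ) τ =
      (-1) ^ m * Complex.exp (-(Real.pi * Complex.I * (m ^ 2 * τ + 2 * m * z))) * phi z τ := by
  induction m with
  | zero => simp
  | succ m ih =>
    rw [show z + ((m + 1 : ℕ) : ℂ) * τ = (z + m * τ) + τ by push_cast; ring, phi_add_tau hτ, ih,
      show -(Real.pi * Complex.I * (((m + 1 : ℕ) : ℂ) ^ 2 * τ + 2 * ((m + 1 : ℕ) : ℂ) * z)) =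
        -(Real.pi * Complex.I * (τ + 2 * (z + m * τ))) +
          -(Real.pi * Complex.I * (m ^ 2 * τ + 2 * m * z)) by push_cast; ring, Complex.exp_add,
      pow_succ]
    ring

lemma oddAntiperiodic_phi {p : ℕ} (hp : p ≠ 0) {τ : ℂ} (hτ : 0 < τ.im) :
    OddAntiperiodic p (fun k => phi (k / p) τ) where
  add_period k := by
    have : (p : ℂ) ≠ 0 := by exact_mod_cast hp
    rw [← phi_add_one]
    congr 1
    push_cast
    field_simp
  neg k := by
    rw [← phi_neg hτ]
    push_cast
    rw [neg_div]

/-- The transformation law of `phi` at `p`-torsion points under `Γ_0(p)`. -/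
lemma phi_torsion_smul {p : ℕ} (hp : p ≠ 0) (A : SL(2, ℤ)) {c : ℕ} (hc : A 1 0 = p * c) (τ : ℍ)
    (k : ℕ) :
    phi (k / p) (A • τ : ℍ) = (autFactor A τ)⁻¹ * ((-1) ^ (k * c) *
      Complex.exp (-(Real.pi * Complex.I * (k ^ 2 * c * A 1 1 / p)))) *
        phi (((k * A 1 1 : ℤ) : ℂ) / p) τ := by
  have hp0 : (p : ℂ) ≠ 0 := by exact_mod_cast hp
  have h0 := autFactor_ne_zero A τ
  have h := phiLaw A τ (k / p * autFactor A τ)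
  have hD : autFactor A τ = p * c * τ + A 1 1 := by
    rw [autFactor, hc]; push_cast; ring
  rw [mul_div_cancel_right₀ _ h0] at h
  rw [h, show (k / p * autFactor A τ : ℂ) = ((k * A 1 1 : ℤ) : ℂ) / p + ((k * c : ℕ) : ℂ) * τ by
    rw [hD]; push_cast; field_simp; ring, phi_add_nat_mul_tau τ.im_pos]
  have hexp : Complex.exp (Real.pi * Complex.I * (A 1 0 : ℤ) *
        (((k * A 1 1 : ℤ) : ℂ) / p + ((k * c : ℕ) : ℂ) * τ) ^ 2 / autFactor A τ) *
      Complex.exp (-(Real.pi * Complex.I * (((k * c : ℕ) : ℂ) ^ 2 * τ + 2 * ((k * c : ℕ) : ℂ) *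
        (((k * A 1 1 : ℤ) : ℂ) / p)))) =
      Complex.exp (-(Real.pi * Complex.I * (k ^ 2 * c * A 1 1 / p))) := by
    rw [← Complex.exp_add]
    congr 1
    rw [show (((k * A 1 1 : ℤ) : ℂ) / p + ((k * c : ℕ) : ℂ) * τ) = k / p * autFactor A τ by
      rw [hD]; push_cast; field_simp; ring, hc]
    rw [mul_pow, sq (autFactor A τ), ← mul_assoc, ← mul_assoc, mul_div_cancel_right₀ _ h0, hD]
    push_cast
    field_simp
    ring
  rw [← hexp]
  ring

end CrankSymmetry

end

noncomputable section

namespace CrankSymmetry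

open Filter Topology Finset Matrix MatrixGroups

/-! ### The eta quotient `η(p²τ) / η(τ)` -/

/-- The point `N τ`. -/
def scale (N : ℕ) [NeZero N] (τ : ℍ) : ℍ :=
  ⟨N * τ, by
    have : 0 < (N : ℝ) := by exact_mod_cast Nat.pos_of_ne_zero (NeZero.ne N)
    simpa using mul_pos this τ.im_pos⟩

@[simp] lemma coe_scale (N : ℕ) [NeZero N] (τ : ℍ) : (scale N τ : ℂ) = N * τ := rfl

/-! ### Arithmetic of s_p -/

section Arithmetic

variable {p : ℕ}

lemma sP_mul (hp : p.Prime) (h3 : 3 < p) : 24 * sP p + 1 = p ^ 2 := by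
  have h2 : p % 2 = 1 := Nat.odd_iff.mp (hp.odd_of_ne_two (by omega))
  have h3' : p % 3 ≠ 0 := fun h => by
    have := (Nat.prime_dvd_prime_iff_eq Nat.prime_three hp).mp (Nat.dvd_of_mod_eq_zero h)
    omega
  have h24 : p ^ 2 % 24 = 1 := by
    have h : p % 24 < 24 := Nat.mod_lt _ (by norm_num)
    have e2 : p % 24 % 2 = 1 := by omega
    have e3 : p % 24 % 3 ≠ 0 := by omega
    rw [Nat.pow_mod]
    generalize p % 24 = r at *
    interval_cases r <;> simp_all
  unfold sP
  have : 1 ≤ p ^ 2 := Nat.one_le_pow _ _ hp.pos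
  omega

lemma eq_two_mul_half_add_one (hp : p.Prime) (h3 : 3 < p) : p = 2 * ((p - 1) / 2) + 1 := by
  have h2 : p % 2 = 1 := Nat.odd_iff.mp (hp.odd_of_ne_two (by omega))
  omega

lemma six_mul_sP (hp : p.Prime) (h3 : 3 < p) : 6 * sP p = (p - 1) / 2 * ((p - 1) / 2 + 1) := by
  have h1 := sP_mul hp h3
  have h2 := eq_two_mul_half_add_one hp h3
  generalize (p - 1) / 2 = P at *
  subst h2
  nlinarith

lemma sum_Icc_id (P : ℕ) : 2 * ∑ k ∈ Icc 1 P, k = P * (P + 1) := by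
  induction P with
  | zero => simp
  | succ P ih => rw [sum_Icc_succ_top (by omega), mul_add, ih]; ring

lemma sum_Icc_sq (P : ℕ) : 6 * ∑ k ∈ Icc 1 P, k ^ 2 = P * (P + 1) * (2 * P + 1) := by
  induction P with
  | zero => simp
  | succ P ih => rw [sum_Icc_succ_top (by omega), mul_add, ih]; ring

lemma sum_Icc_half (hp : p.Prime) (h3 : 3 < p) : ∑ k ∈ Icc 1 ((p - 1) / 2), k = 3 * sP p := by
  have := sum_Icc_id ((p - 1) / 2)
  have := six_mul_sP hp h3
  omega

lemma sum_Icc_half_sq (hp : p.Prime) (h3 : 3 < p) :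
    ∑ k ∈ Icc 1 ((p - 1) / 2), k ^ 2 = sP p * p := by
  have h1 := sum_Icc_sq ((p - 1) / 2)
  have h2 := six_mul_sP hp h3
  have h4 := eq_two_mul_half_add_one hp h3
  rw [← h4, ← h2] at h1
  nlinarith

end Arithmetic

/-! ### Products of torsion values and the invariance of the eta quotient -/

lemma isPrimitiveRoot_zeta (p : ℕ) (hp : p ≠ 0) : IsPrimitiveRoot (zeta p) p :=
  Complex.isPrimitiveRoot_exp p hp

lemma prod_one_sub_zeta_pow_mul {p : ℕ} (hp : 0 < p) (y : ℂ) :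
    ∏ k ∈ range p, (1 - zeta p ^ k * y) = 1 - y ^ p := by
  have h := (isPrimitiveRoot_zeta p hp.ne').pow_sub_pow_eq_prod_sub_mul 1 y hp
  rw [one_pow] at h
  rw [h]
  have hmaps : ∀ k ∈ range p, zeta p ^ k ∈ Polynomial.nthRootsFinset p (1 : ℂ) := fun k _ => by
    rw [Polynomial.mem_nthRootsFinset hp, ← pow_mul, mul_comm, pow_mul,
      (isPrimitiveRoot_zeta p hp.ne').pow_eq_one, one_pow]
  have hinj : Set.InjOn (fun k => zeta p ^ k) (range p : Finset ℕ) := fun k hk l hl hkl =>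
    (isPrimitiveRoot_zeta p hp.ne').pow_inj (by simpa using hk) (by simpa using hl) hkl
  refine Finset.prod_nbij (fun k => zeta p ^ k) hmaps hinj
    (Finset.surjOn_of_injOn_of_card_le _ hmaps hinj ?_) (fun _ _ => rfl)
  rw [(isPrimitiveRoot_zeta p hp.ne').card_nthRootsFinset, card_range]

lemma prod_qPoch_zeta {p : ℕ} (hp : 0 < p) {q : ℂ} (hq : ‖q‖ < 1) :
    ∏ k ∈ range p, qPoch (zeta p ^ k * q) q = qPoch (q ^ p) (q ^ p) := by
  unfold qPoch
  rw [← Multipliable.tprod_finsetProd (fun k _ => multipliable_qPoch _ hq)]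
  refine tprod_congr fun n => ?_
  simp only [mul_assoc]
  rw [prod_one_sub_zeta_pow_mul hp, mul_pow, ← pow_mul, ← pow_mul, mul_comm p n]

lemma prod_range_odd {M : Type*} [CommMonoid M] (f : ℕ → M) (P : ℕ) :
    ∏ k ∈ range (2 * P + 1), f k = f 0 * ∏ k ∈ Icc 1 P, (f k * f (2 * P + 1 - k)) := by
  rw [prod_range_succ', mul_comm, two_mul, prod_range_add, prod_mul_distrib]
  have h1 : ∏ k ∈ Icc 1 P, f k = ∏ k ∈ range P, f (k + 1) := by
    rw [Finset.range_eq_Ico, Finset.prod_Ico_add' f 0 P 1]; rfl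
  have h2 : ∏ k ∈ Icc 1 P, f (P + P + 1 - k) = ∏ k ∈ range P, f (P + k + 1) := by
    rw [← Finset.prod_range_reflect (fun k => f (P + k + 1)),
      show Icc 1 P = Ico (0 + 1) (P + 1) from rfl,
      ← Finset.prod_Ico_add' (fun k => f (P + P + 1 - k)) 0 P 1, ← Finset.range_eq_Ico]
    refine prod_congr rfl fun k hk => ?_
    rw [mem_range] at hk
    congr 1
    omega
  rw [h1, h2]

/-- The product of the values of `phi` at the points `k/p`, `1 ≤ k ≤ (p-1)/2`. -/
def torsionProd (p : ℕ) (τ : ℂ) : ℂ := ∏ k ∈ Icc 1 ((p - 1) / 2), phi (((k : ℤ) : ℂ) / p) τ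

lemma phi_eq {τ : ℂ} (hτ : 0 < τ.im) (z : ℂ) :
    phi z τ = -Complex.exp (-(Real.pi * Complex.I * z)) * (1 - Complex.exp (2 * Real.pi * Complex.I * z)) *
      (qPoch (Complex.exp (2 * Real.pi * Complex.I * z) * Complex.exp (2 * Real.pi * Complex.I * τ))
        (Complex.exp (2 * Real.pi * Complex.I * τ)) *
      qPoch (Complex.exp (-(2 * Real.pi * Complex.I * z)) * Complex.exp (2 * Real.pi * Complex.I * τ))
        (Complex.exp (2 * Real.pi * Complex.I * τ)) / eulerFun τ ^ 2) := by
  have hq := norm_exp_two_pi_I_lt_one hτ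
  rw [phi, thetaProd, qPoch_succ (Complex.exp (2 * Real.pi * Complex.I * z)) hq, ← eulerFun,
    show τ - z = -z + τ by ring, exp_two_pi_I_add, mul_neg]
  have := eulerFun_ne_zero hτ
  field_simp

/-- Each value φ(k/p) carries the factors of ζ^k and ζ^{-k} = ζ^{p-k}. Together with (q;q) for k = 0
these exhaust the p-th roots of unity, and ∏(1 - ζ^k y) = 1 - y^p gives (q^p;q^p). -/
lemma exists_torsionProd_eq {p : ℕ} (hp : p.Prime) (h3 : 3 < p) :
    ∃ κ : ℂ, κ ≠ 0 ∧ ∀ τ : ℂ, 0 < τ.im →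
      torsionProd p τ = κ * (eulerFun (p * τ) / eulerFun τ ^ p) := by
  have hpP := eq_two_mul_half_add_one hp h3
  have hz := isPrimitiveRoot_zeta p hp.ne_zero
  refine ⟨∏ k ∈ Icc 1 ((p - 1) / 2), (-Complex.exp (-(Real.pi * Complex.I * (((k : ℤ) : ℂ) / p))) *
    (1 - Complex.exp (2 * Real.pi * Complex.I * (((k : ℤ) : ℂ) / p)))), ?_, fun τ hτ => ?_⟩
  · refine prod_ne_zero_iff.mpr fun k hk => mul_ne_zero (neg_ne_zero.mpr (Complex.exp_ne_zero _)) ?_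
    rw [mem_Icc] at hk
    have : Complex.exp (2 * Real.pi * Complex.I * (((k : ℤ) : ℂ) / p)) = zeta p ^ k := by
      rw [zeta, ← Complex.exp_nat_mul]
      congr 1
      push_cast
      ring
    rw [this, sub_ne_zero]
    exact fun h => hz.pow_ne_one_of_pos_of_lt (by omega) (by omega) h.symm
  · have hq := norm_exp_two_pi_I_lt_one hτ
    have hE := eulerFun_ne_zero hτ
    rw [torsionProd, prod_congr rfl (fun k _ => phi_eq hτ _), prod_mul_distrib, prod_div_distrib,
      prod_const, Nat.card_Icc, Nat.add_sub_cancel]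
    congr 1
    have h1 := prod_qPoch_zeta hp.pos hq
    have h2 : eulerFun (p * τ) = qPoch (Complex.exp (2 * Real.pi * Complex.I * τ) ^ p)
        (Complex.exp (2 * Real.pi * Complex.I * τ) ^ p) := by
      rw [eulerFun, exp_two_pi_I_mul_pow]
    rw [h2, ← h1]
    have h4 := prod_range_odd (fun k => qPoch (zeta p ^ k * Complex.exp (2 * Real.pi * Complex.I * τ))
      (Complex.exp (2 * Real.pi * Complex.I * τ))) ((p - 1) / 2)
    rw [← hpP] at h4
    rw [h4, pow_zero, one_mul, ← eulerFun]
    have h5 : eulerFun τ ^ p = (eulerFun τ ^ 2) ^ ((p - 1) / 2) * eulerFun τ := by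
      rw [← pow_mul, ← pow_succ, ← hpP]
    rw [h5, mul_comm (eulerFun τ) (∏ k ∈ Icc 1 ((p - 1) / 2), _), mul_div_mul_right _ _ hE]
    congr 1
    refine prod_congr rfl fun k hk => ?_
    rw [mem_Icc] at hk
    have hzk : Complex.exp (2 * Real.pi * Complex.I * (((k : ℤ) : ℂ) / p)) = zeta p ^ k := by
      rw [zeta, ← Complex.exp_nat_mul]
      congr 1
      push_cast
      ring
    have hzk' : Complex.exp (-(2 * Real.pi * Complex.I * (((k : ℤ) : ℂ) / p))) = zeta p ^ (p - k) := by
      rw [Complex.exp_neg, hzk]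
      refine inv_eq_of_mul_eq_one_right ?_
      rw [← pow_add, Nat.add_sub_cancel' (by omega), hz.pow_eq_one]
    rw [hzk, hzk']

/-- The function `η(p²τ) / η(τ)`, for a prime `p > 3`. -/
def etaRatio (p : ℕ) (τ : ℂ) : ℂ :=
  Complex.exp (2 * Real.pi * Complex.I * (sP p * τ)) * (eulerFun (p ^ 2 * τ) / eulerFun τ)

/-- If E = (q;q) and T is the torsion product, then T(pτ)T(τ)^p is a constant times
E(p²τ)/E(τ)^{p²}, because E(pτ)^p cancels. The excess E^{p²-1} is restored by the s_p-th power of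
η^24. All factors on the right have known transformation laws. -/
lemma exists_etaRatio_eq {p : ℕ} (hp : p.Prime) (h3 : 3 < p) :
    ∃ κ : ℂ, ∀ τ : ℂ, 0 < τ.im →
      etaRatio p τ = κ * (torsionProd p (p * τ) * torsionProd p τ ^ p *
        (ModularForm.eta τ ^ 24) ^ sP p) := by
  obtain ⟨κ, hκ, h⟩ := exists_torsionProd_eq hp h3
  have : NeZero p := ⟨hp.ne_zero⟩
  refine ⟨(κ ^ (p + 1))⁻¹, fun τ hτ => ?_⟩
  have hpτ : 0 < ((p : ℂ) * τ).im := (scale p ⟨τ, hτ⟩).im_pos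
  rw [h τ hτ, h _ hpτ, etaRatio, ← mul_assoc (p : ℂ), ← sq, eta_eq_eulerFun]
  have hE := eulerFun_ne_zero hτ
  have hE' := eulerFun_ne_zero hpτ
  have hpow : (eulerFun τ ^ 24) ^ sP p * eulerFun τ = (eulerFun τ ^ p) ^ p := by
    rw [← pow_mul, ← pow_mul, ← pow_succ, sP_mul hp h3, sq]
  have hexp : (Complex.exp (2 * Real.pi * Complex.I * τ / 24) ^ 24) ^ sP p =
      Complex.exp (2 * Real.pi * Complex.I * (sP p * τ)) := by
    rw [← Complex.exp_nat_mul, ← Complex.exp_nat_mul]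
    congr 1
    push_cast
    ring
  rw [mul_pow κ, mul_pow (Complex.exp _), mul_pow _ _ (sP p), hexp, div_pow, pow_succ κ p, ← hpow]
  generalize eulerFun (p * τ) = E₁ at *
  generalize eulerFun (p ^ 2 * τ) = E₂ at *
  field_simp

lemma oddAntiperiodic_phi_torsion {p : ℕ} (hp : p.Prime) (τ : ℍ) :
    OddAntiperiodic p (fun k => phi ((k : ℂ) / p) τ) := oddAntiperiodic_phi hp.ne_zero τ.im_pos

lemma neg_one_pow_natCast_mul (n : ℕ) (m : ℤ) : Complex.exp (-(Real.pi * Complex.I * (n * m))) =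
    (-1) ^ ((n : ℤ) * m) := by
  have h := exp_pi_I_mul_intCast (-((n : ℤ) * m))
  rw [show Real.pi * Complex.I * ((-((n : ℤ) * m) : ℤ) : ℂ) = -(Real.pi * Complex.I * (n * m)) by
    push_cast; ring] at h
  rw [h, _root_.zpow_neg]
  rcases Int.even_or_odd ((n : ℤ) * m) with h | h <;> simp [h.neg_one_zpow]

/-- Multiply `phi_torsion_smul` over k. Since ∑k = 3s_p and ∑k² = p·s_p, the roots of unity combine
to signs. -/
lemma torsionProd_smul {p : ℕ} (hp : p.Prime) (h3 : 3 < p) (A : SL(2, ℤ)) {c : ℕ}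
    (hc : A 1 0 = p * c) (τ : ℍ) :
    torsionProd p (A • τ : ℍ) = (autFactor A τ)⁻¹ ^ ((p - 1) / 2) *
      ((-1) ^ (3 * sP p * c) * (-1) ^ ((sP p * c : ℕ) * A 1 1)) *
        ∏ k ∈ Icc 1 ((p - 1) / 2), phi (((k * A 1 1 : ℤ) : ℂ) / p) τ := by
  unfold torsionProd
  have h1 : ∀ k : ℕ, phi (((k : ℤ) : ℂ) / p) (A • τ : ℍ) = (autFactor A τ)⁻¹ * ((-1) ^ (k * c) *
      Complex.exp (-(Real.pi * Complex.I * (k ^ 2 * c * A 1 1 / p)))) *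
        phi (((k * A 1 1 : ℤ) : ℂ) / p) τ := fun k => by
    rw [← phi_torsion_smul hp.ne_zero A hc τ k]
    push_cast
    rfl
  rw [prod_congr rfl (fun k _ => h1 k), prod_mul_distrib, prod_mul_distrib, prod_mul_distrib,
    prod_const, Nat.card_Icc, Nat.add_sub_cancel]
  congr 3
  · rw [prod_pow_eq_pow_sum, ← sum_mul, sum_Icc_half hp h3]
  · rw [← Complex.exp_sum, ← neg_one_pow_natCast_mul]
    congr 1
    rw [sum_neg_distrib, ← mul_sum]
    congr 2
    have := congrArg (fun n : ℕ => (n : ℂ)) (sum_Icc_half_sq hp h3)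
    push_cast at this ⊢
    have hp0 : (p : ℂ) ≠ 0 := by exact_mod_cast hp.ne_zero
    rw [← sum_div, ← sum_mul, ← sum_mul, this]
    field_simp

/-- The conjugate of a matrix by `diag(N, 1)`. -/
def conjScale (N : ℕ) (A : SL(2, ℤ)) (c : ℤ) (hc : A 1 0 = N * c) : SL(2, ℤ) :=
  ⟨!![A 0 0, N * A 0 1; c, A 1 1], by
    have := A.det_coe
    rw [Matrix.det_fin_two] at this ⊢
    simp only [Matrix.of_apply, Matrix.cons_val', Matrix.cons_val_zero, Matrix.cons_val_one,
      Matrix.cons_val_fin_one]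
    rw [hc] at this
    linear_combination this⟩

lemma autFactor_conjScale (N : ℕ) [NeZero N] (A : SL(2, ℤ)) (c : ℤ) (hc : A 1 0 = N * c) (τ : ℍ) :
    autFactor (conjScale N A c hc) (scale N τ) = autFactor A τ := by
  simp only [autFactor, conjScale, hc, coe_scale]
  simp
  ring

lemma conjScale_smul (N : ℕ) [NeZero N] (A : SL(2, ℤ)) (c : ℤ) (hc : A 1 0 = N * c) (τ : ℍ) :
    conjScale N A c hc • scale N τ = scale N (A • τ) := by
  ext
  have h0 := autFactor_ne_zero A τ
  rw [coe_smul_eq, autFactor_conjScale, coe_scale, coe_scale, coe_smul_eq]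
  field_simp
  simp [conjScale]
  ring

/-- `η(p²τ) / η(τ)` is invariant under the matrices of `SL(2, ℤ)` with lower left entry `p²`. -/
theorem etaRatio_smul {p : ℕ} (hp : p.Prime) (h3 : 3 < p) (A : SL(2, ℤ)) (hA : A 1 0 = p * p)
    (τ : ℍ) : etaRatio p (A • τ : ℍ) = etaRatio p τ := by
  have : NeZero p := ⟨hp.ne_zero⟩
  have : Fact p.Prime := ⟨hp⟩
  obtain ⟨κ, hκ⟩ := exists_etaRatio_eq hp h3
  have hδ : ((A 1 1 : ℤ) : ZMod p) ≠ 0 := by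
    intro h
    have hdet := A.det_coe
    rw [Matrix.det_fin_two, hA] at hdet
    have := congrArg (fun m : ℤ => (m : ZMod p)) hdet
    simp [h] at this
  obtain ⟨σ, hσ, hprod⟩ := exists_sign_prod_mul (p := p) (by omega) hδ
  have h1 : torsionProd p (A • τ : ℍ) = (autFactor A τ)⁻¹ ^ ((p - 1) / 2) *
      ((-1) ^ (3 * sP p * p) * (-1) ^ ((sP p * p : ℕ) * A 1 1)) * (σ * torsionProd p τ) := by
    rw [torsionProd_smul hp h3 A hA τ, hprod _ (oddAntiperiodic_phi_torsion hp τ)]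
    rfl
  -- The point pτ is moved by the conjugate matrix, whose lower left entry is p. Hence c = 1 here,
  -- against c = p at τ; the resulting signs agree because p is odd.
  have hA1 : conjScale p A p hA 1 0 = p * (1 : ℕ) := by simp [conjScale]
  have hA11 : conjScale p A p hA 1 1 = A 1 1 := by simp [conjScale]
  have h2 : torsionProd p (p * (A • τ : ℍ)) = (autFactor A τ)⁻¹ ^ ((p - 1) / 2) *
      ((-1) ^ (3 * sP p * 1) * (-1) ^ ((sP p * 1 : ℕ) * A 1 1)) * (σ * torsionProd p (p * τ)) := by
    have := torsionProd_smul hp h3 (conjScale p A p hA) hA1 (scale p τ)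
    rw [hA11, hprod _ (oddAntiperiodic_phi_torsion hp (scale p τ)), conjScale_smul,
      autFactor_conjScale, coe_scale, coe_scale] at this
    rw [this]
    rfl
  have hodd : Odd p := hp.odd_of_ne_two (by omega)
  have ha : ((-1 : ℂ)) ^ (3 * sP p * p) = (-1) ^ (3 * sP p * 1) := by
    rw [pow_mul _ (3 * sP p), pow_mul _ (3 * sP p)]
    generalize 3 * sP p = m
    rcases neg_one_pow_eq_or ℂ m with h | h <;> simp [h, hodd.neg_one_pow]
  have hb : ((-1 : ℂ)) ^ ((sP p * p : ℕ) * A 1 1) = (-1) ^ ((sP p * 1 : ℕ) * A 1 1) := by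
    rw [_root_.zpow_mul, _root_.zpow_mul, zpow_natCast, zpow_natCast, pow_mul, pow_mul]
    rcases neg_one_pow_eq_or ℂ (sP p) with h | h <;> simp [h, hodd.neg_one_pow]
  have hD := autFactor_ne_zero A τ
  have h6 := six_mul_sP hp h3
  have hP := eq_two_mul_half_add_one hp h3
  rw [hκ _ (A • τ).im_pos, hκ _ τ.im_pos, h1, h2, eta_pow_smul A τ, ha, hb]
  -- T(pτ) and T(τ) acquire the same factor, which thus occurs to the even power p+1, so every sign
  -- disappears. The weights cancel since (p+1)(p-1)/2 = 12 s_p.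
  have hg : ((autFactor A τ)⁻¹ ^ ((p - 1) / 2) * ((-1) ^ (3 * sP p * 1) *
      (-1) ^ ((sP p * 1 : ℕ) * A 1 1)) * σ) ^ (p + 1) * (autFactor A τ ^ 12) ^ sP p = 1 := by
    have h12 : (autFactor A τ ^ 12) ^ sP p =
        (autFactor A τ ^ (2 * ((p - 1) / 2))) ^ ((p - 1) / 2 + 1) := by
      rw [← pow_mul, ← pow_mul]
      congr 1
      linarith
    have hp1 : p + 1 = 2 * ((p - 1) / 2 + 1) := by omega
    have hs : ((-1 : ℂ) ^ (3 * sP p * 1)) ^ 2 = 1 := by rw [← pow_mul, mul_comm, pow_mul]; simp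
    have hs' := neg_one_zpow_sq ((sP p * 1 : ℕ) * A 1 1)
    generalize (-1 : ℂ) ^ (3 * sP p * 1) = a at hs ⊢
    generalize (-1 : ℂ) ^ ((sP p * 1 : ℕ) * A 1 1) = b at hs' ⊢
    have h7 : ((autFactor A τ)⁻¹ ^ ((p - 1) / 2) * (a * b) * σ) ^ 2 =
        (autFactor A τ)⁻¹ ^ (2 * ((p - 1) / 2)) := by
      rw [mul_comm 2, pow_mul]
      linear_combination ((autFactor A τ)⁻¹ ^ ((p - 1) / 2)) ^ 2 *
        (b ^ 2 * σ ^ 2 * hs + σ ^ 2 * hs' + hσ)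
    rw [h12, hp1, pow_mul _ 2, h7, ← mul_pow, ← mul_pow, inv_mul_cancel₀ hD, one_pow, one_pow]
  generalize (autFactor A τ)⁻¹ ^ ((p - 1) / 2) * ((-1) ^ (3 * sP p * 1) *
      (-1) ^ ((sP p * 1 : ℕ) * A 1 1)) = g at *
  rw [← mul_assoc g, ← mul_assoc g, mul_pow, mul_pow]
  rw [pow_succ] at hg
  linear_combination (κ * torsionProd p (p * τ) * torsionProd p τ ^ p *
    (ModularForm.eta τ ^ 24) ^ sP p) * hg

end CrankSymmetry

end

noncomputable section

namespace CrankSymmetry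

open Filter Topology Finset PowerSeries

/-! ### Power series on the unit disc -/

/-- The power series `F` converges to `f` on the open unit disc. -/
def Represents (F : ℂ⟦X⟧) (f : ℂ → ℂ) : Prop :=
  ∀ q : ℂ, ‖q‖ < 1 → HasSum (fun n => coeff n F * q ^ n) (f q)

namespace Represents

variable {F G : ℂ⟦X⟧} {f g : ℂ → ℂ}

lemma congr (h : Represents F f) (hfg : ∀ q : ℂ, ‖q‖ < 1 → f q = g q) : Represents F g :=
  fun q hq => hfg q hq ▸ h q hq

lemma summable_norm (h : Represents F f) {q : ℂ} (hq : ‖q‖ < 1) :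
    Summable fun n => ‖coeff n F * q ^ n‖ := (h q hq).summable.norm

lemma summable_norm_mul_pow (h : Represents F f) {r : ℝ} (h0 : 0 ≤ r) (h1 : r < 1) :
    Summable fun n => ‖coeff n F‖ * r ^ n := by
  have := h.summable_norm (q := r) (by simpa [abs_of_nonneg h0] using h1)
  simpa [abs_of_nonneg h0] using this

lemma add (hF : Represents F f) (hG : Represents G g) : Represents (F + G) (f + g) :=
  fun q hq => by simpa [add_mul] using (hF q hq).add (hG q hq)

lemma sub (hF : Represents F f) (hG : Represents G g) : Represents (F - G) (f - g) :=
  fun q hq => by simpa [sub_mul] using (hF q hq).sub (hG q hq)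

lemma mul (hF : Represents F f) (hG : Represents G g) : Represents (F * G) (f * g) := by
  intro q hq
  have h := (summable_norm_sum_mul_antidiagonal_of_summable_norm (hF.summable_norm hq)
    (hG.summable_norm hq)).of_norm.hasSum
  rw [← tsum_mul_tsum_eq_tsum_sum_antidiagonal_of_summable_norm (hF.summable_norm hq)
    (hG.summable_norm hq), (hF q hq).tsum_eq, (hG q hq).tsum_eq] at h
  convert! h using 1
  ext n
  rw [coeff_mul, sum_mul]
  refine sum_congr rfl fun x hx => ?_
  rw [← mem_antidiagonal.mp hx, pow_add]
  ring

lemma const (a : ℂ) : Represents (C a) (fun _ => a) := by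
  intro q _
  convert! hasSum_ite_eq 0 a using 1
  ext n
  rw [coeff_C]
  split_ifs with h <;> simp [h]

lemma one : Represents 1 1 := by simpa using! const 1

lemma X_pow (m : ℕ) : Represents (X ^ m) (fun q => q ^ m) := by
  intro q _
  convert! hasSum_ite_eq m (q ^ m) using 1
  ext n
  rw [coeff_X_pow]
  split_ifs with h <;> simp [h]

lemma prod {ι : Type*} (s : Finset ι) {F : ι → ℂ⟦X⟧} {f : ι → ℂ → ℂ}
    (h : ∀ i ∈ s, Represents (F i) (f i)) : Represents (∏ i ∈ s, F i) (∏ i ∈ s, f i) := by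
  classical
  induction s using Finset.induction_on with
  | empty => simpa using one
  | insert i s hi ih =>
    rw [prod_insert hi, prod_insert hi]
    exact (h i (mem_insert_self i s)).mul (ih fun j hj => h j (mem_insert_of_mem hj))

lemma differentiableOn (h : Represents F f) : DifferentiableOn ℂ f (Metric.ball 0 1) := by
  intro q hq
  rw [mem_ball_zero_iff] at hq
  obtain ⟨r, hr1, hr2⟩ := exists_between hq
  have hr0 : 0 ≤ r := (norm_nonneg q).trans hr1.le
  have h1 : DifferentiableOn ℂ (fun w : ℂ => ∑' n, coeff n F * w ^ n) (Metric.ball 0 r) := by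
    refine Complex.differentiableOn_tsum_of_summable_norm (h.summable_norm_mul_pow hr0 hr2)
      (fun n => by fun_prop) Metric.isOpen_ball fun n w hw => ?_
    rw [mem_ball_zero_iff] at hw
    rw [norm_mul, norm_pow]
    gcongr
  have hmem : Metric.ball (0 : ℂ) r ∈ 𝓝 q := Metric.isOpen_ball.mem_nhds (by simpa using hr1)
  refine ((h1.differentiableAt hmem).congr_of_eventuallyEq ?_).differentiableWithinAt
  filter_upwards [hmem] with w hw
  exact (h w ((mem_ball_zero_iff.mp hw).trans hr2)).tsum_eq.symm

lemma continuousAt_zero (h : Represents F f) : ContinuousAt f 0 :=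
  (h.differentiableOn.differentiableAt
    (Metric.isOpen_ball.mem_nhds (by simp))).continuousAt

lemma apply_zero (h : Represents F f) : f 0 = constantCoeff F := by
  have h1 := h 0 (by simp)
  have h2 : HasSum (fun n => coeff n F * (0 : ℂ) ^ n) (coeff 0 F * 0 ^ 0) :=
    hasSum_single 0 fun n hn => by simp [hn]
  simpa using h1.unique h2

/-- A power series vanishing on the punctured unit disc is zero. -/
lemma eq_zero (h : Represents F f) (hf : ∀ q : ℂ, ‖q‖ < 1 → q ≠ 0 → f q = 0) : F = 0 := by
  have h0 : f 0 = 0 := by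
    have h1 : Tendsto f (𝓝[≠] 0) (𝓝 (f 0)) := h.continuousAt_zero.tendsto.mono_left nhdsWithin_le_nhds
    refine tendsto_nhds_unique h1 (tendsto_const_nhds.congr' ?_)
    have : Metric.ball (0 : ℂ) 1 ∈ 𝓝[≠] (0 : ℂ) :=
      mem_nhdsWithin_of_mem_nhds (Metric.isOpen_ball.mem_nhds (by simp))
    filter_upwards [this, self_mem_nhdsWithin] with q hq hq0
    exact (hf q (by simpa using hq) hq0).symm
  have hp : HasFPowerSeriesAt (0 : ℂ → ℂ) (FormalMultilinearSeries.ofScalars ℂ fun n => coeff n F) 0 := by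
    rw [hasFPowerSeriesAt_iff]
    filter_upwards [Metric.ball_mem_nhds (0 : ℂ) one_pos] with q hq
    rw [mem_ball_zero_iff] at hq
    have h2 := h q hq
    have h3 : f q = 0 := by
      by_cases hq0 : q = 0
      · rw [hq0, h0]
      · exact hf q hq hq0
    rw [h3] at h2
    simpa [FormalMultilinearSeries.coeff_ofScalars, mul_comm] using h2
  have h4 := hp.eq_zero
  ext n
  have h5 := congrArg (fun p : FormalMultilinearSeries ℂ ℂ ℂ => p.coeff n) h4
  simp only [FormalMultilinearSeries.coeff_ofScalars] at h5
  exact h5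

lemma unique (hF : Represents F f) (hG : Represents G f) : F = G :=
  sub_eq_zero.mp ((hF.sub hG).eq_zero fun q _ _ => by simp)

end Represents

/-- The Taylor series at the origin. -/
def taylor (f : ℂ → ℂ) : ℂ⟦X⟧ := PowerSeries.mk fun n => (n.factorial : ℂ)⁻¹ * iteratedDeriv n f 0

lemma represents_taylor {f : ℂ → ℂ} (hf : DifferentiableOn ℂ f (Metric.ball 0 1)) :
    Represents (taylor f) f := by
  intro q hq
  have := Complex.hasSum_taylorSeries_on_ball (c := 0) (r := 1) (z := q) hf (by simpa using hq)
  convert! this using 1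
  ext n
  simp [taylor]
  ring

lemma Represents.eq_taylor {F : ℂ⟦X⟧} {f : ℂ → ℂ} (h : Represents F f) : F = taylor f :=
  h.unique (represents_taylor h.differentiableOn)

/-- The reciprocal is holomorphic on the disc, hence is the sum of its Taylor series there, and by
uniqueness that series is the formal inverse. -/
lemma Represents.exists_inv {F : ℂ⟦X⟧} {f : ℂ → ℂ} (h : Represents F f)
    (hf : ∀ q : ℂ, ‖q‖ < 1 → f q ≠ 0) : Represents F⁻¹ (fun q => (f q)⁻¹) := by
  have h1 : DifferentiableOn ℂ (fun q => (f q)⁻¹) (Metric.ball 0 1) :=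
    h.differentiableOn.fun_inv fun q hq => hf q (by simpa using hq)
  have h2 := represents_taylor h1
  have h3 : F * taylor (fun q => (f q)⁻¹) = 1 := by
    refine Represents.unique (f := 1) ((h.mul h2).congr fun q hq => ?_) Represents.one
    simp [hf q hq]
  have h4 : constantCoeff F ≠ 0 := by
    rw [← h.apply_zero]
    exact hf 0 (by simp)
  have h5 : F⁻¹ = taylor (fun q => (f q)⁻¹) := by
    rw [PowerSeries.inv_eq_iff_mul_eq_one h4, mul_comm, h3]
  rwa [h5]

lemma tendsto_taylor_coeff {ι : Type*} {l : Filter ι} [l.NeBot] {f : ι → ℂ → ℂ} {g : ℂ → ℂ}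
    (h : TendstoLocallyUniformlyOn f g l (Metric.ball 0 1))
    (hf : ∀ i, DifferentiableOn ℂ (f i) (Metric.ball 0 1)) (n : ℕ) :
    Tendsto (fun i => coeff n (taylor (f i))) l (𝓝 (coeff n (taylor g))) := by
  have key : ∀ n : ℕ, TendstoLocallyUniformlyOn (fun i => iteratedDeriv n (f i)) (iteratedDeriv n g) l
      (Metric.ball 0 1) ∧ ∀ i, DifferentiableOn ℂ (iteratedDeriv n (f i)) (Metric.ball 0 1) := by
    intro n
    induction n with
    | zero => simpa using ⟨h, hf⟩
    | succ n ih =>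
      simp only [iteratedDeriv_succ]
      exact ⟨ih.1.deriv (Eventually.of_forall ih.2) Metric.isOpen_ball,
        fun i => (ih.2 i).deriv Metric.isOpen_ball⟩
  simp only [taylor, coeff_mk]
  exact ((key n).1.tendsto_at (by simp)).const_mul _

/-- Weierstrass: locally uniform limits may be differentiated, so Taylor coefficients converge. This
ties analytic infinite products to formal ones. -/
lemma Represents.of_tendsto {ι : Type*} {l : Filter ι} [l.NeBot] {F : ι → ℂ⟦X⟧} {f : ι → ℂ → ℂ}
    {g : ℂ → ℂ} (h : TendstoLocallyUniformlyOn f g l (Metric.ball 0 1))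
    (hf : ∀ i, Represents (F i) (f i)) :
    ∃ G, Represents G g ∧ ∀ n, Tendsto (fun i => coeff n (F i)) l (𝓝 (coeff n G)) := by
  have h1 := fun i => (hf i).differentiableOn
  refine ⟨taylor g, represents_taylor (h.differentiableOn (Eventually.of_forall h1)
    Metric.isOpen_ball), fun n => ?_⟩
  simp only [fun i => (hf i).eq_taylor]
  exact tendsto_taylor_coeff h h1 n

/-- Infinite products `∏ (1 - w_i q^{e_i})`. -/
lemma exists_represents_tprod {w : ℕ → ℂ} {e : ℕ → ℕ} {B : ℝ} (hw : ∀ i, ‖w i‖ ≤ B)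
    (he : ∀ i, i ≤ e i) :
    ∃ W : ℂ⟦X⟧, Represents W (fun q => ∏' i, (1 - w i * q ^ e i)) ∧
      ∀ n, Tendsto (fun s : Finset ℕ => coeff n (∏ i ∈ s, (1 - C (w i) * X ^ e i) : ℂ⟦X⟧)) atTop
        (𝓝 (coeff n W)) := by
  have hloc : HasProdLocallyUniformlyOn (fun i (q : ℂ) => 1 + -(w i * q ^ e i))
      (fun q => ∏' i, (1 + -(w i * q ^ e i))) (Metric.ball 0 1) := by
    apply hasProdLocallyUniformlyOn_of_forall_compact Metric.isOpen_ball
    intro K hK hcK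
    obtain ⟨r, hr0, hr1, hr⟩ : ∃ r : ℝ, 0 ≤ r ∧ r < 1 ∧ ∀ q ∈ K, ‖q‖ ≤ r := by
      rcases K.eq_empty_or_nonempty with rfl | hne
      · exact ⟨0, le_rfl, one_pos, by simp⟩
      · obtain ⟨q₀, hq₀, hmax⟩ := hcK.exists_isMaxOn hne (f := fun q : ℂ => ‖q‖) (by fun_prop)
        exact ⟨‖q₀‖, norm_nonneg _, by simpa using hK hq₀, fun q hq => hmax hq⟩
    refine ((summable_geometric_of_lt_one hr0 hr1).mul_left B).hasProdUniformlyOn_nat_one_add hcK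
      (.of_forall fun n q hq => ?_) (fun _ => by fun_prop)
    rw [norm_neg, norm_mul, norm_pow]
    have hB : 0 ≤ B := (norm_nonneg _).trans (hw 0)
    have h1 : ‖q‖ ^ e n ≤ r ^ n := calc
      ‖q‖ ^ e n ≤ r ^ e n := by gcongr; exact hr q hq
      _ ≤ r ^ n := pow_le_pow_of_le_one hr0 hr1.le (he n)
    exact mul_le_mul (hw n) h1 (by positivity) hB
  simp only [← sub_eq_add_neg] at hloc
  have hfac : ∀ s : Finset ℕ, Represents (∏ i ∈ s, (1 - C (w i) * X ^ e i) : ℂ⟦X⟧)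
      (fun q => ∏ i ∈ s, (1 - w i * q ^ e i)) := fun s => by
    refine (Represents.prod s fun i _ => Represents.one.sub
      ((Represents.const (w i)).mul (Represents.X_pow (e i)))).congr fun q _ => ?_
    simp [Finset.prod_apply]
  exact Represents.of_tendsto hloc hfac

end CrankSymmetry

end

noncomputable section

namespace CrankSymmetry

open Filter Topology Finset PowerSeries

/-! ### The generating function of the crank -/

section GenFun

open scoped PowerSeries.WithPiTopology

/-- The index i of w stands for the part i+1. Parts at least 2 have multiplicative weights and give
geometric series. The part 1 may be weighted arbitrarily, as the crank requires, and G records its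
factor after multiplication by 1 - w_0 X. -/
lemma represents_genFun {f : ℕ → ℕ → ℂ} {w : ℕ → ℂ} {G : ℂ⟦X⟧} {g : ℂ → ℂ} (hw : ∀ i, ‖w i‖ ≤ 1)
    (hf : ∀ i c, f (i + 2) (c + 1) = w (i + 1) ^ (c + 1))
    (hG : (1 + ∑' j, f 1 (j + 1) • (X : ℂ⟦X⟧) ^ (j + 1)) * (1 - C (w 0) * X) = G)
    (hg : Represents G g) :
    Represents (Nat.Partition.genFun f) (fun q => g q / ∏' i, (1 - w i * q ^ (i + 1))) := by
  obtain ⟨W, hW, hlim⟩ := exists_represents_tprod (e := fun i => i + 1) hw (by simp)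
  have hW' : HasProd (fun i => (1 - C (w i) * X ^ (i + 1) : ℂ⟦X⟧)) W := by
    rw [HasProd, WithPiTopology.tendsto_iff_coeff_tendsto]
    exact hlim
  have h1 := (Nat.Partition.hasProd_genFun f).mul hW'
  have h2 : HasProd (fun i => (1 + ∑' j, f (i + 1) (j + 1) • (X : ℂ⟦X⟧) ^ ((i + 1) * (j + 1))) *
      (1 - C (w i) * X ^ (i + 1))) G := by
    convert! hasProd_ite_eq 0 G using 1
    ext1 i
    split_ifs with hi
    · subst hi
      rw [← hG]
      simp
    · obtain ⟨k, rfl⟩ := Nat.exists_eq_succ_of_ne_zero hi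
      set y : ℂ⟦X⟧ := C (w (k + 1)) * X ^ (k + 1 + 1) with hy
      have hy0 : constantCoeff y = 0 := by simp [hy]
      have hterm : ∀ j, f (k + 1 + 1) (j + 1) • (X : ℂ⟦X⟧) ^ ((k + 1 + 1) * (j + 1)) = y ^ (j + 1) := by
        intro j
        rw [show k + 1 + 1 = k + 2 from rfl, hf, hy, mul_pow, ← pow_mul, smul_eq_C_mul, map_pow]
      simp only [Nat.succ_eq_add_one, hterm]
      have hs := WithPiTopology.summable_pow_of_constantCoeff_eq_zero hy0
      have h3 := hs.tsum_eq_zero_add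
      rw [pow_zero] at h3
      rw [← h3]
      exact WithPiTopology.tsum_pow_mul_one_sub_of_constantCoeff_eq_zero hy0
  have h3 : Nat.Partition.genFun f * W = G := h1.unique h2
  have hne : ∀ q : ℂ, ‖q‖ < 1 → ∏' i, (1 - w i * q ^ (i + 1)) ≠ 0 := by
    intro q hq
    have hlt : ∀ i, ‖w i * q ^ (i + 1)‖ < 1 := fun i => by
      rw [norm_mul, norm_pow]
      have : ‖q‖ ^ (i + 1) < 1 := pow_lt_one₀ (norm_nonneg q) hq (Nat.succ_ne_zero i)
      exact (mul_le_of_le_one_left (by positivity) (hw i)).trans_lt this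
    have := tprod_one_add_ne_zero_of_summable (f := fun i : ℕ => -(w i * q ^ (i + 1)))
      (fun i => by
        rw [← sub_eq_add_neg, sub_ne_zero]
        intro h
        have := hlt i
        rw [← h] at this
        simp at this) (by
        refine Summable.of_nonneg_of_le (fun _ => norm_nonneg _) (fun i => ?_)
          ((summable_nat_add_iff 1).mpr (summable_geometric_of_lt_one (norm_nonneg q) hq))
        rw [norm_neg, norm_mul, norm_pow]
        exact mul_le_of_le_one_left (by positivity) (hw i))
    simpa [sub_eq_add_neg] using this
  have h4 : constantCoeff W ≠ 0 := by
    rw [← hW.apply_zero]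
    exact hne 0 (by simp)
  have h5 : Nat.Partition.genFun f = G * W⁻¹ := by
    rw [← h3, mul_assoc, PowerSeries.mul_inv_cancel _ h4, mul_one]
  rw [h5]
  exact (hg.mul (hW.exists_inv hne)).congr fun q _ => (div_eq_mul_inv _ _).symm

end GenFun

lemma represents_card_partition :
    Represents (PowerSeries.mk fun n => (Fintype.card n.Partition : ℂ))
      (fun q => 1 / ∏' i : ℕ, (1 - q ^ (i + 1))) := by
  have h := represents_genFun (f := fun _ _ => 1) (w := fun _ => 1) (G := 1) (g := 1) (by simp)
    (by simp) (by
      have hy0 : constantCoeff (X : ℂ⟦X⟧) = 0 := by simp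
      open scoped PowerSeries.WithPiTopology in
      have hs := WithPiTopology.summable_pow_of_constantCoeff_eq_zero hy0
      open scoped PowerSeries.WithPiTopology in
      have h3 := hs.tsum_eq_zero_add
      rw [pow_zero] at h3
      simp only [one_smul, map_one, one_mul]
      rw [← h3]
      exact WithPiTopology.tsum_pow_mul_one_sub_of_constantCoeff_eq_zero hy0) Represents.one
  have h2 : Nat.Partition.genFun (fun _ _ => (1 : ℂ)) = PowerSeries.mk fun n => (Fintype.card n.Partition : ℂ) := by
    ext n
    simp [Finsupp.prod]
  rw [← h2]
  simpa using! h

lemma summable_card_partition_mul_pow {r : ℝ} (h0 : 0 ≤ r) (h1 : r < 1) :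
    Summable fun n => (Fintype.card n.Partition : ℝ) * r ^ n := by
  simpa using represents_card_partition.summable_norm_mul_pow h0 h1

/-- Since ∑ p(n)|q|^n converges, the sum over all partitions is absolutely convergent and may be
regrouped by the largest part or by the number of ones. -/
lemma hasSum_partition_sigma {W : (Σ n, n.Partition) → ℂ} (hW : ∀ x, ‖W x‖ ≤ 1) {q S : ℂ}
    (hq : ‖q‖ < 1) (hS : HasSum (fun n => (∑ P : n.Partition, W ⟨n, P⟩) * q ^ n) S) :
    HasSum (fun x : Σ n, n.Partition => W x * q ^ x.1) S := by
  have hs : Summable fun x : Σ n, n.Partition => W x * q ^ x.1 := by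
    refine Summable.of_norm_bounded (g := fun x : Σ n, n.Partition => ‖q‖ ^ x.1) ?_ fun x => ?_
    · rw [summable_sigma_of_nonneg (fun _ => by positivity)]
      refine ⟨fun n => (hasSum_fintype _).summable, ?_⟩
      simpa [tsum_fintype] using summable_card_partition_mul_pow (norm_nonneg q) hq
    · rw [norm_mul, norm_pow]
      exact mul_le_of_le_one_left (by positivity) (hW x)
  have h1 := hs.hasSum.sigma (fun n => hasSum_fintype _)
  have h2 : (fun n => ∑ P : n.Partition, W ⟨n, P⟩ * q ^ n) =
      fun n => (∑ P : n.Partition, W ⟨n, P⟩) * q ^ n := by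
    ext n; rw [sum_mul]
  have h3 : ∑' x : Σ n, n.Partition, W x * q ^ x.1 = S :=
    h1.unique (by simpa only [h2] using hS)
  exact h3 ▸ hs.hasSum

/-- The number of ones. -/
def numOnes {n : ℕ} (P : n.Partition) : ℕ := P.parts.count 1

lemma prod_map_ite_eq_pow (s : Multiset ℕ) (Q : ℕ → Prop) [DecidablePred Q] (u : ℂ) :
    (s.map fun i => if Q i then u else 1).prod = u ^ (s.filter Q).card := by
  induction s using Multiset.induction_on with
  | empty => simp
  | cons a s ih =>
    rw [Multiset.map_cons, Multiset.prod_cons, ih]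
    by_cases h : Q a
    · simp [h, pow_succ']
    · simp [h]

lemma toFinsupp_prod_ones {n : ℕ} (P : n.Partition) (j : ℕ) (v u : ℂ) :
    P.parts.toFinsupp.prod (fun i c => (if i = 1 then (if c = j then v else 0) else 1) *
      (if j < i then u else 1) ^ c) =
    (if numOnes P = 0 then 1 else if numOnes P = j then v else 0) *
      u ^ (P.parts.filter (fun x => j < x)).card := by
  rw [Finsupp.prod_mul]
  congr 1
  · rw [Finsupp.prod, Finset.prod_ite_eq' (s := P.parts.toFinsupp.support) (a := 1)
      (b := fun i => if P.parts.toFinsupp i = j then v else 0)]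
    simp only [Multiset.toFinsupp_support, Multiset.toFinsupp_apply, Multiset.mem_toFinset, numOnes,
      ← Multiset.count_ne_zero]
    split_ifs <;> simp_all
  · rw [← prod_map_ite_eq_pow, Finset.prod_multiset_map_count]
    simp [Finsupp.prod]

lemma toFinsupp_prod_no_ones {n : ℕ} (P : n.Partition) (m : ℕ) :
    P.parts.toFinsupp.prod (fun i _ => if 2 ≤ i ∧ i ≤ m then (1 : ℂ) else 0) =
    if numOnes P = 0 ∧ P.parts.sup ≤ m then 1 else 0 := by
  rw [Finsupp.prod, Finset.prod_ite_zero, Finset.prod_const_one]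
  congr 1
  simp only [Multiset.toFinsupp_support, Multiset.mem_toFinset, eq_iff_iff, numOnes,
    Multiset.count_eq_zero, Multiset.sup_le]
  constructor
  · exact fun h => ⟨fun h1 => by have := h 1 h1; omega, fun i hi => (h i hi).2⟩
  · rintro ⟨h1, h2⟩ i hi
    refine ⟨?_, h2 i hi⟩
    have := P.parts_pos hi
    have : i ≠ 1 := by rintro rfl; exact h1 hi
    omega

end CrankSymmetry

end

noncomputable section

namespace CrankSymmetry

open Filter Topology Finset PowerSeries

/-! ### The theorem of Andrews and Garvan -/

lemma HasSum.of_fibers {β : Type*} {f : β → ℂ} {a : ℂ} (hf : HasSum f a) (g : β → ℕ) {A : ℕ → ℂ}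
    (hA : ∀ c, HasSum (fun b => if g b = c then f b else 0) (A c)) : HasSum A a := by
  convert! hf.tsum_fiberwise g using 1
  ext c
  rw [tsum_subtype (g ⁻¹' {c}) f, ← (hA c).tsum_eq]
  refine tsum_congr fun b => ?_
  by_cases h : g b = c
  · rw [if_pos h, Set.indicator_of_mem (show b ∈ g ⁻¹' {c} from h)]
  · rw [if_neg h, Set.indicator_of_notMem (show b ∉ g ⁻¹' {c} from h)]

lemma summable_partition_sigma {W : (Σ n : ℕ, n.Partition) → ℂ} (hW : ∀ x, ‖W x‖ ≤ 1) {q : ℂ}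
    (hq : ‖q‖ < 1) : Summable (fun x : Σ n : ℕ, n.Partition => W x * q ^ x.1) := by
  refine Summable.of_norm_bounded (g := fun x : Σ n : ℕ, n.Partition => ‖q‖ ^ x.1) ?_ fun x => ?_
  · rw [summable_sigma_of_nonneg (fun _ => by positivity)]
    refine ⟨fun n => (hasSum_fintype _).summable, ?_⟩
    simpa [tsum_fintype] using summable_card_partition_mul_pow (norm_nonneg q) hq
  · rw [norm_mul, norm_pow]
    exact mul_le_of_le_one_left (by positivity) (hW x)

lemma hasSum_no_ones_sup_le {q : ℂ} (hq : ‖q‖ < 1) (m : ℕ) :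
    HasSum (fun x : Σ n : ℕ, n.Partition =>
      (if numOnes x.2 = 0 ∧ x.2.parts.sup ≤ m + 1 then (1 : ℂ) else 0) * q ^ x.1)
      ((1 - q) / qPochN q q (m + 1)) := by
  refine hasSum_partition_sigma (fun x => by split_ifs <;> simp) hq ?_
  have h := represents_genFun (f := fun i _ => if 2 ≤ i ∧ i ≤ m + 1 then (1 : ℂ) else 0)
    (w := fun i => if 1 ≤ i ∧ i ≤ m then 1 else 0) (G := 1) (g := 1)
    (fun i => by split_ifs <;> simp) (fun i c => by
      by_cases h : i + 1 ≤ m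
      · simp [h, show i + 2 ≤ m + 1 by omega]
      · simp [h, show ¬ (i + 2 ≤ m + 1) by omega])
    (by simp) Represents.one q hq
  have h1 : ∏' i : ℕ, (1 - (if 1 ≤ i ∧ i ≤ m then (1 : ℂ) else 0) * q ^ (i + 1)) =
      qPochN q q (m + 1) / (1 - q) := by
    rw [tprod_eq_prod (s := range (m + 1)) (fun i hi => by
      rw [mem_range] at hi
      simp [show ¬ (i ≤ m) by omega])]
    rw [eq_div_iff (by simpa using one_sub_pow_ne_zero hq 0), qPochN, prod_range_succ',
      prod_range_succ']
    simp only [show ¬ (1 ≤ 0) by omega, false_and, if_false, zero_mul, sub_zero, mul_one, pow_zero]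
    congr 1
    refine prod_congr rfl fun i hi => ?_
    rw [mem_range] at hi
    simp [show i + 1 ≤ m by omega, pow_succ']
  simp only [h1] at h
  convert! h using 1
  · ext n
    congr 1
    rw [Nat.Partition.coeff_genFun]
    exact sum_congr rfl fun P _ => (toFinsupp_prod_no_ones P (m + 1)).symm
  · simp

/-- For m ≥ 2 this is a difference of two cases of `hasSum_no_ones_sup_le`. The uniform formula
gives 1 - q at m = 0, where the empty partition counts 1, and q at m = 1, where there is nothing.
These two corrections are the origin of the special convention at n = 1. -/
lemma hasSum_no_ones_sup_eq {q : ℂ} (hq : ‖q‖ < 1) (m : ℕ) :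
    HasSum (fun x : Σ n : ℕ, n.Partition =>
      (if numOnes x.2 = 0 ∧ x.2.parts.sup = m then (1 : ℂ) else 0) * q ^ x.1)
      ((1 - q) * (q ^ m / qPochN q q m) + (if m = 0 then q else 0) - (if m = 1 then q else 0)) := by
  have hq1 : 1 - q ≠ 0 := by simpa using one_sub_pow_ne_zero hq 0
  obtain rfl | m := m
  · have hsing := hasSum_single (f := fun x : Σ n : ℕ, n.Partition =>
      (if numOnes x.2 = 0 ∧ x.2.parts.sup = 0 then (1 : ℂ) else 0) * q ^ x.1) ⟨0, default⟩
      fun x hx => ?_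
    · convert! hsing using 1
      simp [numOnes, qPochN_zero]
    · rw [if_neg, zero_mul]
      rintro ⟨-, h⟩
      apply hx
      obtain ⟨n, P⟩ := x
      have : P.parts = 0 := by
        refine Multiset.eq_zero_of_forall_notMem fun i hi => ?_
        have h1 := P.parts_pos hi
        have h2 : i ≤ P.parts.sup := Multiset.le_sup hi
        simp only at h
        omega
      have hn : n = 0 := by rw [← P.parts_sum, this]; rfl
      subst hn
      congr 1
      exact Subsingleton.elim _ _
  obtain rfl | m := m
  · have hz : HasSum (fun _ : Σ n : ℕ, n.Partition => (0 : ℂ)) 0 := hasSum_zero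
    convert! hz using 1
    · ext x
      rw [if_neg, zero_mul]
      rintro ⟨h0, h⟩
      have hne : x.2.parts ≠ 0 := by rintro h1; simp [h1] at h
      obtain ⟨i, hi⟩ := Multiset.exists_mem_of_ne_zero hne
      have h1 := x.2.parts_pos hi
      have h2 : i ≤ x.2.parts.sup := Multiset.le_sup hi
      have h3 : i = 1 := by omega
      subst h3
      exact Multiset.count_eq_zero.mp h0 hi
    · simp [qPochN_succ, qPochN_zero]
      field_simp
      simp
  · convert! (hasSum_no_ones_sup_le hq (m + 1)).sub (hasSum_no_ones_sup_le hq m) using 1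
    · ext x
      by_cases h0 : numOnes x.2 = 0
      · simp only [h0, true_and]
        rw [← sub_mul]
        congr 1
        split_ifs <;> first | omega | simp
      · simp [h0]
    · have h1 := qPochN_self_ne_zero hq (m + 1)
      have h2 := qPochN_self_ne_zero hq (m + 1 + 1)
      have h3 : 1 - q * q ^ (m + 1) ≠ 0 := by
        rw [← pow_succ']; exact one_sub_pow_ne_zero hq (m + 1)
      rw [qPochN_succ q q (m + 1)]
      simp
      field_simp
      ring

lemma crank_of_numOnes_eq_zero {n : ℕ} {P : n.Partition} (h : numOnes P = 0) :
    crank P = P.parts.sup := if_pos h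

lemma crank_of_numOnes_ne_zero {n : ℕ} {P : n.Partition} (h : numOnes P ≠ 0) :
    crank P = ((P.parts.filter (fun x => numOnes P < x)).card : ℤ) - numOnes P := if_neg h

lemma hasSum_no_ones {q u : ℂ} (hq : ‖q‖ < 1) (hu : ‖u‖ = 1) :
    HasSum (fun x : Σ n : ℕ, n.Partition =>
      (if numOnes x.2 = 0 then u ^ crank x.2 else 0) * q ^ x.1)
      ((1 - q) / qPoch (u * q) q + q - u * q) := by
  have hs := (summable_partition_sigma (W := fun x => if numOnes x.2 = 0 then u ^ crank x.2 else 0)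
    (fun x => by split_ifs <;> simp [hu]) hq).hasSum
  have h1 := HasSum.of_fibers hs (fun x => x.2.parts.sup) (A := fun m => u ^ m *
    ((1 - q) * (q ^ m / qPochN q q m) + (if m = 0 then q else 0) - (if m = 1 then q else 0)))
    fun m => by
      convert! (hasSum_no_ones_sup_eq hq m).mul_left (u ^ m) using 1
      ext x
      by_cases h0 : numOnes x.2 = 0
      · by_cases h2 : x.2.parts.sup = m
        · simp [h0, h2, crank_of_numOnes_eq_zero h0]
        · simp [h2]
      · simp [h0]
  have h2 : HasSum (fun m => u ^ m *
      ((1 - q) * (q ^ m / qPochN q q m) + (if m = 0 then q else 0) - (if m = 1 then q else 0)))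
      ((1 - q) * (1 / qPoch (u * q) q) + q - u * q) := by
    have ha := (hasSum_euler_inv (t := u * q) hq (by simpa [hu] using hq)).mul_left (1 - q)
    convert! (ha.add (hasSum_ite_eq 0 q)).sub (hasSum_ite_eq 1 (u * q)) using 1
    ext m
    split_ifs with hm1 hm2 <;> simp_all [mul_pow] <;> ring
  rw [h1.unique h2, mul_one_div] at hs
  exact hs

lemma represents_ones_aux {u : ℂ} (hu : ‖u‖ = 1) (j : ℕ) (v : ℂ) :
    Represents (Nat.Partition.genFun fun i c => (if i = 1 then (if c = j + 1 then v else 0) else 1) *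
      (if j + 1 < i then u else 1) ^ c)
      (fun q => (1 + v * q ^ (j + 1)) / ∏' i : ℕ,
        (1 - (if i = 0 then 0 else if j < i then u else 1) * q ^ (i + 1))) := by
  refine represents_genFun (G := 1 + C v * X ^ (j + 1))
    (w := fun i => if i = 0 then 0 else if j < i then u else 1)
    (fun i => by split_ifs <;> simp [hu])
    (fun i c => by simp) ?_ ?_
  · open scoped PowerSeries.WithPiTopology in
    rw [tsum_eq_single j (fun i hi => by simp [hi])]
    simp [smul_eq_C_mul]
  · exact Represents.one.add ((Represents.const v).mul (Represents.X_pow (j + 1)))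

lemma hasSum_ones {q u : ℂ} (hq : ‖q‖ < 1) (hu : ‖u‖ = 1) (j : ℕ) :
    HasSum (fun x : Σ n : ℕ, n.Partition =>
      (if numOnes x.2 = j + 1 then u ^ (x.2.parts.filter (fun i => j + 1 < i)).card else 0) *
        q ^ x.1)
      ((1 - q) / qPoch (u * q) q *
        (qPochN (u * q) q (j + 1) / qPochN q q (j + 1) * q ^ (j + 1))) := by
  refine hasSum_partition_sigma (fun x => by split_ifs <;> simp [hu]) hq ?_
  -- A partition without ones has a weight independent of v, so the difference of v = 1 and v = 0
  -- retains exactly the partitions with j+1 ones.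
  have h := (represents_ones_aux hu j 1 q hq).sub (represents_ones_aux hu j 0 q hq)
  set F : ℕ → ℂ := fun i => 1 - (if i = 0 then 0 else if j < i then u else 1) * q ^ (i + 1)
    with hF
  have hFj : (fun i => F (i + (j + 1))) = fun i => 1 - u * q * q ^ (j + 1) * q ^ i := by
    ext i
    rw [hF]
    simp only
    rw [if_neg (by omega), if_pos (by omega)]
    ring
  have hm : Multipliable fun i => F (i + (j + 1)) := by
    rw [hFj]
    exact multipliable_qPoch (u * q * q ^ (j + 1)) hq
  have hq1 : 1 - q ≠ 0 := by simpa using one_sub_pow_ne_zero hq 0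
  have h1 : ∏' i, F i = qPochN q q (j + 1) / (1 - q) * qPoch (u * q * q ^ (j + 1)) q := by
    rw [← Multipliable.prod_mul_tprod_nat_mul' (k := j + 1) hm, hFj]
    congr 1
    rw [eq_div_iff hq1, qPochN, prod_range_succ', prod_range_succ']
    · simp only [hF, if_true, zero_mul, sub_zero, mul_one, pow_zero]
      congr 1
      refine prod_congr rfl fun i hi => ?_
      rw [mem_range] at hi
      rw [if_neg (by omega), if_neg (by omega)]
      ring
  simp only [hF] at h1
  simp only [h1] at h
  convert! h using 1
  · ext n
    rw [Nat.Partition.coeff_genFun, Nat.Partition.coeff_genFun, ← sub_mul, ← sum_sub_distrib]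
    congr 1
    refine sum_congr rfl fun P _ => ?_
    rw [toFinsupp_prod_ones, toFinsupp_prod_ones]
    simp only
    by_cases h0 : numOnes P = 0
    · simp [h0]
    · simp [h0]
  · have hN : qPoch (u * q) q = qPochN (u * q) q (j + 1) * qPoch (u * q * q ^ (j + 1)) q :=
      qPoch_eq_prod_mul _ hq _
    have h3 : qPoch (u * q) q ≠ 0 := qPoch_ne_zero_of_norm_lt hq (by simpa [hu] using hq)
    rw [hN] at h3 ⊢
    have h4 := left_ne_zero_of_mul h3
    have h5 := right_ne_zero_of_mul h3
    have h6 := qPochN_self_ne_zero hq (j + 1)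
    generalize qPochN (u * q) q (j + 1) = x at *
    generalize qPoch (u * q * q ^ (j + 1)) q = y at *
    field_simp
    ring

/-- The generating function of the crank, before the correction at `n = 1`. -/
lemma hasSum_crank {q u : ℂ} (hq : ‖q‖ < 1) (hu : ‖u‖ = 1) :
    HasSum (fun n => (∑ P : n.Partition, u ^ crank P) * q ^ n)
      (qPoch q q / (qPoch (u * q) q * qPoch (u⁻¹ * q) q) + q - u * q) := by
  have hu0 : u ≠ 0 := by rintro rfl; simp at hu
  have hs := (summable_partition_sigma (W := fun x => u ^ crank x.2)
    (fun x => by simp [hu]) hq).hasSum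
  -- The contribution of the partitions with j ones. Apart from the correction at j = 0 it is
  -- uniform in j, and the sum over j is the q-binomial series with parameters uq and u⁻¹q.
  set A : ℕ → ℂ := fun j => (1 - q) / qPoch (u * q) q *
    (qPochN (u * q) q j / qPochN q q j * (u⁻¹ * q) ^ j) + if j = 0 then q - u * q else 0 with hA
  have h1 : HasSum A _ := HasSum.of_fibers hs (fun x => numOnes x.2) fun j => by
    obtain rfl | j := j
    · convert! hasSum_no_ones hq hu using 1
      · ext x
        split_ifs <;> simp
      · simp [hA, qPochN_zero]
        ring
    · convert! (hasSum_ones hq hu j).mul_left (u⁻¹ ^ (j + 1)) using 1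
      · ext x
        by_cases h0 : numOnes x.2 = j + 1
        · rw [if_pos h0, if_pos h0, crank_of_numOnes_ne_zero (by omega), h0, zpow_sub₀ hu0]
          simp only [zpow_natCast, inv_pow]
          ring
        · simp [h0]
      · simp [hA, mul_pow]
        ring
  have h2 : HasSum A ((1 - q) / qPoch (u * q) q * (qPoch (u * q * (u⁻¹ * q)) q /
      qPoch (u⁻¹ * q) q) + (q - u * q)) :=
    ((hasSum_qBinomial (u * q) (t := u⁻¹ * q) hq (by simpa [hu] using hq)).mul_left _).add
      (hasSum_ite_eq 0 _)
  rw [h1.unique h2] at hs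
  have h3 := hs.sigma (fun n => hasSum_fintype _)
  convert! h3 using 1
  · ext n
    rw [sum_mul]
  · rw [show u * q * (u⁻¹ * q) = q * q by field_simp, qPoch_succ q hq]
    have ha : qPoch (u * q) q ≠ 0 := qPoch_ne_zero_of_norm_lt hq (by simpa [hu] using hq)
    have hb : qPoch (u⁻¹ * q) q ≠ 0 := qPoch_ne_zero_of_norm_lt hq (by simpa [hu] using hq)
    field_simp
    ring

/-- The coefficients of the crank generating function at the root of unity `u`. -/
def crankCoeff (u : ℂ) (n : ℕ) : ℂ :=
  (∑ P : n.Partition, u ^ crank P) + if n = 1 then u - 1 else 0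

lemma hasSum_crankCoeff {q u : ℂ} (hq : ‖q‖ < 1) (hu : ‖u‖ = 1) :
    HasSum (fun n => crankCoeff u n * q ^ n)
      (qPoch q q / (qPoch (u * q) q * qPoch (u⁻¹ * q) q)) := by
  convert! (hasSum_crank hq hu).add (hasSum_ite_eq 1 ((u - 1) * q)) using 1
  · ext n
    by_cases h : n = 1
    · subst h; simp [crankCoeff]; ring
    · simp [crankCoeff, h]
  · ring

lemma crank_mem_Icc {n : ℕ} (P : n.Partition) : crank P ∈ Finset.Icc (-(n : ℤ)) n := by
  have hc : P.parts.card ≤ n := by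
    conv_rhs => rw [← P.parts_sum]
    simpa using Multiset.card_nsmul_le_sum (a := 1) fun i hi => P.parts_pos hi
  have hs : P.parts.sup ≤ n := Multiset.sup_le.mpr fun i hi => P.le_of_mem_parts hi
  have h1 := Multiset.count_le_card 1 P.parts
  have h2 := Multiset.card_le_card (Multiset.filter_le (fun x => P.parts.count 1 < x) P.parts)
  rw [Finset.mem_Icc, crank]
  split_ifs <;> omega

lemma sum_crankCountMod {p n : ℕ} (hp : p ≠ 0) {u : ℂ} (hu : u ^ p = 1) :
    ∑ k ∈ range p, (crankCountMod k p n : ℂ) * u ^ k = crankCoeff u n := by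
  have hu0 : u ≠ 0 := by rintro rfl; simp [hp] at hu
  have h1 : ∑ k ∈ range p, (crankCountMod k p n : ℂ) * u ^ k =
      ∑ m ∈ Finset.Icc (-(n : ℤ)) n, (crankCount m n : ℂ) * u ^ m := by
    have hf : ∀ m ∈ Finset.Icc (-(n : ℤ)) n, (m % p).toNat ∈ range p := by
      intro m _
      have := Int.emod_lt_of_pos m (show (0 : ℤ) < p by omega)
      have := Int.emod_nonneg m (show (p : ℤ) ≠ 0 by omega)
      rw [mem_range]; omega
    rw [← sum_fiberwise_of_maps_to hf]
    refine sum_congr rfl fun k hk => ?_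
    rw [mem_range] at hk
    rw [crankCountMod, Int.cast_sum, sum_mul]
    refine sum_congr ?_ fun m hm => ?_
    · ext m
      simp only [mem_filter, and_congr_right_iff]
      intro _
      have h1 := Int.emod_lt_of_pos m (show (0 : ℤ) < p by omega)
      have h2 := Int.emod_nonneg m (show (p : ℤ) ≠ 0 by omega)
      rw [Int.ModEq, Int.emod_eq_of_lt (a := (k : ℤ)) (by omega) (by omega)]
      omega
    · rw [mem_filter] at hm
      congr 1
      have h2 : m = k + p * (m / p) := by
        have := Int.emod_add_mul_ediv m p
        have := Int.emod_nonneg m (show (p : ℤ) ≠ 0 by omega)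
        omega
      rw [h2, zpow_add₀ hu0, _root_.zpow_mul, zpow_natCast, zpow_natCast, hu, one_zpow, mul_one]
  rw [h1, crankCoeff]
  by_cases hn : n = 1
  · subst hn
    have h2 : Finset.Icc (-((1 : ℕ) : ℤ)) ((1 : ℕ) : ℤ) = {-1, 0, 1} := by decide
    rw [h2]
    -- The only partition of 1 contributes u⁻¹. The convention gives u - 1 + u⁻¹, and the excess u -
    -- 1 is the correction in `crankCoeff`.
    have h3 : ∀ P : (1 : ℕ).Partition, crank P = -1 := fun P => by
      rw [Subsingleton.elim P (.indiscrete 1)]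
      simp [crank]
    simp [crankCount, h3]
    ring
  · simp only [crankCount, if_neg hn, add_zero]
    rw [← sum_fiberwise_of_maps_to (fun P _ => crank_mem_Icc P)]
    refine sum_congr rfl fun m _ => ?_
    rw [sum_congr rfl (g := fun _ => u ^ m) (fun P hP => by rw [(mem_filter.mp hP).2])]
    simp

end CrankSymmetry

end

noncomputable section

namespace CrankSymmetry

open Filter Topology Finset Matrix MatrixGroups

/-! ### The transformation law of the crank dissection -/

variable {p : ℕ}

/-- The function of which `crankK p 0 l` is the image under the `U_p` operator, up to the factor
`(q^p; q^p)`. -/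
def crankKernel (p l : ℕ) (τ : ℂ) : ℂ :=
  2 * Complex.I * Complex.sin (Real.pi * l / p) * etaRatio p τ / phi (l / p) τ

lemma zeta_pow (p l : ℕ) : zeta p ^ l = Complex.exp (2 * Real.pi * Complex.I * (l / p)) := by
  rw [zeta, ← Complex.exp_nat_mul]
  congr 1
  ring

lemma norm_zeta_pow (hp : p ≠ 0) (l : ℕ) : ‖zeta p ^ l‖ = 1 := by
  rw [norm_pow, (isPrimitiveRoot_zeta p hp).norm'_eq_one hp, one_pow]

lemma sin_ne_zero_of_mem_Icc {l : ℕ} (hl : l ∈ Icc 1 ((p - 1) / 2)) :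
    Complex.sin (Real.pi * l / p) ≠ 0 := by
  rw [mem_Icc] at hl
  have hp : 0 < (p : ℝ) := by exact_mod_cast (show 0 < p by omega)
  have h1 : (l : ℝ) < p := by exact_mod_cast (show l < p by omega)
  have h2 : 0 < (l : ℝ) := by exact_mod_cast (show 0 < l by omega)
  have h3 : 0 < Real.sin (Real.pi * l / p) := by
    apply Real.sin_pos_of_pos_of_lt_pi (by positivity)
    rw [div_lt_iff₀ hp]
    exact mul_lt_mul_of_pos_left h1 Real.pi_pos
  have h4 : Complex.sin (Real.pi * l / p) = ((Real.sin (Real.pi * l / p) : ℝ) : ℂ) := by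
    push_cast; rfl
  rw [h4]
  exact_mod_cast h3.ne'

lemma phi_torsion_eq {τ : ℂ} (hτ : 0 < τ.im) (l : ℕ) :
    phi (l / p) τ = 2 * Complex.I * Complex.sin (Real.pi * l / p) *
      (qPoch (zeta p ^ l * Complex.exp (2 * Real.pi * Complex.I * τ))
        (Complex.exp (2 * Real.pi * Complex.I * τ)) *
      qPoch ((zeta p ^ l)⁻¹ * Complex.exp (2 * Real.pi * Complex.I * τ))
        (Complex.exp (2 * Real.pi * Complex.I * τ)) / eulerFun τ ^ 2) := by
  rw [phi_eq hτ, zeta_pow, ← Complex.exp_neg]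
  congr 1
  rw [Complex.sin]
  have h1 : Complex.exp (2 * Real.pi * Complex.I * (l / p)) =
      Complex.exp (Real.pi * l / p * Complex.I) * Complex.exp (Real.pi * l / p * Complex.I) := by
    rw [← Complex.exp_add]; congr 1; ring
  have h2 : Complex.exp (-(Real.pi * l / p) * Complex.I) =
      (Complex.exp (Real.pi * l / p * Complex.I))⁻¹ := by
    rw [← Complex.exp_neg]; congr 1; ring
  have h3 : Complex.exp (-(Real.pi * Complex.I * (l / p))) =
      (Complex.exp (Real.pi * l / p * Complex.I))⁻¹ := by
    rw [← Complex.exp_neg]; congr 1; ring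
  rw [h1, h2, h3]
  have := Complex.exp_ne_zero (Real.pi * l / p * Complex.I)
  generalize Complex.exp (Real.pi * l / p * Complex.I) = e at *
  field_simp
  linear_combination (-(1 - e ^ 2)) * Complex.I_sq

lemma hasSum_crankKernel {l : ℕ} (hl : l ∈ Icc 1 ((p - 1) / 2)) {τ : ℂ} (hτ : 0 < τ.im) :
    HasSum (fun n : ℕ => eulerFun (p ^ 2 * τ) * (crankCoeff (zeta p ^ l) n *
      Complex.exp (2 * Real.pi * Complex.I * τ) ^ (n + sP p))) (crankKernel p l τ) := by
  have hp : p ≠ 0 := by rw [mem_Icc] at hl; omega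
  have hq := norm_exp_two_pi_I_lt_one hτ
  have h := ((hasSum_crankCoeff hq (norm_zeta_pow hp l)).mul_right
    (Complex.exp (2 * Real.pi * Complex.I * τ) ^ sP p)).mul_left (eulerFun (p ^ 2 * τ))
  convert! h using 1
  · ext n
    rw [pow_add]; ring
  · rw [crankKernel, phi_torsion_eq hτ, etaRatio, ← exp_two_pi_I_mul_pow]
    have h1 := sin_ne_zero_of_mem_Icc hl
    have h2 := eulerFun_ne_zero hτ
    have h3 : qPoch (zeta p ^ l * Complex.exp (2 * Real.pi * Complex.I * τ))
        (Complex.exp (2 * Real.pi * Complex.I * τ)) ≠ 0 :=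
      qPoch_ne_zero_of_norm_lt hq (by rw [norm_mul, norm_zeta_pow hp, one_mul]; exact hq)
    have h4 : qPoch ((zeta p ^ l)⁻¹ * Complex.exp (2 * Real.pi * Complex.I * τ))
        (Complex.exp (2 * Real.pi * Complex.I * τ)) ≠ 0 :=
      qPoch_ne_zero_of_norm_lt hq
        (by rw [norm_mul, norm_inv, norm_zeta_pow hp, inv_one, one_mul]; exact hq)
    rw [show qPoch (Complex.exp (2 * Real.pi * Complex.I * τ))
      (Complex.exp (2 * Real.pi * Complex.I * τ)) = eulerFun τ from rfl]
    generalize qPoch (zeta p ^ l * Complex.exp (2 * Real.pi * Complex.I * τ))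
        (Complex.exp (2 * Real.pi * Complex.I * τ)) = x at *
    generalize qPoch ((zeta p ^ l)⁻¹ * Complex.exp (2 * Real.pi * Complex.I * τ))
        (Complex.exp (2 * Real.pi * Complex.I * τ)) = y at *
    generalize Complex.sin (Real.pi * l / p) = s at *
    have := Complex.I_ne_zero
    field_simp

/-- The point `(τ + m) / p`. -/
def shiftDiv (p : ℕ) [NeZero p] (τ : ℍ) (m : ℕ) : ℍ :=
  ⟨((τ : ℂ) + m) / p, by
    have : 0 < (p : ℝ) := by exact_mod_cast Nat.pos_of_ne_zero (NeZero.ne p)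
    rw [Complex.div_natCast_im]
    simpa using div_pos τ.im_pos this⟩

lemma coe_shiftDiv [NeZero p] (τ : ℍ) (m : ℕ) : (shiftDiv p τ m : ℂ) = ((τ : ℂ) + m) / p := rfl

lemma sum_zeta_pow (hp : p ≠ 0) (k : ℕ) :
    ∑ m ∈ range p, zeta p ^ (m * k) = if p ∣ k then (p : ℂ) else 0 := by
  have hz := isPrimitiveRoot_zeta p hp
  split_ifs with h
  · obtain ⟨c, rfl⟩ := h
    rw [sum_congr rfl (g := fun _ => (1 : ℂ)) fun m _ => by
      rw [show m * (p * c) = p * (m * c) by ring, pow_mul, hz.pow_eq_one, one_pow]]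
    simp
  · have h1 : zeta p ^ k ≠ 1 := fun h1 => h ((hz.pow_eq_one_iff_dvd k).mp h1)
    simp_rw [mul_comm _ k, pow_mul]
    rw [geom_sum_eq h1, ← pow_mul, mul_comm k p, pow_mul, hz.pow_eq_one, one_pow, sub_self,
      zero_div]

/-- Averaging over the p points (z+m)/p retains the exponents n + s_p divisible by p, by
orthogonality of roots of unity. The factor (q^{p²};q^{p²}) becomes (q^p;q^p) at each of these
points, whatever m is. -/
lemma hasSum_sum_crankKernel [NeZero p] {l : ℕ} (hl : l ∈ Icc 1 ((p - 1) / 2)) (z : ℍ) :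
    HasSum (fun n : ℕ => qPoch (qpow p z) (qpow p z) * if sP p ≤ p * n + 0 then
      (∑ k ∈ range p, (crankCountMod k p (p * n + 0 - sP p) : ℂ) * zeta p ^ (k * l)) * qpow n z
      else 0) ((p : ℂ)⁻¹ * ∑ m ∈ range p, crankKernel p l (shiftDiv p z m)) := by
  have hp : p ≠ 0 := NeZero.ne p
  have hp' : (p : ℂ) ≠ 0 := by exact_mod_cast hp
  set x : ℂ := Complex.exp (2 * Real.pi * Complex.I * (z / p)) with hx
  set E : ℂ := qPoch (qpow p z) (qpow p z) with hE
  have hE' : ∀ m : ℕ, eulerFun (p ^ 2 * (shiftDiv p z m : ℂ)) = E := by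
    intro m
    have : Complex.exp (2 * Real.pi * Complex.I * (p ^ 2 * (shiftDiv p z m : ℂ))) = qpow p z := by
      rw [coe_shiftDiv, qpow, Complex.exp_eq_exp_iff_exists_int]
      refine ⟨p * m, ?_⟩
      push_cast
      field_simp
    rw [eulerFun, this]
  have hexp : ∀ m : ℕ, Complex.exp (2 * Real.pi * Complex.I * (shiftDiv p z m : ℂ)) =
      x * zeta p ^ m := by
    intro m
    rw [zeta_pow, hx, ← exp_two_pi_I_add, coe_shiftDiv, add_div]
  have h1 := (hasSum_sum fun m (_ : m ∈ range p) =>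
    hasSum_crankKernel hl (shiftDiv p z m).im_pos).mul_left (p : ℂ)⁻¹
  set G : ℕ → ℂ := fun k => if sP p ≤ k ∧ p ∣ k then E * (crankCoeff (zeta p ^ l) (k - sP p) * x ^ k)
    else 0 with hG
  have h2 : HasSum (fun n => G (n + sP p))
      ((p : ℂ)⁻¹ * ∑ m ∈ range p, crankKernel p l (shiftDiv p z m)) := by
    convert! h1 using 1
    ext n
    simp_rw [hE', hexp, mul_pow, ← pow_mul]
    rw [← mul_sum, ← mul_sum, ← mul_sum, sum_zeta_pow hp]
    simp only [hG, le_add_iff_nonneg_left, zero_le, true_and, Nat.add_sub_cancel]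
    split_ifs
    · field_simp
    · simp
  have h3 : HasSum G ((p : ℂ)⁻¹ * ∑ m ∈ range p, crankKernel p l (shiftDiv p z m)) := by
    rw [hasSum_nat_add_iff] at h2
    rwa [sum_eq_zero (fun i hi => if_neg (by rw [mem_range] at hi; omega)), add_zero] at h2
  have h4 : HasSum (G ∘ fun n => p * n)
      ((p : ℂ)⁻¹ * ∑ m ∈ range p, crankKernel p l (shiftDiv p z m)) := by
    rwa [Function.Injective.hasSum_iff (mul_right_injective₀ hp)]
    intro k hk
    refine if_neg fun h => hk ?_
    obtain ⟨c, rfl⟩ := h.2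
    exact ⟨c, rfl⟩
  convert! h4 using 1
  ext n
  simp only [hG, Function.comp, add_zero, dvd_mul_right, and_true, mul_ite, mul_zero]
  split_ifs
  · rw [← sum_crankCountMod hp (u := zeta p ^ l) (by
      rw [← pow_mul, mul_comm, pow_mul, (isPrimitiveRoot_zeta p hp).pow_eq_one, one_pow]), pow_mul,
      show x ^ p = Complex.exp (2 * Real.pi * Complex.I * z) by
        rw [hx, exp_two_pi_I_mul_pow]; congr 2; field_simp, exp_two_pi_I_mul_pow]
    congr 2
    · exact sum_congr rfl fun k _ => by rw [← pow_mul, mul_comm k l]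
    · rw [qpow]; congr 1; push_cast; ring
  · rfl

lemma crankK_eq_sum [NeZero p] {l : ℕ} (hl : l ∈ Icc 1 ((p - 1) / 2)) (z : ℍ) :
    crankK p 0 l z = (p : ℂ)⁻¹ * ∑ m ∈ range p, crankKernel p l (shiftDiv p z m) := by
  rw [← (hasSum_sum_crankKernel hl z).tsum_eq, tsum_mul_left, crankK]
  simp [qpow]

/-- φ has weight -1 and stands in the denominator, hence weight 1. Signs: the torsion law at k = 1,
c = p gives (-1)^p and (-1)^{d-mp}, and reducing d-mp to d gives (-1)^m. As p is odd, the product is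
(-1)^{d+1}. The sines are the normalizations of the two kernels. -/
lemma crankKernel_smul (hp : p.Prime) (h3 : 3 < p) {d : ℕ} (hd : d ∈ Icc 1 ((p - 1) / 2))
    (A : SL(2, ℤ)) (hA : A 1 0 = p * p) {m : ℕ} (hm : A 1 1 = d - m * p) (τ : ℍ) :
    crankKernel p 1 (A • τ : ℍ) = autFactor A τ * ((-1) ^ (d + 1) *
      (Complex.sin (Real.pi / p) / Complex.sin (Real.pi * d / p)) * crankKernel p d τ) := by
  have hpo : Odd p := hp.odd_of_ne_two (by omega)
  have hp' : (p : ℂ) ≠ 0 := by exact_mod_cast hp.ne_zero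
  have h1 : phi ((1 : ℕ) / p) (A • τ : ℍ) = (autFactor A τ)⁻¹ * ((-1) ^ (d + 1) * phi (d / p) τ) := by
    rw [phi_torsion_smul hp.ne_zero A hA, mul_assoc]
    congr 1
    have h2 : phi (((((1 : ℕ) : ℤ) * A 1 1 : ℤ) : ℂ) / p) τ = (-1) ^ m * phi (d / p) τ := by
      have h4 := (oddAntiperiodic_phi_torsion hp τ).add_mul d (-m)
      rw [_root_.zpow_neg, ← _root_.inv_zpow, inv_neg, inv_one, zpow_natCast] at h4
      simp only [Int.cast_natCast] at h4
      rw [← h4, hm]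
      congr 2
      push_cast
      ring
    have h5 : Complex.exp (-(Real.pi * Complex.I * (((1 : ℕ) : ℂ) ^ 2 * p * (A 1 1 : ℤ) / p))) =
        (-1) ^ d * (-1) ^ m := by
      have := neg_one_pow_natCast_mul 1 (A 1 1)
      rw [show (((1 : ℕ) : ℂ) ^ 2 * p * (A 1 1 : ℤ) / p) = ((1 : ℕ) : ℂ) * (A 1 1 : ℤ) by
        field_simp; simp, this, hm]
      have h6 : ((1 : ℕ) : ℤ) * (d - m * p) = (d : ℤ) + -(m * p : ℕ) := by push_cast; ring
      rw [h6, zpow_add₀ (by norm_num), _root_.zpow_neg, ← _root_.inv_zpow, inv_neg, inv_one, zpow_natCast,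
        zpow_natCast, mul_comm m p, pow_mul, hpo.neg_one_pow]
    rw [h2, h5, one_mul, hpo.neg_one_pow, pow_succ]
    have : ((-1 : ℂ) ^ m) ^ 2 = 1 := by rw [← pow_mul, mul_comm, pow_mul]; simp
    linear_combination (-(-1) ^ d * phi (d / p) τ) * this
  have hs := sin_ne_zero_of_mem_Icc hd
  have hD := autFactor_ne_zero A τ
  have hone : ((-1 : ℂ) ^ (d + 1))⁻¹ = (-1) ^ (d + 1) := by
    rw [← inv_pow]; norm_num
  rw [crankKernel, crankKernel, h1, etaRatio_smul hp h3 A hA, Nat.cast_one, mul_one]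
  generalize phi (d / p) τ = x
  rw [div_eq_mul_inv _ (_ * _), mul_inv, mul_inv, inv_inv, hone, div_eq_mul_inv _ x]
  generalize x⁻¹ = y
  field_simp

/-- The Hecke-type coset argument: (1 m; 0 p)A = B(1 i; 0 p), where B in SL(2, ℤ) has lower left
entry p² and i depends on m. `crankKernel_smul` applies to each B, and m ↦ i permutes the residues
modulo p. -/
theorem crankK_smul (hp : p.Prime) (h3 : 3 < p) {d : ℕ} (hd : d ∈ Icc 1 ((p - 1) / 2))
    (A : SL(2, ℤ)) (hA : A 1 0 = p) (hA1 : A 1 1 = d) (z : ℍ) :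
    crankK p 0 1 (A • z) = autFactor A z * ((-1) ^ (d + 1) *
      (Complex.sin (Real.pi / p) / Complex.sin (Real.pi * d / p)) * crankK p 0 d z) := by
  have := NeZero.mk hp.ne_zero
  have hFact := Fact.mk hp
  have hp' : (p : ℂ) ≠ 0 := by exact_mod_cast hp.ne_zero
  have hpZ : (p : ℤ) ≠ 0 := by exact_mod_cast hp.ne_zero
  have hdet : A 0 0 * d - A 0 1 * p = 1 := by
    have := A.det_coe
    rw [Matrix.det_fin_two] at this
    rw [← hA, ← hA1]; exact this
  have hone : 1 ∈ Icc 1 ((p - 1) / 2) := by rw [mem_Icc]; omega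
  rw [crankK_eq_sum hone, crankK_eq_sum hd]
  -- Integrality of B requires i·a ≡ b + md modulo p, and a⁻¹ ≡ d.
  set i : ℕ → ℕ := fun m => (((A 0 1 + m * d) * d) % p).toNat with hi
  have hiz : ∀ m, ((i m : ℕ) : ℤ) = ((A 0 1 + m * d) * d) % p := fun m => by
    rw [hi]; exact Int.toNat_of_nonneg (Int.emod_nonneg _ hpZ)
  have key : ∀ m ∈ range p, crankKernel p 1 (shiftDiv p (A • z) m) = autFactor A z *
      ((-1) ^ (d + 1) * (Complex.sin (Real.pi / p) / Complex.sin (Real.pi * d / p)) *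
        crankKernel p d (shiftDiv p z (i m))) := by
    intro m _
    obtain ⟨e, he⟩ : (p : ℤ) ∣ A 0 1 + m * d - i m * (A 0 0 + m * p) := by
      have h1 : (p : ℤ) ∣ (A 0 1 + m * d) * d - i m := by
        rw [hiz]; exact Int.dvd_self_sub_emod
      obtain ⟨f, hf⟩ := h1
      refine ⟨f * (A 0 0 + m * p) - (A 0 1 + m * d) * (A 0 1 + d * m), ?_⟩
      linear_combination (A 0 0 + m * p) * hf - (A 0 1 + m * d) * hdet
    set B : SL(2, ℤ) := ⟨!![A 0 0 + m * p, e; p * p, d - i m * p], by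
      rw [Matrix.det_fin_two_of]
      linear_combination hdet + p * he⟩ with hB
    have hB00 : B 0 0 = A 0 0 + m * p := rfl
    have hB01 : B 0 1 = e := rfl
    have hB10 : B 1 0 = p * p := rfl
    have hB11 : B 1 1 = d - i m * p := rfl
    have haut : autFactor B (shiftDiv p z (i m)) = autFactor A z := by
      rw [autFactor, autFactor, hB10, hB11, hA, hA1, coe_shiftDiv]
      push_cast
      field_simp
      ring
    have hs : shiftDiv p (A • z) m = B • shiftDiv p z (i m) := by
      apply UpperHalfPlane.ext
      rw [coe_smul_eq, haut, coe_shiftDiv, coe_smul_eq, coe_shiftDiv, hB00, hB01]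
      have hne := autFactor_ne_zero A z
      have he' : (A 0 1 : ℂ) + m * d - i m * (A 0 0 + m * p) = p * e := by exact_mod_cast he
      have ha : autFactor A z = p * z + d := by rw [autFactor, hA, hA1]; push_cast; rfl
      field_simp
      push_cast
      rw [ha]
      linear_combination he'
    rw [hs, crankKernel_smul hp h3 hd B hB10 hB11, haut]
  rw [sum_congr rfl key]
  have hinj : Set.InjOn i (range p : Set ℕ) := by
    intro m hm m' hm' h
    have h1 : ((A 0 1 + m * d) * d) % p = ((A 0 1 + m' * d) * d) % (p : ℤ) := by
      rw [← hiz, ← hiz, h]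
    have h2 : ((((A 0 1 + m * d) * d : ℤ)) : ZMod p) = (((A 0 1 + m' * d) * d : ℤ) : ZMod p) :=
      (ZMod.intCast_eq_intCast_iff' _ _ _).mpr h1
    push_cast at h2
    have hd0 := natCast_ne_zero_of_mem_Icc hd
    have h5 : (m : ZMod p) = m' := by
      have h4 := mul_right_cancel₀ hd0 h2
      exact mul_right_cancel₀ hd0 (add_left_cancel h4)
    rw [ZMod.natCast_eq_natCast_iff'] at h5
    simp only [coe_range, Set.mem_Iio] at hm hm'
    rwa [Nat.mod_eq_of_lt hm, Nat.mod_eq_of_lt hm'] at h5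
  have hmaps : Set.MapsTo i (range p : Set ℕ) (range p : Set ℕ) := by
    intro m _
    have h1 := Int.emod_lt_of_pos ((A 0 1 + m * d) * d) (show (0 : ℤ) < p by
      exact_mod_cast hp.pos)
    rw [← hiz] at h1
    simpa using h1
  have hsum : ∑ m ∈ range p, crankKernel p d (shiftDiv p z (i m)) =
      ∑ m ∈ range p, crankKernel p d (shiftDiv p z m) :=
    sum_nbij i (fun m hm => by simpa using hmaps (by simpa using hm)) hinj
      (surjOn_of_injOn_of_card_le i hmaps hinj le_rfl) fun _ _ => rfl
  rw [← mul_sum, ← mul_sum, hsum]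
  ring

end CrankSymmetry

end

noncomputable section

namespace CrankSymmetry

open Filter Topology Finset Matrix MatrixGroups

/-! ### The transformation law of the generalized eta quotients -/

variable {p : ℕ}

/-- Up to the factor `-η(pz)³`, the function `f_{p,k}`, for any integer `k`. -/
def thetaForm (p : ℕ) (k : ℤ) (z : ℂ) : ℂ :=
  Complex.exp (Real.pi * Complex.I * (k ^ 2 * z / p)) * phi (k * z) (p * z)

lemma natCast_mul_im_pos (hp : p ≠ 0) (z : ℍ) : 0 < ((p : ℂ) * z).im := by
  have : 0 < (p : ℝ) := by exact_mod_cast Nat.pos_of_ne_zero hp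
  simpa using mul_pos this z.im_pos

lemma eta_natCast_mul_ne_zero (hp : p ≠ 0) (z : ℍ) : ModularForm.eta ((p : ℂ) * z) ≠ 0 := by
  rw [eta_eq_eulerFun]
  exact mul_ne_zero (Complex.exp_ne_zero _) (eulerFun_ne_zero (natCast_mul_im_pos hp z))

/-- The Gaussian factor is chosen so that the quasi-period pz of φ acts by a mere sign. Indices may
then be reduced modulo p up to sign. -/
lemma oddAntiperiodic_thetaForm (hp : p ≠ 0) (z : ℍ) :
    OddAntiperiodic p (fun k => thetaForm p k z) where
  add_period k := by
    have hp' : (p : ℂ) ≠ 0 := by exact_mod_cast hp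
    have h := phi_add_tau (natCast_mul_im_pos hp z) (k * z)
    simp only [thetaForm]
    rw [show (((k + p : ℤ) : ℂ) * z) = k * z + p * z by push_cast; ring, h]
    have h1 : Complex.exp (Real.pi * Complex.I * (((k + p : ℤ) : ℂ) ^ 2 * z / p)) =
        Complex.exp (Real.pi * Complex.I * (k ^ 2 * z / p)) *
          (Complex.exp (-(Real.pi * Complex.I * (p * z + 2 * (k * z)))))⁻¹ := by
      rw [← Complex.exp_neg, ← Complex.exp_add]
      congr 1
      push_cast
      field_simp
      ring
    rw [h1]
    have := Complex.exp_ne_zero (-(Real.pi * Complex.I * (p * z + 2 * (k * z))))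
    field_simp
  neg k := by
    simp only [thetaForm]
    rw [show (((-k : ℤ) : ℂ) * z) = -(k * z) by push_cast; ring,
      phi_neg (natCast_mul_im_pos hp z)]
    push_cast
    rw [neg_sq]
    ring

lemma biagioliF_eq {k : ℕ} (hk : k ∈ Icc 1 ((p - 1) / 2)) (z : ℍ) :
    biagioliF p k z = -(ModularForm.eta ((p : ℂ) * z) ^ 3 * thetaForm p k z) := by
  rw [mem_Icc] at hk
  have hp : p ≠ 0 := by omega
  have hp' : (p : ℂ) ≠ 0 := by exact_mod_cast hp
  have hE := eulerFun_ne_zero (natCast_mul_im_pos hp z)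
  have h0 : ((k : ℤ) / (p : ℤ)) = 0 := Int.ediv_eq_zero_of_lt (by omega) (by omega)
  have h1 : qpow ((k : ℤ) : ℝ) z = Complex.exp (2 * Real.pi * Complex.I * (k * z)) := by
    rw [qpow]; congr 1; push_cast; ring
  have h2 : qpow (p : ℝ) z = Complex.exp (2 * Real.pi * Complex.I * (p * z)) := by
    rw [qpow]; congr 1; push_cast; ring
  have h3 : qpow ((p : ℝ) - ((k : ℤ) : ℝ)) z =
      Complex.exp (2 * Real.pi * Complex.I * (p * z - k * z)) := by
    rw [qpow]; congr 1; push_cast; ring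
  have h4 : qpow (((p : ℝ) - 2 * ((k : ℤ) : ℝ)) ^ 2 / (8 * p)) z =
      Complex.exp (Real.pi * Complex.I * (p * z) / 4) *
        Complex.exp (Real.pi * Complex.I * (((k : ℤ) : ℂ) ^ 2 * z / p)) *
          Complex.exp (-(Real.pi * Complex.I * (k * z))) := by
    rw [qpow, ← Complex.exp_add, ← Complex.exp_add]
    congr 1
    push_cast
    field_simp
    ring
  rw [biagioliF, h0, h1, h2, h3, h4, thetaForm, phi, eta_pow_three, thetaProd, zpow_zero, one_mul,
    Int.cast_natCast]
  field_simp

lemma prod_const_zpow {ι : Type*} (s : Finset ι) {x : ℂ} (hx : x ≠ 0) (n : ι → ℤ) :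
    ∏ k ∈ s, x ^ n k = x ^ ∑ k ∈ s, n k := by
  classical
  induction s using Finset.induction_on with
  | empty => simp
  | insert a s ha ih => rw [prod_insert ha, sum_insert ha, zpow_add₀ hx, ih]

lemma permIdx_zero (p r : ℕ) : permIdx p r 0 = 0 := by simp [permIdx]

lemma permIdx_absResidue (hp : p.Prime) (h3 : 3 < p) {r k : ℕ} (hr : r ∈ Icc 1 ((p - 1) / 2))
    (hk : k ∈ Icc 1 ((p - 1) / 2)) : permIdx p r (absResidue p (k * r)) = k := by
  have := Fact.mk hp
  have hr0 := natCast_ne_zero_of_mem_Icc hr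
  have hk0 := natCast_ne_zero_of_mem_Icc hk
  have hi : absResidue p (k * r) ∈ Icc 1 ((p - 1) / 2) :=
    absResidue_mem_Icc (by omega) (by push_cast; exact mul_ne_zero hk0 hr0)
  obtain ⟨h1, h2⟩ := permIdx_spec hp h3 hr hi
  refine eq_of_cast_eq_or_neg h1 hk ?_
  have h4 := cast_absResidue p (k * r)
  push_cast at h4
  have h5 : (r : ZMod p) * (permIdx p r (absResidue p (k * r)) : ZMod p) = r * k ∨
      (r : ZMod p) * (permIdx p r (absResidue p (k * r)) : ZMod p) = r * -k := by
    rcases h2 with h2 | h2 <;> rcases h4 with h4 | h4 <;> rw [h2, h4] <;> [left; right; right; left] <;>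
      ring
  exact h5.imp (mul_left_cancel₀ hr0) (mul_left_cancel₀ hr0)

/-- If m = ρ + pt the floor of m/p is t; if m = -ρ + pt it is t - 1, and the difference accounts for
the sign of oddness. This is the source of the terms ⌊di/p⌋ in L. -/
lemma OddAntiperiodic.absResidue_eq {u : ℤ → ℂ} (hu : OddAntiperiodic p u) (hp : p.Prime)
    (h3 : 3 < p) {m : ℤ} (hm : (m : ZMod p) ≠ 0) :
    u (absResidue p m) = (-1) ^ (m / (p : ℤ)) * u m := by
  have := Fact.mk hp
  have hi := absResidue_mem_Icc (by omega) hm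
  rw [mem_Icc] at hi
  have hsq : ∀ t : ℤ, ((-1 : ℂ) ^ t) * (-1) ^ t = 1 := fun t => by
    rw [← sq]; exact neg_one_zpow_sq t
  have hpos : (0 : ℤ) < p := by omega
  obtain ⟨t, ht | ht⟩ := exists_eq_absResidue p m
  · have h1 : m / (p : ℤ) = t := by
      rw [ht, Int.add_mul_ediv_left _ _ hpos.ne', Int.ediv_eq_zero_of_lt (by omega) (by omega)]
      simp
    rw [h1]
    conv_rhs => rw [ht, hu.add_mul, ← mul_assoc, hsq, one_mul]
  · have h1 : m / (p : ℤ) = t - 1 := by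
      rw [ht, Int.add_mul_ediv_left _ _ hpos.ne',
        show (-(absResidue p m : ℤ)) = (p - absResidue p m) + p * (-1) by ring,
        Int.add_mul_ediv_left _ _ hpos.ne', Int.ediv_eq_zero_of_lt (by omega) (by omega)]
      ring
    rw [h1]
    conv_rhs => rw [ht, hu.add_mul, hu.neg, zpow_sub₀ (by norm_num)]
    have := hsq t
    rw [zpow_one]
    linear_combination (-u (absResidue p m)) * this

/-- Reindexing by the inverse of π_r moves the permutation from the exponents to the indices rk, and
collects all factors η(pz) into one power. -/
lemma etaQuot_vecPerm (hp : p.Prime) (h3 : 3 < p) {r : ℕ} (hr : r ∈ Icc 1 ((p - 1) / 2))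
    (n : ℕ → ℤ) (z : ℍ) :
    etaQuot p (vecPerm p r n) z = (-1) ^ (∑ k ∈ Icc 1 ((p - 1) / 2), n k) *
      ModularForm.eta ((p : ℂ) * z) ^ (n 0 + 3 * ∑ k ∈ Icc 1 ((p - 1) / 2), n k) *
        ((-1) ^ (∑ k ∈ Icc 1 ((p - 1) / 2), ((r : ℤ) * k / (p : ℤ)) * n k) *
          ∏ k ∈ Icc 1 ((p - 1) / 2), thetaForm p (r * k) z ^ n k) := by
  have := Fact.mk hp
  have hr0 := natCast_ne_zero_of_mem_Icc hr
  have hη := eta_natCast_mul_ne_zero hp.ne_zero z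
  rw [etaQuot, ← prod_absResidue_mul (p := p) (by omega) (δ := r) (by simpa using hr0)]
  simp only [vecPerm, permIdx_zero]
  have h1 : ∀ k ∈ Icc 1 ((p - 1) / 2), biagioliF p (absResidue p (k * r) : ℕ) z ^
      n (permIdx p r (absResidue p (k * r))) = (-1) ^ n k * ModularForm.eta ((p : ℂ) * z) ^ (3 * n k) *
        ((-1) ^ (((r : ℤ) * k / (p : ℤ)) * n k) * thetaForm p (r * k) z ^ n k) := by
    intro k hk
    have hk0 := natCast_ne_zero_of_mem_Icc hk
    have hm : (((k * r : ℤ)) : ZMod p) ≠ 0 := by push_cast; exact mul_ne_zero hk0 hr0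
    rw [permIdx_absResidue hp h3 hr hk, biagioliF_eq (absResidue_mem_Icc (by omega) hm),
      (oddAntiperiodic_thetaForm hp.ne_zero z).absResidue_eq hp h3 hm, mul_comm (k : ℤ) r,
      neg_eq_neg_one_mul, mul_zpow, mul_zpow, mul_zpow, ← _root_.zpow_mul, ← zpow_natCast,
      ← _root_.zpow_mul]
    push_cast
    ring
  rw [prod_congr rfl h1, prod_mul_distrib, prod_mul_distrib, prod_mul_distrib,
    prod_const_zpow _ (by norm_num), prod_const_zpow _ hη, prod_const_zpow _ (by norm_num),
    zpow_add₀ hη, mul_sum]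
  ring

/-- The modulus pz is moved by the conjugate of A with lower left entry 1. The elliptic variable
becomes k(az+b): the new index is ka, and the integer translation kb gives a sign. -/
lemma thetaForm_smul (hp : p ≠ 0) (A : SL(2, ℤ)) (hA : A 1 0 = p) (k : ℤ) (z : ℍ) :
    thetaForm p k (A • z : ℍ) = (autFactor A z)⁻¹ * ((-1) ^ (k * A 0 1) *
      Complex.exp (Real.pi * Complex.I * (k ^ 2 * A 0 0 * A 0 1 / p)) * thetaForm p (k * A 0 0) z) := by
  have := NeZero.mk hp
  have hp' : (p : ℂ) ≠ 0 := by exact_mod_cast hp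
  have hA' : A 1 0 = p * 1 := by rw [hA, mul_one]
  have haut := autFactor_conjScale p A 1 hA' z
  have hD := autFactor_ne_zero A z
  have hsm := coe_smul_eq A z
  have h := phiLaw (conjScale p A 1 hA') (scale p z) (k * (A 0 0 * z + A 0 1))
  have h10 : (conjScale p A 1 hA') 1 0 = 1 := rfl
  rw [haut, conjScale_smul, h10, coe_scale, coe_scale, mul_div_assoc, ← hsm] at h
  rw [thetaForm, h, thetaForm]
  have h2 : phi (k * (A 0 0 * z + A 0 1)) (p * z) =
      (-1) ^ (k * A 0 1) * phi (((k * A 0 0 : ℤ) : ℂ) * z) (p * z) := by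
    rw [← phi_add_intCast]
    congr 1
    push_cast
    ring
  rw [h2]
  have h3 : Complex.exp (Real.pi * Complex.I * (k ^ 2 * (A • z : ℍ) / p)) *
      Complex.exp (Real.pi * Complex.I * ((1 : ℤ) : ℂ) * (k * (A 0 0 * z + A 0 1)) ^ 2 / autFactor A z) =
      Complex.exp (Real.pi * Complex.I * (k ^ 2 * A 0 0 * A 0 1 / p)) *
      Complex.exp (Real.pi * Complex.I * (((k * A 0 0 : ℤ) : ℂ) ^ 2 * z / p)) := by
    rw [← Complex.exp_add, ← Complex.exp_add]
    congr 1
    rw [hsm]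
    have hdet := det_cast A
    have ha : autFactor A z = p * z + A 1 1 := by rw [autFactor, hA]; push_cast; rfl
    rw [hA] at hdet
    push_cast at hdet ⊢
    field_simp
    rw [ha]
    linear_combination (-(k ^ 2 * (A 0 0 * z + A 0 1) : ℂ)) * hdet
  linear_combination ((autFactor A z)⁻¹ * ((-1) ^ (k * A 0 1) * phi (((k * A 0 0 : ℤ) : ℂ) * z) (p * z)))
    * h3

lemma eta_natCast_mul_smul (hp : p ≠ 0) (A : SL(2, ℤ)) (hA : A 1 0 = p) (z : ℍ) :
    ModularForm.eta ((p : ℂ) * (A • z : ℍ)) ^ 24 =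
      autFactor A z ^ 12 * ModularForm.eta ((p : ℂ) * z) ^ 24 := by
  have := NeZero.mk hp
  have hA' : A 1 0 = p * 1 := by rw [hA, mul_one]
  have h := eta_pow_smul (conjScale p A 1 hA') (scale p z)
  rwa [autFactor_conjScale p A 1 hA' z, conjScale_smul, coe_scale, coe_scale] at h

/-- The action of a matrix on the generalized eta quotients, up to a comparison of the theta
functions that occur. -/
lemma etaQuot_vecPerm_smul_aux (hp : p.Prime) (h3 : 3 < p) {r s : ℕ}
    (hr : r ∈ Icc 1 ((p - 1) / 2)) (hs : s ∈ Icc 1 ((p - 1) / 2)) (n : ℕ → ℤ) {m M : ℤ}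
    (hm : n 0 + 3 * ∑ k ∈ Icc 1 ((p - 1) / 2), n k = 24 * m)
    (hM : ∑ k ∈ Icc 1 ((p - 1) / 2), (k : ℤ) ^ 2 * n k = p * M)
    (A : SL(2, ℤ)) (hA : A 1 0 = p) {e : ℕ → ℤ}
    (he : ∀ (z : ℍ), ∀ k ∈ Icc 1 ((p - 1) / 2),
      thetaForm p (r * k * A 0 0) z = (-1) ^ e k * thetaForm p (s * k) z) (z : ℍ) :
    etaQuot p (vecPerm p r n) (A • z) =
      (-1) ^ (r ^ 2 * A 0 0 * A 0 1 * M + ∑ k ∈ Icc 1 ((p - 1) / 2),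
        ((r : ℤ) * k / (p : ℤ) + r * k * A 0 1 + e k + (s : ℤ) * k / (p : ℤ)) * n k) *
      autFactor A z ^ (12 * m - ∑ k ∈ Icc 1 ((p - 1) / 2), n k) *
        etaQuot p (vecPerm p s n) z := by
  have hD := autFactor_ne_zero A z
  have hp' : (p : ℂ) ≠ 0 := by exact_mod_cast hp.ne_zero
  have h1 : ∀ k ∈ Icc 1 ((p - 1) / 2), thetaForm p (r * k) (A • z : ℍ) ^ n k =
      (autFactor A z) ^ (-n k) * ((-1) ^ ((r * k * A 0 1 + e k) * n k) *
      Complex.exp (n k * (Real.pi * Complex.I * ((r * k) ^ 2 * A 0 0 * A 0 1 / p))) *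
        thetaForm p (s * k) z ^ n k) := by
    intro k hk
    rw [thetaForm_smul hp.ne_zero A hA, he z k hk, _root_.zpow_neg, ← _root_.inv_zpow,
      Complex.exp_int_mul, mul_zpow, mul_zpow, mul_zpow, mul_zpow, ← _root_.zpow_mul,
      ← _root_.zpow_mul, add_mul, zpow_add₀ (by norm_num)]
    push_cast
    ring
  -- By `hm` only a power of η^24 occurs, so no multiplier of η appears.
  have h2 : ModularForm.eta ((p : ℂ) * (A • z : ℍ)) ^ (24 * m) =
      autFactor A z ^ (12 * m) * ModularForm.eta ((p : ℂ) * z) ^ (24 * m) := by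
    rw [_root_.zpow_mul, _root_.zpow_mul, _root_.zpow_mul, ← mul_zpow]
    congr 1
    exact_mod_cast eta_natCast_mul_smul hp.ne_zero A hA z
  -- By `hM` the denominator p cancels in the total exponent, so the root of unity is a sign.
  have h4 : ∏ k ∈ Icc 1 ((p - 1) / 2),
      Complex.exp (n k * (Real.pi * Complex.I * ((r * k) ^ 2 * A 0 0 * A 0 1 / p))) =
      (-1) ^ (r ^ 2 * A 0 0 * A 0 1 * M) := by
    rw [← Complex.exp_sum, ← exp_pi_I_mul_intCast]
    congr 1
    have hM' : ∑ k ∈ Icc 1 ((p - 1) / 2), (k : ℂ) ^ 2 * n k = p * M := by exact_mod_cast hM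
    have h5 : ((r ^ 2 * A 0 0 * A 0 1 * M : ℤ) : ℂ) = r ^ 2 * A 0 0 * A 0 1 * (p * M) / p := by
      push_cast; field_simp
    rw [h5, ← hM', mul_sum, sum_div, mul_sum]
    refine sum_congr rfl fun k _ => ?_
    ring
  rw [etaQuot_vecPerm hp h3 hr, etaQuot_vecPerm hp h3 hs, hm, h2, prod_congr rfl h1,
    prod_mul_distrib, prod_mul_distrib, prod_mul_distrib, prod_const_zpow _ hD,
    prod_const_zpow _ (by norm_num), h4, sum_neg_distrib, sub_eq_add_neg, zpow_add₀ hD]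
  simp only [add_mul, sum_add_distrib, zpow_add₀ (show (-1 : ℂ) ≠ 0 by norm_num)]
  have hsq := neg_one_zpow_sq (∑ k ∈ Icc 1 ((p - 1) / 2), ((s : ℤ) * k / (p : ℤ)) * n k)
  rw [sq] at hsq
  generalize (-1 : ℂ) ^ (∑ k ∈ Icc 1 ((p - 1) / 2), ((s : ℤ) * k / (p : ℤ)) * n k) = x at *
  set y := (-1 : ℂ) ^ (∑ k ∈ Icc 1 ((p - 1) / 2), n k) *
    (autFactor A z ^ (12 * m) * ModularForm.eta ((p : ℂ) * z) ^ (24 * m)) *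
    ((-1) ^ (∑ k ∈ Icc 1 ((p - 1) / 2), ((r : ℤ) * k / (p : ℤ)) * n k) *
    (autFactor A z ^ (-∑ k ∈ Icc 1 ((p - 1) / 2), n k) *
    ((-1) ^ (∑ k ∈ Icc 1 ((p - 1) / 2), ((r : ℤ) * k * A 0 1) * n k) *
     (-1) ^ (∑ k ∈ Icc 1 ((p - 1) / 2), (e k) * n k) *
      (-1) ^ (r ^ 2 * A 0 0 * A 0 1 * M) *
        ∏ k ∈ Icc 1 ((p - 1) / 2), thetaForm p (s * k) z ^ n k)))
  linear_combination (-y) * hsq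

/-- Since ad ≡ 1 modulo p, the relation ds ≡ ±r gives ra ≡ ±s, so the theta functions of index rka
reduce to those of index sk. The constant ε matters only for r = d, which the next computation
settles. -/
lemma etaQuot_vecPerm_smul (hp : p.Prime) (h3 : 3 < p) {r d : ℕ}
    (hr : r ∈ Icc 1 ((p - 1) / 2)) (hd : d ∈ Icc 1 ((p - 1) / 2)) (n : ℕ → ℤ) {m M : ℤ}
    (hm : n 0 + 3 * ∑ k ∈ Icc 1 ((p - 1) / 2), n k = 24 * m)
    (hM : ∑ k ∈ Icc 1 ((p - 1) / 2), (k : ℤ) ^ 2 * n k = p * M)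
    (A : SL(2, ℤ)) (hA : A 1 0 = p) (hA1 : A 1 1 = d) :
    ∃ ε : ℂ, ∀ z : ℍ, etaQuot p (vecPerm p r n) (A • z) =
      ε * autFactor A z ^ (12 * m - ∑ k ∈ Icc 1 ((p - 1) / 2), n k) *
        etaQuot p (vecPerm p (permIdx p d r) n) z := by
  have := Fact.mk hp
  obtain ⟨hs, h⟩ := permIdx_spec hp h3 hd hr
  set s := permIdx p d r with hs'
  have hdet : A 0 0 * d - A 0 1 * p = 1 := by
    have := A.det_coe
    rw [Matrix.det_fin_two] at this
    rw [← hA, ← hA1]; exact this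
  have hdetp : (A 0 0 : ZMod p) * d = 1 := by
    have := congrArg (Int.cast : ℤ → ZMod p) hdet
    push_cast at this
    simpa using this
  obtain ⟨c, t, hct⟩ : ∃ c t : ℤ, (c = 0 ∧ (r : ℤ) * A 0 0 = s + p * t) ∨
      (c = 1 ∧ (r : ℤ) * A 0 0 = -s + p * t) := by
    rcases h with h | h
    · have h1 : (((r : ℤ) * A 0 0 - s : ℤ) : ZMod p) = 0 := by
        push_cast
        linear_combination (-A 0 0 : ZMod p) * h + (s : ZMod p) * hdetp
      rw [ZMod.intCast_zmod_eq_zero_iff_dvd] at h1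
      obtain ⟨t, ht⟩ := h1
      exact ⟨0, t, Or.inl ⟨rfl, by linear_combination ht⟩⟩
    · have h1 : (((r : ℤ) * A 0 0 + s : ℤ) : ZMod p) = 0 := by
        push_cast
        linear_combination (A 0 0 : ZMod p) * h - (s : ZMod p) * hdetp
      rw [ZMod.intCast_zmod_eq_zero_iff_dvd] at h1
      obtain ⟨t, ht⟩ := h1
      exact ⟨1, t, Or.inr ⟨rfl, by linear_combination ht⟩⟩
  refine ⟨_, fun z => etaQuot_vecPerm_smul_aux hp h3 hr hs n hm hM A hA
    (e := fun k => k * t + c) (fun z k _ => ?_) z⟩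
  have hu := oddAntiperiodic_thetaForm hp.ne_zero z
  rcases hct with ⟨rfl, h1⟩ | ⟨rfl, h1⟩
  · rw [show (r : ℤ) * k * A 0 0 = s * k + p * (k * t) by linear_combination (k : ℤ) * h1,
      hu.add_mul, add_zero]
  · rw [show (r : ℤ) * k * A 0 0 = -(s * k) + p * (k * t) by linear_combination (k : ℤ) * h1,
      hu.add_mul, hu.neg, zpow_add₀ (by norm_num), zpow_one]
    ring

lemma neg_one_zpow_congr {x y : ℤ} (h : (x : ZMod 2) = y) : (-1 : ℂ) ^ x = (-1) ^ y := by
  rw [ZMod.intCast_eq_intCast_iff_dvd_sub] at h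
  obtain ⟨c, hc⟩ := h
  rw [show y = x + 2 * c by push_cast at hc; linear_combination hc, zpow_add₀ (by norm_num),
    _root_.zpow_mul]
  norm_num

/-- Here da = 1 + pb, so dka = k + p·bk: the sign of the reduction is (-1)^{bk}, and bk is also
⌊dka/p⌋. Modulo 2, M ≡ ∑k n_k because p is odd and x² = x. Collecting the terms gives L. -/
lemma etaQuot_vecPerm_smul_self (hp : p.Prime) (h3 : 3 < p) {d : ℕ}
    (hd : d ∈ Icc 1 ((p - 1) / 2)) (n : ℕ → ℤ) {m M : ℤ}
    (hm : n 0 + 3 * ∑ k ∈ Icc 1 ((p - 1) / 2), n k = 24 * m)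
    (hM : ∑ k ∈ Icc 1 ((p - 1) / 2), (k : ℤ) ^ 2 * n k = p * M)
    (A : SL(2, ℤ)) (hA : A 1 0 = p) (hA1 : A 1 1 = d) (z : ℍ) :
    etaQuot p (vecPerm p d n) (A • z) =
      (-1) ^ signL n (A 0 0) (A 0 1) d p *
        autFactor A z ^ (12 * m - ∑ k ∈ Icc 1 ((p - 1) / 2), n k) *
        etaQuot p (vecPerm p 1 n) z := by
  have hdet : A 0 0 * d - A 0 1 * p = 1 := by
    have := A.det_coe
    rw [Matrix.det_fin_two] at this
    rw [← hA, ← hA1]; exact this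
  have hpZ : (p : ℤ) ≠ 0 := by exact_mod_cast hp.ne_zero
  rw [etaQuot_vecPerm_smul_aux hp h3 hd (s := 1) (by rw [mem_Icc]; omega) n hm hM A hA
    (e := fun k => A 0 1 * k) (fun z k _ => ?_) z]
  · congr 2
    apply neg_one_zpow_congr
    have hpo : (p : ZMod 2) = 1 := by
      have := hp.odd_of_ne_two (by omega)
      exact ZMod.natCast_eq_one_iff_odd.mpr this
    have hsq : ∀ x : ZMod 2, x ^ 2 = x := by decide
    have hdiv0 : ∀ k ∈ Icc 1 ((p - 1) / 2), ((1 : ℕ) : ℤ) * k / (p : ℤ) = 0 := fun k hk => by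
      rw [mem_Icc] at hk
      exact Int.ediv_eq_zero_of_lt (by positivity) (by push_cast; omega)
    have hdiv : ∀ k ∈ Icc 1 ((p - 1) / 2), (d : ℤ) * k * A 0 0 / (p : ℤ) = A 0 1 * k :=
      fun k hk => by
        rw [show (d : ℤ) * k * A 0 0 = k + p * (A 0 1 * k) by linear_combination (k : ℤ) * hdet,
          Int.add_mul_ediv_left _ _ hpZ, ← one_mul ((k : ℕ) : ℤ)]
        have := hdiv0 k hk
        push_cast at this
        rw [this]
        ring
    have hL : ∑ k ∈ Icc 1 ((p - 1) / 2), ((d : ℤ) * k * A 0 0 / (p : ℤ) + (d : ℤ) * k / (p : ℤ)) * n k =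
        ∑ k ∈ Icc 1 ((p - 1) / 2), (A 0 1 * k + (d : ℤ) * k / (p : ℤ)) * n k :=
      sum_congr rfl fun k hk => by rw [hdiv k hk]
    rw [signL, hL, sum_congr rfl (fun k hk => by rw [hdiv0 k hk, add_zero])]
    have hM2 := congrArg (Int.cast : ℤ → ZMod 2) hM
    have hdet2 := congrArg (Int.cast : ℤ → ZMod 2) hdet
    push_cast at hM2 hdet2 ⊢
    simp only [hsq, hpo, one_mul, mul_one] at hM2 hdet2 ⊢
    rw [← hM2]
    have hcomm : ∀ k : ℕ, (d : ZMod 2) * k * ((A 0 1 : ℤ) : ZMod 2) = d * ((A 0 1 : ℤ) : ZMod 2) * k :=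
      fun k => by ring
    simp only [hcomm, add_mul, sum_add_distrib, mul_assoc, ← mul_sum]
    ring
  · rw [show (d : ℤ) * k * A 0 0 = ((1 : ℕ) : ℤ) * k + p * (A 0 1 * k) by
      push_cast; linear_combination (k : ℤ) * hdet, (oddAntiperiodic_thetaForm hp.ne_zero z).add_mul]

end CrankSymmetry

end

noncomputable section

namespace CrankSymmetry

open Filter Topology Finset PowerSeries

/-! ### Rational expansions -/

/-- Nowhere vanishing functions on the unit disc with a Taylor series with rational
coefficients. -/
structure IsRationalUnit (f : ℂ → ℂ) : Prop where
  exists_series : ∃ P : ℚ⟦X⟧, Represents (P.map (algebraMap ℚ ℂ)) f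
  ne_zero : ∀ q : ℂ, ‖q‖ < 1 → f q ≠ 0

namespace IsRationalUnit

variable {f g : ℂ → ℂ}

lemma congr (h : IsRationalUnit f) (hfg : ∀ q : ℂ, ‖q‖ < 1 → f q = g q) : IsRationalUnit g where
  exists_series := h.exists_series.imp fun _ hP => hP.congr hfg
  ne_zero q hq := hfg q hq ▸ h.ne_zero q hq

lemma one : IsRationalUnit 1 where
  exists_series := ⟨1, by rw [map_one]; exact Represents.one⟩
  ne_zero q _ := by simp

lemma mul (hf : IsRationalUnit f) (hg : IsRationalUnit g) : IsRationalUnit (f * g) where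
  exists_series := by
    obtain ⟨P, hP⟩ := hf.exists_series
    obtain ⟨R, hR⟩ := hg.exists_series
    exact ⟨P * R, by rw [map_mul]; exact hP.mul hR⟩
  ne_zero q hq := mul_ne_zero (hf.ne_zero q hq) (hg.ne_zero q hq)

lemma inv (hf : IsRationalUnit f) : IsRationalUnit f⁻¹ where
  exists_series := by
    obtain ⟨P, hP⟩ := hf.exists_series
    have h0 : constantCoeff (P.map (algebraMap ℚ ℂ)) ≠ 0 := by
      rw [← hP.apply_zero]
      exact hf.ne_zero 0 (by simp)
    have h1 : constantCoeff P ≠ 0 := by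
      intro h
      apply h0
      rw [← coeff_zero_eq_constantCoeff_apply, coeff_map, coeff_zero_eq_constantCoeff_apply, h,
        map_zero]
    have h2 : P⁻¹.map (algebraMap ℚ ℂ) = (P.map (algebraMap ℚ ℂ))⁻¹ := by
      rw [eq_comm, PowerSeries.inv_eq_iff_mul_eq_one h0, ← map_mul, PowerSeries.inv_mul_cancel _ h1,
        map_one]
    exact ⟨P⁻¹, by rw [h2]; exact hP.exists_inv hf.ne_zero⟩
  ne_zero q hq := inv_ne_zero (hf.ne_zero q hq)

lemma pow (hf : IsRationalUnit f) (n : ℕ) : IsRationalUnit (f ^ n) := by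
  induction n with
  | zero => rw [pow_zero]; exact one
  | succ n ih => rw [pow_succ]; exact ih.mul hf

lemma zpow (hf : IsRationalUnit f) (n : ℤ) : IsRationalUnit (fun q => f q ^ n) := by
  obtain ⟨m, rfl | rfl⟩ := n.eq_nat_or_neg
  · exact (hf.pow m).congr fun q _ => by simp
  · exact (hf.pow m).inv.congr fun q _ => by simp

end IsRationalUnit

lemma isClosed_range_intCast : IsClosed (Set.range ((↑) : ℤ → ℂ)) := by
  have h := (Complex.isometry_ofReal.isClosedEmbedding.comp Int.isClosedEmbedding_coe_real).isClosed_range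
  convert! h using 2

/-- The coefficients are limits of coefficients of integral polynomials, and ℤ is closed in ℂ. -/
lemma isRationalUnit_qPoch {a b : ℕ} (ha : 1 ≤ a) (hb : 1 ≤ b) :
    IsRationalUnit (fun q => qPoch (q ^ a) (q ^ b)) where
  exists_series := by
    obtain ⟨W, hW, hlim⟩ := exists_represents_tprod (w := fun _ => 1) (e := fun i => a + b * i)
      (B := 1) (by simp) (fun i => by nlinarith)
    have hint : ∀ n, ∃ m : ℤ, (m : ℂ) = coeff n W := fun n => by
      refine isClosed_range_intCast.mem_of_tendsto (hlim n) (Eventually.of_forall fun s => ?_)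
      have h1 : (∏ i ∈ s, (1 - C (1 : ℂ) * X ^ (a + b * i)) : ℂ⟦X⟧) =
          (∏ i ∈ s, (1 - X ^ (a + b * i)) : ℤ⟦X⟧).map (Int.castRingHom ℂ) := by
        simp [map_prod]
      rw [h1, coeff_map]
      exact ⟨_, rfl⟩
    choose m hm using hint
    refine ⟨PowerSeries.mk fun n => (m n : ℚ), ?_⟩
    have h2 : (PowerSeries.mk fun n => (m n : ℚ)).map (algebraMap ℚ ℂ) = W := by
      ext n
      simp [hm]
    rw [h2]
    refine hW.congr fun q _ => ?_
    rw [qPoch]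
    exact tprod_congr fun i => by rw [one_mul, pow_add, pow_mul]
  ne_zero q hq := by
    have h : ∀ c : ℕ, 1 ≤ c → ‖q ^ c‖ < 1 := fun c hc => by
      rw [norm_pow]
      exact pow_lt_one₀ (norm_nonneg q) hq (by omega)
    exact qPoch_ne_zero_of_norm_lt (h b hb) (h a ha)

/-- The parameter `exp(2πiz/N)` at infinity. -/
def nome (N : ℕ) (z : ℍ) : ℂ := Complex.exp (2 * Real.pi * Complex.I * (z / N))

lemma nome_ne_zero (N : ℕ) (z : ℍ) : nome N z ≠ 0 := Complex.exp_ne_zero _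

lemma norm_nome_lt_one {N : ℕ} (hN : N ≠ 0) (z : ℍ) : ‖nome N z‖ < 1 := by
  refine norm_exp_two_pi_I_lt_one ?_
  rw [Complex.div_natCast_im]
  exact div_pos z.im_pos (by exact_mod_cast Nat.pos_of_ne_zero hN)

lemma exists_nome_eq {N : ℕ} (hN : N ≠ 0) {q : ℂ} (hq : ‖q‖ < 1) (hq0 : q ≠ 0) :
    ∃ z : ℍ, nome N z = q := by
  have hN' : (N : ℂ) ≠ 0 := by exact_mod_cast hN
  have hpos : 0 < (N : ℝ) := by exact_mod_cast Nat.pos_of_ne_zero hN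
  have him : 0 < (N * Complex.log q / (2 * Real.pi * Complex.I)).im := by
    have h1 : N * Complex.log q / (2 * Real.pi * Complex.I) =
        ((-(N / (2 * Real.pi)) : ℝ) : ℂ) * (Complex.log q * Complex.I) := by
      push_cast
      have := Complex.I_ne_zero
      field_simp
      rw [Complex.I_sq]
      ring
    rw [h1, Complex.im_ofReal_mul]
    have h2 : Real.log ‖q‖ < 0 := Real.log_neg (norm_pos_iff.mpr hq0) hq
    have h3 : 0 < N / (2 * Real.pi) := by positivity
    simp only [Complex.mul_I_im, Complex.log_re]
    nlinarith
  refine ⟨⟨_, him⟩, ?_⟩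
  have h4 : (2 * Real.pi * Complex.I * (N * Complex.log q / (2 * Real.pi * Complex.I) / N)) =
      Complex.log q := by
    have := Complex.I_ne_zero
    field_simp
  rw [nome]
  change Complex.exp (2 * Real.pi * Complex.I *
    (N * Complex.log q / (2 * Real.pi * Complex.I) / N)) = q
  rw [h4, Complex.exp_log hq0]

lemma exp_eq_nome_zpow {N : ℕ} (z : ℍ) {x : ℂ} {e : ℤ} (h : N * x = e * z) (hN : N ≠ 0) :
    Complex.exp (2 * Real.pi * Complex.I * x) = nome N z ^ e := by
  have hN' : (N : ℂ) ≠ 0 := by exact_mod_cast hN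
  rw [nome, ← Complex.exp_int_mul]
  congr 1
  field_simp
  linear_combination h

/-- Functions `Q^e f(Q)`, where `Q = exp(2πiz/N)`, `e` is an integer and `f` is holomorphic on the
disc, without zeros, with rational Taylor coefficients. -/
def HasRationalExpansion (N : ℕ) (F : ℍ → ℂ) : Prop :=
  ∃ (e : ℤ) (f : ℂ → ℂ), IsRationalUnit f ∧ ∀ z, F z = nome N z ^ e * f (nome N z)

namespace HasRationalExpansion

variable {N : ℕ} {F G : ℍ → ℂ}

lemma congr (h : HasRationalExpansion N F) (hFG : ∀ z, G z = F z) : HasRationalExpansion N G := by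
  obtain ⟨e, f, hf, h⟩ := h
  exact ⟨e, f, hf, fun z => (hFG z).trans (h z)⟩

lemma mul (hF : HasRationalExpansion N F) (hG : HasRationalExpansion N G) :
    HasRationalExpansion N (fun z => F z * G z) := by
  obtain ⟨e, f, hf, hF⟩ := hF
  obtain ⟨e', g, hg, hG⟩ := hG
  refine ⟨e + e', f * g, hf.mul hg, fun z => ?_⟩
  simp only [hF, hG]
  rw [zpow_add₀ (nome_ne_zero N z), Pi.mul_apply]
  ring

lemma zpow (hF : HasRationalExpansion N F) (n : ℤ) : HasRationalExpansion N (fun z => F z ^ n) := by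
  obtain ⟨e, f, hf, hF⟩ := hF
  refine ⟨e * n, fun q => f q ^ n, hf.zpow n, fun z => ?_⟩
  simp only [hF]
  rw [mul_zpow, zpow_mul]

lemma prod {ι : Type*} (s : Finset ι) {F : ι → ℍ → ℂ}
    (h : ∀ i ∈ s, HasRationalExpansion N (F i)) :
    HasRationalExpansion N (fun z => ∏ i ∈ s, F i z) := by
  classical
  induction s using Finset.induction_on with
  | empty => exact ⟨0, 1, IsRationalUnit.one, fun z => by simp⟩
  | insert a s ha ih =>
    exact ((h a (mem_insert_self a s)).mul (ih fun i hi => h i (mem_insert_of_mem hi))).congr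
      fun z => by rw [prod_insert ha]

lemma exp (hN : N ≠ 0) (e : ℤ) {x : ℍ → ℂ} (h : ∀ z, N * x z = e * z) :
    HasRationalExpansion N (fun z => Complex.exp (2 * Real.pi * Complex.I * x z)) :=
  ⟨e, 1, IsRationalUnit.one, fun z => by simp only [exp_eq_nome_zpow z (h z) hN]; simp⟩

lemma qPoch_exp (hN : N ≠ 0) {a b : ℕ} (ha : 1 ≤ a) (hb : 1 ≤ b) {x y : ℍ → ℂ}
    (hx : ∀ z, x z = a * z) (hy : ∀ z, y z = b * z) :
    HasRationalExpansion N (fun z => qPoch (Complex.exp (2 * Real.pi * Complex.I * x z))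
      (Complex.exp (2 * Real.pi * Complex.I * y z))) := by
  refine ⟨0, _, isRationalUnit_qPoch (a := N * a) (b := N * b)
    (Nat.one_le_iff_ne_zero.mpr (by positivity)) (Nat.one_le_iff_ne_zero.mpr (by positivity)), fun z => ?_⟩
  simp only
  rw [zpow_zero, one_mul, exp_eq_nome_zpow z (e := (N * a : ℕ)) (by rw [hx]; push_cast; ring) hN,
    exp_eq_nome_zpow z (e := (N * b : ℕ)) (by rw [hy]; push_cast; ring) hN, zpow_natCast,
    zpow_natCast]

end HasRationalExpansion

/-- The exponents of q at the cusp have denominators 24 (from η) and 8p (from f_{p,k}); the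
parameter exp(2πiz/(24p)) clears both. -/
lemma hasRationalExpansion_etaQuot {p : ℕ} (hp : p ≠ 0) (n : ℕ → ℤ) :
    HasRationalExpansion (24 * p) (etaQuot p n) := by
  have hN : 24 * p ≠ 0 := by omega
  have hp' : (p : ℂ) ≠ 0 := by exact_mod_cast hp
  have hp1 : 1 ≤ p := by omega
  have hη : HasRationalExpansion (24 * p) (fun z => ModularForm.eta ((p : ℂ) * z)) := by
    refine ((HasRationalExpansion.exp hN (p ^ 2) (x := fun z => p * z / 24) fun z => ?_).mul
      (HasRationalExpansion.qPoch_exp hN hp1 hp1 (x := fun z => p * z) (y := fun z => p * z)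
        (fun _ => rfl) (fun _ => rfl))).congr fun z => ?_
    · push_cast; ring
    · rw [eta_eq_eulerFun, eulerFun, mul_div_assoc]
  refine ((hη.zpow (n 0)).mul (HasRationalExpansion.prod (Icc 1 ((p - 1) / 2))
    (F := fun k z => biagioliF p k z ^ n k) fun k hk => HasRationalExpansion.zpow ?_ _)).congr
      fun z => rfl
  rw [mem_Icc] at hk
  have h0 : ((k : ℤ) / (p : ℤ)) = 0 := Int.ediv_eq_zero_of_lt (by omega) (by omega)
  refine ((HasRationalExpansion.exp hN (3 * (p - 2 * k) ^ 2)
    (x := fun z => (p - 2 * k) ^ 2 / (8 * p) * z) fun z => ?_).mul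
    (((HasRationalExpansion.qPoch_exp hN (a := k) hk.1 hp1 (x := fun z => k * z)
      (y := fun z => p * z) (fun _ => rfl) (fun _ => rfl)).mul
    (HasRationalExpansion.qPoch_exp hN (a := p - k) (by omega) hp1 (x := fun z => (p - k) * z)
      (y := fun z => p * z) (fun _ => ?_) (fun _ => rfl))).mul
    (HasRationalExpansion.qPoch_exp hN hp1 hp1 (x := fun z => p * z)
      (y := fun z => p * z) (fun _ => rfl) (fun _ => rfl)))).congr fun z => ?_
  · push_cast; field_simp; ring
  · rw [Nat.cast_sub (by omega)]
  · simp only [biagioliF, h0, zpow_zero, one_mul, qpow]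
    push_cast
    simp only [mul_assoc]

/-- Linear relations between functions with rational expansions can be transported along
`ℚ`-linear maps. -/
lemma sum_map_mul_eq {N : ℕ} (hN : N ≠ 0) {ι : Type*} [Fintype ι] {F : ι → ℍ → ℂ}
    (hF : ∀ i, HasRationalExpansion N (F i)) {u : ι → ℂ} {κ : ℕ → ℂ} (φ : ℂ →ₗ[ℚ] ℂ)
    {S : ℍ → ℂ} (hu : ∀ z, HasSum (fun n => κ n * nome N z ^ n) (∑ i, u i * F i z))
    (hS : ∀ z, HasSum (fun n => φ (κ n) * nome N z ^ n) (S z)) (z : ℍ) :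
    S z = ∑ i, φ (u i) * F i z := by
  choose e f hf hFf using hF
  choose P hP using fun i => (hf i).exists_series
  -- Multiplication by Q^E makes all exponents nonnegative, so that power series suffice.
  set E : ℕ := ∑ i, (e i).natAbs with hE
  have hEe : ∀ i, 0 ≤ e i + E := fun i => by
    have h1 : (e i).natAbs ≤ E := single_le_sum (f := fun i => (e i).natAbs)
      (fun _ _ => Nat.zero_le _) (mem_univ i)
    omega
  have hrep : ∀ {κ : ℕ → ℂ} {T : ℍ → ℂ}, (∀ z, HasSum (fun n => κ n * nome N z ^ n) (T z)) →
      Represents (PowerSeries.mk κ) (fun q => ∑' n, κ n * q ^ n) := by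
    intro κ T hT q hq
    by_cases hq0 : q = 0
    · subst hq0
      simp only [coeff_mk]
      exact (hasSum_single 0 fun n hn => by simp [hn] : HasSum (fun n => κ n * (0 : ℂ) ^ n) _).summable.hasSum
    · obtain ⟨z, rfl⟩ := exists_nome_eq hN hq hq0
      simpa using (hT z).summable.hasSum
  have hcomb : ∀ v : ι → ℂ, Represents
      (∑ i, C (v i) * (X ^ (e i + E).toNat * (P i).map (algebraMap ℚ ℂ)))
      (fun q => ∑ i, v i * (q ^ (e i + E).toNat * f i q)) := by
    intro v q hq
    simp only [map_sum, sum_mul]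
    exact hasSum_sum fun i _ => ((Represents.const (v i)).mul
      ((Represents.X_pow (e i + E).toNat).mul (hP i))) q hq
  have hval : ∀ (v : ι → ℂ) (z : ℍ), ∑ i, v i * (nome N z ^ (e i + E).toNat * f i (nome N z)) =
      nome N z ^ E * ∑ i, v i * F i z := by
    intro v z
    rw [mul_sum]
    refine sum_congr rfl fun i _ => ?_
    have h1 : nome N z ^ (e i + E).toNat = nome N z ^ e i * nome N z ^ E := by
      rw [← zpow_natCast, Int.toNat_of_nonneg (hEe i), zpow_add₀ (nome_ne_zero N z), zpow_natCast]
    rw [h1, hFf]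
    ring
  have h1 : X ^ E * PowerSeries.mk κ =
      ∑ i, C (u i) * (X ^ (e i + E).toNat * (P i).map (algebraMap ℚ ℂ)) := by
    rw [← sub_eq_zero]
    refine (((Represents.X_pow E).mul (hrep hu)).sub (hcomb u)).eq_zero fun q hq hq0 => ?_
    obtain ⟨z, rfl⟩ := exists_nome_eq hN hq hq0
    simp only [Pi.sub_apply, Pi.mul_apply]
    rw [hval, (hu z).tsum_eq, sub_self]
  -- Each coefficient is a ℚ-linear form in v, and therefore commutes with φ.
  have hcoeff : ∀ (v : ι → ℂ) (n : ℕ), coeff n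
      (∑ i, C (v i) * (X ^ (e i + E).toNat * (P i).map (algebraMap ℚ ℂ)) : ℂ⟦X⟧) =
      ∑ i, (coeff n (X ^ (e i + E).toNat * P i) : ℚ) • v i := by
    intro v n
    rw [map_sum]
    refine sum_congr rfl fun i _ => ?_
    have h2 : (X ^ (e i + E).toNat * (P i).map (algebraMap ℚ ℂ) : ℂ⟦X⟧) =
        (X ^ (e i + E).toNat * P i).map (algebraMap ℚ ℂ) := by simp
    rw [h2, coeff_C_mul, coeff_map, Algebra.smul_def, mul_comm]
  have h2 : X ^ E * PowerSeries.mk (fun n => φ (κ n)) =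
      ∑ i, C (φ (u i)) * (X ^ (e i + E).toNat * (P i).map (algebraMap ℚ ℂ)) := by
    ext n
    have h3 := congrArg (fun A => φ (coeff n A)) h1
    simp only [hcoeff, map_sum, map_smul] at h3
    rw [hcoeff, ← h3, coeff_X_pow_mul', coeff_X_pow_mul']
    split_ifs <;> simp
  have h3 := ((Represents.X_pow E).mul (hrep hS)) (nome N z) (norm_nome_lt_one hN z)
  rw [h2] at h3
  have h4 := h3.unique (hcomb (fun i => φ (u i)) (nome N z) (norm_nome_lt_one hN z))
  simp only [Pi.mul_apply, (hS z).tsum_eq, hval] at h4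
  exact mul_left_cancel₀ (pow_ne_zero E (nome_ne_zero N z)) h4

/-- Functions with rational expansions which are linearly independent over `ℚ` are linearly
independent over `ℂ`. -/
lemma linearIndependent_complex {N : ℕ} (hN : N ≠ 0) {ι : Type*} [Fintype ι] {F : ι → ℍ → ℂ}
    (hF : ∀ i, HasRationalExpansion N (F i)) (h : LinearIndependent ℚ F) :
    LinearIndependent ℂ F := by
  rw [Fintype.linearIndependent_iff] at h ⊢
  intro u hu i
  by_contra hi
  -- A rational functional that does not kill the coefficient u i turns the complex relation into a
  -- nontrivial rational one.
  obtain ⟨ψ, hψ⟩ : ∃ ψ : Module.Dual ℚ ℂ, ψ (u i) ≠ 0 := by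
    by_contra! hc
    exact hi ((Module.forall_dual_apply_eq_zero_iff ℚ (u i)).mp hc)
  refine hψ (h (fun i => ψ (u i)) ?_ i)
  ext z
  have h1 := sum_map_mul_eq hN hF (u := u) (κ := 0) (S := 0)
    ((Algebra.linearMap ℚ ℂ).comp ψ) (fun z => ?_) (fun z => by simp [hasSum_zero]) z
  · simpa [Finset.sum_apply, Algebra.smul_def] using h1.symm
  · have h2 := congrFun hu z
    simp only [Finset.sum_apply, Pi.smul_apply, smul_eq_mul, Pi.zero_apply] at h2
    rw [h2]
    simp [hasSum_zero]

/-- Algebraic conjugates are related by a `ℚ`-linear map. -/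
lemma exists_linearMap_aeval {x y : ℂ} (h : minpoly ℚ x = minpoly ℚ y) :
    ∃ φ : ℂ →ₗ[ℚ] ℂ, ∀ P : Polynomial ℚ, φ (Polynomial.aeval x P) = Polynomial.aeval y P := by
  have hker : LinearMap.ker (Polynomial.aeval (R := ℚ) x).toLinearMap ≤
      LinearMap.ker (Polynomial.aeval (R := ℚ) y).toLinearMap := by
    intro P hP
    rw [LinearMap.mem_ker, AlgHom.toLinearMap_apply] at hP ⊢
    rw [← minpoly.dvd_iff, ← h, minpoly.dvd_iff]
    exact hP
  -- The conjugation ℚ[x] → ℚ[y] is extended to ℂ merely as a ℚ-linear map; multiplicativity outside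
  -- ℚ[x] is not needed.
  obtain ⟨φ, hφ⟩ := LinearMap.exists_extend
    (((LinearMap.ker (Polynomial.aeval (R := ℚ) x).toLinearMap).liftQ _ hker).comp
      (LinearMap.quotKerEquivRange (Polynomial.aeval (R := ℚ) x).toLinearMap).symm.toLinearMap)
  refine ⟨φ, fun P => ?_⟩
  have h1 := LinearMap.congr_fun hφ ⟨Polynomial.aeval x P, P, rfl⟩
  simp only [LinearMap.comp_apply, Submodule.subtype_apply] at h1
  rw [h1]
  have h2 : (LinearMap.quotKerEquivRange (Polynomial.aeval (R := ℚ) x).toLinearMap).symm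
      ⟨Polynomial.aeval x P, P, rfl⟩ = Submodule.Quotient.mk P := by
    rw [LinearEquiv.symm_apply_eq]
    rfl
  simp only [LinearEquiv.coe_coe, h2]
  rfl

lemma minpoly_zeta_pow {p d : ℕ} (hp : p ≠ 0) (hd : d.Coprime p) :
    minpoly ℚ (zeta p) = minpoly ℚ (zeta p ^ d) := by
  have h := isPrimitiveRoot_zeta p hp
  rw [← Polynomial.cyclotomic_eq_minpoly_rat h (Nat.pos_of_ne_zero hp),
    ← Polynomial.cyclotomic_eq_minpoly_rat (h.pow_of_coprime d hd) (Nat.pos_of_ne_zero hp)]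

end CrankSymmetry

end

noncomputable section

namespace CrankSymmetry

open Filter Topology Finset

/-! ### Conjugate relations -/

variable {p : ℕ}

lemma hasSum_crankK (hp : p ≠ 0) {l : ℕ} (hl : l ∈ Icc 1 ((p - 1) / 2)) (z : ℍ) :
    HasSum (fun n : ℕ => qPoch (qpow p z) (qpow p z) * if sP p ≤ p * n + 0 then
      (∑ k ∈ range p, (crankCountMod k p (p * n + 0 - sP p) : ℂ) * zeta p ^ (k * l)) * qpow n z
      else 0) (crankK p 0 l z) := by
  have := NeZero.mk hp
  rw [crankK_eq_sum hl]
  exact hasSum_sum_crankKernel hl z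

/-- The polynomial whose values at `ζ_p^l` are the coefficients of `crankK p 0 l`, without the
infinite product. -/
def crankPoly (p n : ℕ) : Polynomial ℚ :=
  if sP p ≤ p * n then
    ∑ k ∈ range p, Polynomial.C (crankCountMod k p (p * n - sP p) : ℚ) * Polynomial.X ^ k
  else 0

lemma nome_pow {N : ℕ} (hN : N ≠ 0) (z : ℍ) (n : ℕ) : nome N z ^ (N * n) = qpow n z := by
  have hN' : (N : ℂ) ≠ 0 := by exact_mod_cast hN
  rw [nome, exp_two_pi_I_mul_pow, qpow]
  congr 1
  push_cast
  field_simp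

lemma qPoch_qpow_ne_zero (hp : p ≠ 0) (z : ℍ) : qPoch (qpow p z) (qpow p z) ≠ 0 := by
  have h := eulerFun_ne_zero (natCast_mul_im_pos hp z)
  rw [eulerFun, ← mul_assoc] at h
  simpa [qpow] using h

lemma hasSum_crankK_nome (hp : p ≠ 0) {l : ℕ} (hl : l ∈ Icc 1 ((p - 1) / 2)) {N : ℕ} (hN : N ≠ 0)
    (z : ℍ) : HasSum (fun n : ℕ => Polynomial.aeval (zeta p ^ l)
      (if N ∣ n then crankPoly p (n / N) else 0) * nome N z ^ n)
      (crankK p 0 l z * (qPoch (qpow p z) (qpow p z))⁻¹) := by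
  have h1 := (hasSum_crankK hp hl z).mul_right (qPoch (qpow p z) (qpow p z))⁻¹
  rw [← Function.Injective.hasSum_iff (mul_right_injective₀ hN)]
  · convert! h1 using 1
    ext n
    have hU := qPoch_qpow_ne_zero hp z
    rw [Function.comp_apply, if_pos (dvd_mul_right N n), Nat.mul_div_cancel_left n
      (Nat.pos_of_ne_zero hN), nome_pow hN, crankPoly, add_zero]
    split_ifs
    · rw [map_sum]
      have h2 : ∀ k, zeta p ^ (k * l) = (zeta p ^ l) ^ k := fun k => by rw [← pow_mul, mul_comm]
      simp only [map_mul, map_pow, Polynomial.aeval_X, map_intCast, h2]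
      field_simp
    · simp
  · intro n hn
    rw [if_neg, map_zero, zero_mul]
    rintro ⟨c, rfl⟩
    exact hn ⟨c, rfl⟩

/-- After division by (q^p;q^p), the coefficients of K(ζ, ·) are rational polynomials evaluated at
ζ, and the j still have rational expansions. A ℚ-linear map taking P(ζ) to P(ζ^d) therefore
conjugates the whole relation. -/
lemma crankK_conj (hp : p.Prime) (h3 : 3 < p) {ι : Type*} [Fintype ι] (n : ι → ℕ → ℤ)
    (c : ι → Polynomial ℚ) (hK : ∀ z : ℍ, crankK p 0 1 z =
      ∑ i, Polynomial.aeval (zeta p) (c i) * etaQuot p (n i) z)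
    {d : ℕ} (hd : d ∈ Icc 1 ((p - 1) / 2)) (z : ℍ) :
    crankK p 0 d z = ∑ i, Polynomial.aeval (zeta p ^ d) (c i) * etaQuot p (n i) z := by
  have hp0 := hp.ne_zero
  have hN : 24 * p ≠ 0 := by omega
  have hcop : d.Coprime p := by
    rw [mem_Icc] at hd
    exact (Nat.coprime_of_lt_prime (by omega) (by omega) hp).symm
  obtain ⟨φ, hφ⟩ := exists_linearMap_aeval (minpoly_zeta_pow hp0 hcop)
  have hU : HasRationalExpansion (24 * p) (fun z => (qPoch (qpow p z) (qpow p z))⁻¹) := by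
    refine ((HasRationalExpansion.qPoch_exp hN (a := p) (b := p) (by omega) (by omega)
      (x := fun z => p * z) (y := fun z => p * z) (fun _ => rfl) (fun _ => rfl)).zpow (-1)).congr
        fun z => ?_
    simp [qpow, mul_assoc]
  have h1 : (1 : ℕ) ∈ Icc 1 ((p - 1) / 2) := by rw [mem_Icc]; omega
  have key := sum_map_mul_eq hN
    (F := fun i z => etaQuot p (n i) z * (qPoch (qpow p z) (qpow p z))⁻¹)
    (u := fun i => Polynomial.aeval (zeta p) (c i))
    (κ := fun m => Polynomial.aeval (zeta p)
      (if 24 * p ∣ m then crankPoly p (m / (24 * p)) else 0))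
    (S := fun z => crankK p 0 d z * (qPoch (qpow p z) (qpow p z))⁻¹)
    (fun i => (hasRationalExpansion_etaQuot hp0 (n i)).mul hU) φ (fun z => ?_) (fun z => ?_) z
  · have hne := qPoch_qpow_ne_zero hp0 z
    simp only [hφ] at key
    apply mul_right_cancel₀ (inv_ne_zero hne)
    rw [key, sum_mul]
    exact sum_congr rfl fun i _ => by ring
  · have h2 := hasSum_crankK_nome hp0 h1 hN z
    rw [pow_one, hK z, sum_mul] at h2
    convert! h2 using 1
    exact sum_congr rfl fun i _ => by ring
  · simp only [hφ]
    exact hasSum_crankK_nome hp0 hd hN z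

/-! ### Translations -/

lemma qpow_vadd (x : ℝ) (z : ℍ) :
    qpow x ((1 : ℝ) +ᵥ z) = Complex.exp (2 * Real.pi * Complex.I * x) * qpow x z := by
  rw [qpow, qpow, UpperHalfPlane.coe_vadd, ← Complex.exp_add]
  congr 1
  push_cast
  ring

lemma qpow_natCast_vadd (n : ℕ) (z : ℍ) : qpow n ((1 : ℝ) +ᵥ z) = qpow n z := by
  rw [qpow_vadd]
  have h : Complex.exp (2 * Real.pi * Complex.I * (n : ℝ)) = 1 := by
    rw [Complex.exp_eq_one_iff]
    exact ⟨n, by push_cast; ring⟩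
  rw [h, one_mul]

lemma crankK_vadd (p l : ℕ) (z : ℍ) : crankK p 0 l ((1 : ℝ) +ᵥ z) = crankK p 0 l z := by
  simp only [crankK, qpow_natCast_vadd]
  simp [qpow]

/-- The exponent of `q` at the cusp infinity, times `24p`. -/
def cuspOrder (p : ℕ) (n : ℕ → ℤ) : ℤ :=
  p ^ 2 * n 0 + ∑ k ∈ Icc 1 ((p - 1) / 2), 3 * (p - 2 * k) ^ 2 * n k

lemma etaQuot_vadd (hp : p ≠ 0) (n : ℕ → ℤ) (z : ℍ) :
    etaQuot p n ((1 : ℝ) +ᵥ z) =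
      Complex.exp (2 * Real.pi * Complex.I * (cuspOrder p n / (24 * p))) * etaQuot p n z := by
  have hp' : (p : ℂ) ≠ 0 := by exact_mod_cast hp
  have hη : ModularForm.eta ((p : ℂ) * ((1 : ℝ) +ᵥ z : ℍ)) =
      Complex.exp (2 * Real.pi * Complex.I * (p / 24)) * ModularForm.eta ((p : ℂ) * z) := by
    have h1 : eulerFun ((p : ℂ) * ((1 : ℝ) +ᵥ z : ℍ)) = eulerFun ((p : ℂ) * z) := by
      have h2 := qpow_natCast_vadd p z
      rw [qpow, qpow] at h2
      push_cast at h2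
      rw [eulerFun, eulerFun, ← mul_assoc, h2, ← mul_assoc]
    rw [eta_eq_eulerFun, eta_eq_eulerFun, h1, ← mul_assoc (Complex.exp _) (Complex.exp _), ← Complex.exp_add,
      UpperHalfPlane.coe_vadd]
    congr 2
    push_cast
    ring
  have hf : ∀ k ∈ Icc 1 ((p - 1) / 2), biagioliF p k ((1 : ℝ) +ᵥ z) ^ n k =
      Complex.exp (2 * Real.pi * Complex.I * ((p - 2 * k) ^ 2 / (8 * p))) ^ n k *
        biagioliF p k z ^ n k := by
    intro k hk
    rw [mem_Icc] at hk
    rw [← mul_zpow]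
    congr 1
    have h1 : (p : ℝ) - ((k : ℤ) : ℝ) = ((p - k : ℕ) : ℝ) := by
      rw [Nat.cast_sub (by omega)]; simp
    have h2 : (((k : ℕ) : ℤ) : ℝ) = (k : ℝ) := by simp
    rw [biagioliF, biagioliF, h1, h2, qpow_natCast_vadd, qpow_natCast_vadd, qpow_natCast_vadd,
      qpow_vadd]
    push_cast
    ring
  rw [etaQuot, etaQuot, hη, prod_congr rfl hf, prod_mul_distrib, mul_zpow]
  have hexp : Complex.exp (2 * Real.pi * Complex.I * (cuspOrder p n / (24 * p))) =
      Complex.exp (2 * Real.pi * Complex.I * (p / 24)) ^ n 0 *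
      ∏ k ∈ Icc 1 ((p - 1) / 2),
        Complex.exp (2 * Real.pi * Complex.I * ((p - 2 * k) ^ 2 / (8 * p))) ^ n k := by
    simp only [← Complex.exp_int_mul]
    rw [← Complex.exp_sum, ← Complex.exp_add, cuspOrder]
    congr 1
    push_cast
    rw [add_div, mul_add, sum_div, mul_sum]
    congr 1
    · field_simp
    · refine sum_congr rfl fun k _ => ?_
      field_simp
      ring
  rw [hexp]
  ring

lemma exp_cuspOrder_eq_one_iff (hp : p ≠ 0) (n : ℕ → ℤ) :
    Complex.exp (2 * Real.pi * Complex.I * (cuspOrder p n / (24 * p))) = 1 ↔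
      (24 * p : ℤ) ∣ cuspOrder p n := by
  have hp' : (p : ℂ) ≠ 0 := by exact_mod_cast hp
  rw [Complex.exp_eq_one_iff]
  refine exists_congr fun m => ?_
  have h1 : 2 * Real.pi * Complex.I ≠ (0 : ℂ) := Complex.two_pi_I_ne_zero
  rw [mul_comm (m : ℂ), mul_right_inj' h1, div_eq_iff (mul_ne_zero (by norm_num) hp')]
  rw [mul_comm (m : ℂ)]
  exact_mod_cast Iff.rfl

lemma natCast_sq_eq_one_zmod24 (hp : p.Prime) (h3 : 3 < p) : (p : ZMod 24) ^ 2 = 1 := by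
  have h := sP_mul hp h3
  have h1 := congrArg (Nat.cast : ℕ → ZMod 24) h
  push_cast at h1
  rw [← h1, show (24 : ZMod 24) = 0 from rfl]
  ring

/-- The condition on the exponents under which a generalized eta quotient is invariant under
translation. -/
lemma dvd_cuspOrder_iff (hp : p.Prime) (h3 : 3 < p) {r : ℕ} (hr : r ∈ Icc 1 ((p - 1) / 2))
    (n : ℕ → ℤ) : (24 * p : ℤ) ∣ cuspOrder p (vecPerm p r n) ↔
    (24 : ℤ) ∣ n 0 + 3 * ∑ k ∈ Icc 1 ((p - 1) / 2), n k ∧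
      (p : ℤ) ∣ ∑ k ∈ Icc 1 ((p - 1) / 2), (k : ℤ) ^ 2 * n k := by
  have := Fact.mk hp
  have hr0 := natCast_ne_zero_of_mem_Icc hr
  have hre : ∀ f : ℕ → ℕ → ℤ, ∑ i ∈ Icc 1 ((p - 1) / 2), f i (permIdx p r i) =
      ∑ k ∈ Icc 1 ((p - 1) / 2), f (absResidue p (k * r)) k := by
    intro f
    have h1 := prod_absResidue_mul (p := p) (M := Multiplicative ℤ) (by omega) (δ := r)
      (by simpa using hr0) (fun i => Multiplicative.ofAdd (f i (permIdx p r i)))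
    have h2 : ∑ k ∈ Icc 1 ((p - 1) / 2), f (absResidue p (k * r))
        (permIdx p r (absResidue p (k * r))) = ∑ i ∈ Icc 1 ((p - 1) / 2), f i (permIdx p r i) := by
      simpa [← ofAdd_sum] using! h1
    rw [← h2]
    exact sum_congr rfl fun k hk => by rw [permIdx_absResidue hp h3 hr hk]
  have hord : cuspOrder p (vecPerm p r n) = p ^ 2 * n 0 +
      ∑ k ∈ Icc 1 ((p - 1) / 2), 3 * (p - 2 * (absResidue p (k * r) : ℕ)) ^ 2 * n k := by
    rw [cuspOrder, ← hre (fun i k => 3 * (p - 2 * (i : ℕ)) ^ 2 * n k)]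
    simp only [vecPerm, permIdx_zero]
  have hcop : IsCoprime (24 : ℤ) p := by
    refine ⟨-sP p, p, ?_⟩
    have h := sP_mul hp h3
    zify at h
    linear_combination -h
  have hsplit : ∀ x : ℤ, (24 * p : ℤ) ∣ x ↔ (24 : ℤ) ∣ x ∧ (p : ℤ) ∣ x := fun x =>
    ⟨fun h => ⟨(dvd_mul_right _ _).trans h, (dvd_mul_left _ _).trans h⟩,
      fun h => hcop.mul_dvd h.1 h.2⟩
  rw [hord, hsplit]
  refine and_congr ?_ ?_
  · rw [show (24 : ℤ) = ((24 : ℕ) : ℤ) from rfl, ← ZMod.intCast_zmod_eq_zero_iff_dvd,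
      ← ZMod.intCast_zmod_eq_zero_iff_dvd]
    push_cast
    -- Odd squares are 1 modulo 8, so the condition modulo 24 does not see the permutation.
    have hodd : ∀ x : ZMod 24, x ^ 2 = 1 → ∀ y : ZMod 24, 3 * (x - 2 * y) ^ 2 = 3 := by decide
    simp only [natCast_sq_eq_one_zmod24 hp h3, hodd _ (natCast_sq_eq_one_zmod24 hp h3),
      ← mul_sum, one_mul]
  · rw [← ZMod.intCast_zmod_eq_zero_iff_dvd, ← ZMod.intCast_zmod_eq_zero_iff_dvd]
    push_cast
    have hsq : ∀ k : ℕ, ((absResidue p (k * r) : ℕ) : ZMod p) ^ 2 = (k * r : ZMod p) ^ 2 := by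
      intro k
      have := cast_absResidue p (k * r)
      push_cast at this
      rcases this with h | h <;> rw [h]
      rw [neg_sq]
    have h12 : (12 : ZMod p) ≠ 0 := by
      have : ((12 : ℕ) : ZMod p) ≠ 0 := by
        rw [Ne, ZMod.natCast_eq_zero_iff]
        intro hdvd
        have h4 : p ∣ 2 * 2 * 3 := hdvd
        rw [hp.dvd_mul, hp.dvd_mul] at h4
        rcases h4 with (h4 | h4) | h4 <;> exact absurd (Nat.le_of_dvd (by norm_num) h4) (by omega)
      exact_mod_cast this
    -- Modulo p the permutation only contributes the factor r², and 12r² is a unit. The condition is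
    -- thus independent of r.
    have h5 : ∑ k ∈ Icc 1 ((p - 1) / 2),
        3 * ((p : ZMod p) - 2 * (absResidue p (k * r) : ℕ)) ^ 2 * (n k : ZMod p) =
        12 * (r : ZMod p) ^ 2 * ∑ k ∈ Icc 1 ((p - 1) / 2), (k : ZMod p) ^ 2 * (n k : ZMod p) := by
      rw [mul_sum]
      refine sum_congr rfl fun k _ => ?_
      rw [ZMod.natCast_self]
      linear_combination (12 * (n k : ZMod p)) * hsq k
    rw [h5, ZMod.natCast_self]
    simp [h12, hr0]

end CrankSymmetry

end

noncomputable section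

namespace CrankSymmetry

open Filter Topology Finset Matrix MatrixGroups

/-! ### Separation of the weights -/

/-- Coordinate functionals of a linearly independent family. -/
lemma exists_coordinate {ι V : Type*} [AddCommGroup V] [Module ℂ V] [DecidableEq ι] {F : ι → V}
    (h : LinearIndependent ℂ F) (i : ι) :
    ∃ Λ : V →ₗ[ℂ] ℂ, ∀ j, Λ (F j) = if j = i then 1 else 0 := by
  obtain ⟨Λ, hΛ⟩ := LinearMap.exists_extend ((Finsupp.lapply i).comp h.repr)
  refine ⟨Λ, fun j => ?_⟩
  have h1 := LinearMap.congr_fun hΛ ⟨F j, Submodule.subset_span ⟨j, rfl⟩⟩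
  simp only [LinearMap.comp_apply, Submodule.subtype_apply] at h1
  rw [h1, h.repr_eq_single j _ rfl]
  simp [Finsupp.single_apply]

/-- Linear independence of the powers of infinitely many numbers. -/
lemma sum_filter_eq_zero_of_zpow {ι : Type*} [Fintype ι] (g : ι → ℂ) (w : ι → ℤ) {x y : ℂ}
    (hy : y ≠ 0) (hxy : ∀ N : ℕ, x + N * y ≠ 0)
    (h : ∀ N : ℕ, ∑ i, g i * (x + N * y) ^ w i = 0) (v : ℤ) :
    ∑ i with w i = v, g i = 0 := by
  classical
  set E : ℕ := (∑ i, (w i).natAbs) + v.natAbs with hE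
  have hE1 : ∀ i, 0 ≤ w i + E := fun i => by
    have h1 : (w i).natAbs ≤ ∑ i, (w i).natAbs := single_le_sum (f := fun i => (w i).natAbs)
      (fun _ _ => Nat.zero_le _) (mem_univ i)
    omega
  set P : Polynomial ℂ := ∑ i, Polynomial.C (g i) * Polynomial.X ^ (w i + E).toNat with hP
  have hroot : ∀ N : ℕ, P.IsRoot (x + N * y) := by
    intro N
    rw [Polynomial.IsRoot, hP, Polynomial.eval_finsetSum]
    have h1 := congrArg (fun a => a * (x + N * y) ^ E) (h N)
    simp only [zero_mul, sum_mul] at h1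
    rw [← h1]
    refine sum_congr rfl fun i _ => ?_
    rw [Polynomial.eval_mul, Polynomial.eval_C, Polynomial.eval_pow, Polynomial.eval_X,
      ← zpow_natCast, Int.toNat_of_nonneg (hE1 i), zpow_add₀ (hxy N), zpow_natCast, mul_assoc]
  have hP0 : P = 0 := by
    refine Polynomial.eq_zero_of_infinite_isRoot P (Set.infinite_of_injective_forall_mem
      (f := fun N : ℕ => x + N * y) (fun N M hNM => ?_) hroot)
    simpa [hy] using hNM
  have h2 := congrArg (fun P => Polynomial.coeff P (v + E).toNat) hP0
  simp only [hP, Polynomial.finsetSum_coeff, Polynomial.coeff_C_mul, Polynomial.coeff_X_pow,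
    Polynomial.coeff_zero, mul_ite, mul_one, mul_zero] at h2
  rw [sum_filter, ← h2]
  refine sum_congr rfl fun i _ => ?_
  have := hE1 i
  congr 1
  simp only [eq_iff_iff]
  omega

lemma autFactor_vadd (A : SL(2, ℤ)) (N : ℕ) (z : ℍ) :
    autFactor A ((N : ℝ) +ᵥ z : ℍ) = autFactor A z + N * (A 1 0 : ℂ) := by
  rw [autFactor, autFactor, UpperHalfPlane.coe_vadd]
  push_cast
  ring

lemma eq_of_vadd_one {F : ℍ → ℂ} (hF : ∀ z, F ((1 : ℝ) +ᵥ z) = F z) (N : ℕ) (z : ℍ) :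
    F ((N : ℝ) +ᵥ z) = F z := by
  induction N with
  | zero => simp
  | succ N ih =>
    rw [show ((N + 1 : ℕ) : ℝ) = 1 + N by push_cast; ring, add_vadd, hF, ih]

/-- The indices `(k, r)` of the terms. -/
abbrev PairIndex (t p : ℕ) := Fin t × Icc 1 ((p - 1) / 2)

/-- The relation at Az is compared with the conjugate relation at z. The index map σ sends only (k,
d) to (k, 1), so the coordinate at (k, 1) relates c_d(ζ) to c_1(ζ^d). -/
theorem aeval_zeta_eq {p : ℕ} (hp : p.Prime) (h3 : 3 < p) {t : ℕ} (n : Fin t → ℕ → ℤ)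
    (c : ℕ → Fin t → Polynomial ℚ)
    (hlin : LinearIndependent ℚ (fun x : Fin t × Icc 1 ((p - 1) / 2) =>
      (etaQuot p (vecPerm p x.2 (n x.1)) : ℍ → ℂ)))
    (hK : ∀ z : ℍ, crankK p 0 1 z = ∑ x : Fin t × Icc 1 ((p - 1) / 2),
      Polynomial.aeval (zeta p) (c x.2 x.1) * etaQuot p (vecPerm p x.2 (n x.1)) z)
    {d : ℕ} (hd : d ∈ Icc 1 ((p - 1) / 2)) (A : SL(2, ℤ)) (hA : A 1 0 = p) (hA1 : A 1 1 = d)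
    (k : Fin t) :
    Polynomial.aeval (zeta p) (c d k) * (-1) ^ signL (n k) (A 0 0) (A 0 1) d p =
      (-1) ^ (d + 1) * (Complex.sin (Real.pi / p) / Complex.sin (Real.pi * d / p)) *
        Polynomial.aeval (zeta p ^ d) (c 1 k) := by
  classical
  have hFact := Fact.mk hp
  have hp0 := hp.ne_zero
  have hp' : (p : ℂ) ≠ 0 := by exact_mod_cast hp0
  have h1mem : (1 : ℕ) ∈ Icc 1 ((p - 1) / 2) := by rw [mem_Icc]; omega
  set F : PairIndex t p → ℍ → ℂ := fun x => etaQuot p (vecPerm p x.2 (n x.1)) with hF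
  set u : PairIndex t p → ℂ := fun x => Polynomial.aeval (zeta p) (c x.2 x.1) with hu
  set u' : PairIndex t p → ℂ := fun x => Polynomial.aeval (zeta p ^ d) (c x.2 x.1) with hu'
  have hlinC : LinearIndependent ℂ F := linearIndependent_complex (N := 24 * p) (by omega)
    (fun x => hasRationalExpansion_etaQuot hp0 _) hlin
  have hKd : ∀ z, crankK p 0 d z = ∑ x, u' x * F x z :=
    crankK_conj hp h3 _ _ hK hd
  set τ : ℂ := (-1) ^ (d + 1) * (Complex.sin (Real.pi / p) / Complex.sin (Real.pi * d / p)) with hτ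
  -- terms which are not invariant under translation do not occur
  have hbad : ∀ x : PairIndex t p, u x ≠ 0 → (24 * p : ℤ) ∣ cuspOrder p (vecPerm p x.2 (n x.1)) := by
    intro x hx
    rw [← exp_cuspOrder_eq_one_iff hp0]
    set lam : PairIndex t p → ℂ := fun x => Complex.exp (2 * Real.pi * Complex.I *
      (cuspOrder p (vecPerm p x.2 (n x.1)) / (24 * p))) with hlam
    have h1 : ∑ x, (u x * (lam x - 1)) • F x = 0 := by
      ext z
      have h2 := crankK_vadd p 1 z
      rw [hK, hK, ← sub_eq_zero, ← sum_sub_distrib] at h2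
      rw [Finset.sum_apply, Pi.zero_apply, ← h2]
      refine sum_congr rfl fun y _ => ?_
      rw [etaQuot_vadd hp0, Pi.smul_apply, smul_eq_mul]
      simp only [hu, hF, hlam]
      ring
    have h3 := Fintype.linearIndependent_iff.mp hlinC _ h1 x
    rcases mul_eq_zero.mp h3 with h | h
    · exact absurd h hx
    · exact sub_eq_zero.mp h
  set σ : PairIndex t p → PairIndex t p := fun x => (x.1, ⟨permIdx p d x.2, (permIdx_spec hp h3 hd x.2.2).1⟩) with hσ
  set i₀ : PairIndex t p := (k, ⟨1, h1mem⟩) with hi₀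
  set i₁ : PairIndex t p := (k, ⟨d, hd⟩) with hi₁
  have hσi : ∀ x, σ x = i₀ ↔ x = i₁ := by
    rintro ⟨k', r, hr⟩
    simp only [hσ, hi₀, hi₁, Prod.mk.injEq, Subtype.mk.injEq]
    refine and_congr_right fun _ => ?_
    obtain ⟨hs, h⟩ := permIdx_spec hp h3 hd hr
    constructor
    · intro h1
      rw [h1] at h
      refine (eq_of_cast_eq_or_neg hd hr ?_).symm
      simpa using h
    · rintro rfl
      refine eq_of_cast_eq_or_neg hs h1mem ?_
      have hr0 := natCast_ne_zero_of_mem_Icc hr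
      rcases h with h | h
      · left
        apply mul_left_cancel₀ hr0
        rw [h]; simp
      · right
        apply mul_left_cancel₀ hr0
        rw [h]; simp
  -- the action on the single terms
  have hterm : ∀ x : PairIndex t p, ∃ (a : ℂ) (w : ℤ), (∀ z, u x * F x (A • z) =
      a * autFactor A z ^ w * F (σ x) z) ∧ (a ≠ 0 → ∀ z, F (σ x) ((1 : ℝ) +ᵥ z) = F (σ x) z) ∧
      (x = i₁ → a = u x * (-1) ^ signL (n k) (A 0 0) (A 0 1) d p) := by
    rintro ⟨k', r, hr⟩
    by_cases hx : u (k', ⟨r, hr⟩) = 0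
    -- A term with zero coefficient need not be modular; a = 0 removes it.
    · exact ⟨0, 0, fun z => by rw [hx]; ring, fun h => absurd rfl h, fun _ => by rw [hx, zero_mul]⟩
    obtain ⟨⟨m, hm⟩, ⟨M, hM⟩⟩ := (dvd_cuspOrder_iff hp h3 hr _).mp (hbad _ hx)
    have hper : ∀ z, F (σ (k', ⟨r, hr⟩)) ((1 : ℝ) +ᵥ z) = F (σ (k', ⟨r, hr⟩)) z := by
      intro z
      have hdvd := (dvd_cuspOrder_iff hp h3 (permIdx_spec hp h3 hd hr).1 (n k')).mpr
        ⟨⟨m, hm⟩, ⟨M, hM⟩⟩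
      rw [← exp_cuspOrder_eq_one_iff hp0] at hdvd
      simp only [hF, hσ]
      rw [etaQuot_vadd hp0, hdvd, one_mul]
    by_cases hxi : ((k', ⟨r, hr⟩) : PairIndex t p) = i₁
    · have hk : k' = k := congrArg Prod.fst hxi
      have hr' : r = d := congrArg (fun x : PairIndex t p => (x.2 : ℕ)) hxi
      subst hk hr'
      refine ⟨_, 12 * m - ∑ k ∈ Icc 1 ((p - 1) / 2), n k' k, fun z => ?_, fun _ => hper, fun _ => rfl⟩
      rw [(hσi _).mpr hxi]
      simp only [hF, hi₀]
      rw [etaQuot_vecPerm_smul_self hp h3 hr (n k') hm hM A hA hA1]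
      ring
    · obtain ⟨ε, hε⟩ := etaQuot_vecPerm_smul hp h3 hr hd (n k') hm hM A hA hA1
      refine ⟨u (k', ⟨r, hr⟩) * ε, 12 * m - ∑ k ∈ Icc 1 ((p - 1) / 2), n k' k, fun z => ?_, fun _ => hper,
        fun h => absurd h hxi⟩
      simp only [hF, hσ]
      rw [hε]
      ring
  choose a w haw hper ha using hterm
  have hlaw : ∀ z, ∑ x, a x * F (σ x) z * autFactor A z ^ w x - τ * crankK p 0 d z * autFactor A z = 0 := by
    intro z
    have h1 := crankK_smul hp h3 hd A hA hA1 z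
    rw [hK] at h1
    have h2 : ∀ x, a x * F (σ x) z * autFactor A z ^ w x = u x * F x (A • z) := fun x => by
      rw [haw]; ring
    simp only [h2]
    rw [h1]
    ring
  -- Under z ↦ z+N the surviving functions and K are fixed while pz+d increases by Np, so each power
  -- of pz+d must balance separately. The extra index `none` carries the term of K, of weight 1.
  have hsep : ∀ v : ℤ, ∀ z, ∑ x with w x = v, a x * F (σ x) z =
      if v = 1 then τ * crankK p 0 d z else 0 := by
    intro v z
    have h1 := sum_filter_eq_zero_of_zpow (ι := Option (PairIndex t p))
      (fun o => o.elim (-(τ * crankK p 0 d z)) (fun x => a x * F (σ x) z))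
      (fun o => o.elim 1 w) (x := autFactor A z) (y := p) hp' (fun N => ?_) (fun N => ?_) v
    · rw [sum_filter, Fintype.sum_option] at h1
      change (if (1 : ℤ) = v then -(τ * crankK p 0 d z) else 0) +
        (∑ x, if w x = v then a x * F (σ x) z else 0) = 0 at h1
      rw [sum_filter]
      by_cases hv : v = 1
      · rw [if_pos hv.symm] at h1
        rw [if_pos hv]
        linear_combination h1
      · rw [if_neg (Ne.symm hv)] at h1
        rw [if_neg hv]
        linear_combination h1
    · have h2 := autFactor_vadd A N z
      rw [hA] at h2
      push_cast at h2
      rw [← h2]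
      exact autFactor_ne_zero A _
    · have h2 := autFactor_vadd A N z
      rw [hA] at h2
      push_cast at h2
      have h4 := hlaw ((N : ℝ) +ᵥ z)
      rw [h2, eq_of_vadd_one (crankK_vadd p d) N z] at h4
      rw [Fintype.sum_option, ← h4]
      simp only [Option.elim, zpow_one]
      have h5 : ∀ x, a x * F (σ x) ((N : ℝ) +ᵥ z) = a x * F (σ x) z := fun x => by
        by_cases hx : a x = 0
        · rw [hx, zero_mul, zero_mul]
        · rw [eq_of_vadd_one (hper x hx) N z]
      simp only [h5]
      ring
  obtain ⟨Λ, hΛ⟩ := exists_coordinate hlinC i₀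
  have hcoord : ∀ v : ℤ, (if w i₁ = v then a i₁ else 0) = if v = 1 then τ * u' i₀ else 0 := by
    intro v
    have h1 : ∑ x with w x = v, a x • F (σ x) =
        if v = 1 then ∑ x, (τ * u' x) • F x else 0 := by
      ext z
      have h2 := hsep v z
      rw [hKd z] at h2
      split_ifs at h2 ⊢
      · simpa [Finset.sum_apply, mul_sum, mul_assoc] using h2
      · simpa [Finset.sum_apply] using h2
    have h2 := congrArg Λ h1
    rw [map_sum, apply_ite Λ, map_sum] at h2
    simp only [map_smul, hΛ, hσi, smul_eq_mul, mul_ite, mul_one, mul_zero, map_zero, sum_ite_eq',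
      mem_filter, mem_univ, true_and, if_true] at h2
    exact h2
  have hfinal : a i₁ = τ * u' i₀ := by
    have h1 := hcoord (w i₁)
    have h2 := hcoord 1
    -- If the weight of the term i₁ is not 1, comparing the weights w i₁ and 1 shows that both sides
    -- vanish, so the equality holds anyway.
    by_cases h : w i₁ = 1
    · simpa [h] using h1
    · simp only [if_true, if_neg h] at h1 h2
      rw [h1, ← h2]
  rw [ha i₁ rfl] at hfinal
  exact hfinal

end CrankSymmetry

end

/-! ### The symmetry of the coefficients -/

theorem theorem3p2 (p : ℕ) (hp : p.Prime) (h3 : 3 < p) (t : ℕ) (n : Fin t → ℕ → ℤ)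
    (c : ℕ → Fin t → Polynomial ℚ)
    (hlin : LinearIndependent ℚ
      (fun x : Fin t × Finset.Icc 1 ((p - 1) / 2) =>
        (CrankSymmetry.etaQuot p (CrankSymmetry.vecPerm p x.2 (n x.1)) : ℍ → ℂ)))
    (hK : ∀ z : ℍ, CrankSymmetry.crankK p 0 1 z =
      ∑ k : Fin t, ∑ r ∈ Finset.Icc 1 ((p - 1) / 2),
        Polynomial.aeval (CrankSymmetry.zeta p) (c r k) *
          CrankSymmetry.etaQuot p (CrankSymmetry.vecPerm p r (n k)) z)
    (d : ℕ) (hd : d ∈ Finset.Icc 1 ((p - 1) / 2)) (a b : ℤ)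
    (hA : (!![a, b; (p : ℤ), (d : ℤ)] : Matrix (Fin 2) (Fin 2) ℤ).det = 1) (k : Fin t) :
    Polynomial.aeval (CrankSymmetry.zeta p) (c d k) =
      ((Real.sin (Real.pi / p) / Real.sin (d * Real.pi / p) : ℝ) : ℂ) *
        (-1) ^ ((d : ℤ) + 1 + CrankSymmetry.signL (n k) a b d p) *
        Polynomial.aeval (CrankSymmetry.zeta p ^ d) (c 1 k) := by
  have h := CrankSymmetry.aeval_zeta_eq hp h3 n c hlin (fun z => by
    rw [hK z, Fintype.sum_prod_type]
    exact Finset.sum_congr rfl fun k _ => (Finset.sum_coe_sort (Finset.Icc 1 ((p - 1) / 2)) fun r =>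
      Polynomial.aeval (CrankSymmetry.zeta p) (c r k) *
        CrankSymmetry.etaQuot p (CrankSymmetry.vecPerm p r (n k)) z).symm) hd ⟨_, hA⟩ rfl rfl k
  -- The sign (-1)^L is its own inverse and can be moved to the other side.
  have hL := CrankSymmetry.neg_one_zpow_sq (CrankSymmetry.signL (n k) a b d p)
  change _ * (-1) ^ CrankSymmetry.signL (n k) a b d p = _ at h
  rw [zpow_add₀ (by norm_num), show ((d : ℤ) + 1) = ((d + 1 : ℕ) : ℤ) by push_cast; rfl, zpow_natCast]
  push_cast
  rw [mul_comm (d : ℂ)]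
  linear_combination ((-1 : ℂ) ^ CrankSymmetry.signL (n k) a b d p) * h -
    Polynomial.aeval (CrankSymmetry.zeta p) (c d k) * hL
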